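/- **Setting.** Let $n\ge 1$, let $[n]=\{1,\dots,n\}$, let $\mathfrak S_n$ be the group of permutations of $[n]$, let $\mu=(\mu_1\ge\dots\ge\mu_n\ge 0)$ be a partition with at most $n$ parts, and let $S$ be a semistandard Young tableau of shape $\mu$ (rows weakly increasing rightward, columns strictly increasing downward) with entries in $[n]$. Let $S_\mu=\{w\in\mathfrak S_n : \mu_{w^{-1}(i)}=\mu_i \text{ for all } i\}$ be the stabiliser of $\mu$. Let $c$ be the number of non-empty columns of $S$, and $b(1)\ge\dots\ge b(c)$ the numbers of boxes in them. **Key tableaux and cosets.** A permutation $\sigma=\sigma_1\dots\sigma_n$ (one-line notation) determines the key tableau of shape $\mu$ whose entries in any column with $k$ boxes are $\sigma_1,\dots,\sigma_k$ arranged in increasing order. Two permutations determine the same key tableau if and only if they lie in the same left coset of $S_\mu$; in this way key tableaux of shape $\mu$ are identified with left cosets of $S_\mu$. **Left key.** The left key of $S$ is the tableau of shape $\mu$ whose $j$-th column ($1\le j\le c$) is obtained as follows. Take any rearrangement of $(b(1),\dots,b(c))$ whose first entry is $b(j)$ and any skew shape whose successive columns have these numbers of boxes; from $S$ one obtains, by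 jeu de taquin, a semistandard tableau of this skew shape, and the entries of its first column are the entries of the $j$-th column of the left key. (That such a tableau exists for each choice and that the result does not depend on the choices is part of the assertion below.) **The procedure.** For a non-empty semistandard tableau $T$ with non-empty columns $T(1),\dots,T(d)$, let $v_d$ be the biggest entry of $T(d)$ and, for $i=d-1,\dots,1$, let $v_i$ be the biggest entry of $T(i)$ that is at most $v_{i+1}$. Put $w(T)=v_1$, and let $T'$ be the tableau obtained from $T$ by deleting, for each $i$, the box of column $i$ containing $v_i$ and pushing the remaining boxes up. Let $p$ be the number of non-zero parts of $\mu$, put $S_1=S$, and for $1\le j\le p$ put $\tau_j=w(S_j)$ and $S_{j+1}=S_j'$. Let $\tau_{p+1},\dots,\tau_n$ be the elements of $[n]\setminus\{\tau_1,\dots,\tau_p\}$ in decreasing order. **Theorem.** The word $\tau=\tau_1\dots\tau_n$ is the one-line notation of a permutation in $\mathfrak S_n$, and: 1. the left key of $S$ is the coset $\tau S_\mu$, that is, the key tableau of shape $\mu$ determined by $\tau$; 2. $\tau$ is the unique maximal element of the coset $\tau S_\mu$ in the Bruhat order on $\mathfrak S_n$. -/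

import Mathlib

open scoped Pointwise

/-! ## Conventions

Partitions are Young diagrams in English notation; rows, columns and positions are numbered from
`0`, and `[n]` is the set `{0, …, n - 1}` (the order-preserving relabelling of `{1, …, n}`), so that
permutations of `[n]` are elements of `Equiv.Perm (Fin n)` and the one-line notation of `σ` is
`σ 0, σ 1, …, σ (n - 1)`.  A partition `μ` has parts `μ.rowLen 0 ≥ μ.rowLen 1 ≥ …`, its number of
non-zero parts is `μ.colLen 0`, and its number of non-empty columns is `μ.rowLen 0`. -/

namespace LeftKey

/-! ### The symmetric group: stabiliser of a partition and Bruhat order -/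

/-- The stabiliser of the composition `i ↦ μ_i` under the action `(w f) i = f (w⁻¹ i)`. -/
def partStabilizer (n : ℕ) (μ : YoungDiagram) : Subgroup (Equiv.Perm (Fin n)) where
  carrier := {w | ∀ i : Fin n, μ.rowLen (w⁻¹ i : Fin n) = μ.rowLen i}
  one_mem' := by intro i; simp
  mul_mem' := by
    intro a b ha hb i
    rw [mul_inv_rev, Equiv.Perm.mul_apply, hb, ha]
  inv_mem' := by
    intro a ha i
    have h := ha (a i)
    simp only [Equiv.Perm.inv_def, Equiv.symm_apply_apply] at h
    rw [inv_inv, h]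

/-- The left coset `τ S_μ`. -/
def leftCoset {n : ℕ} (τ : Equiv.Perm (Fin n)) (μ : YoungDiagram) : Set (Equiv.Perm (Fin n)) :=
  τ • (partStabilizer n μ : Set (Equiv.Perm (Fin n)))

/-- The length of a permutation: its number of inversions. -/
def permLength {n : ℕ} (σ : Equiv.Perm (Fin n)) : ℕ :=
  (Finset.univ.filter fun ij : Fin n × Fin n => ij.1 < ij.2 ∧ σ ij.2 < σ ij.1).card

/-- The Bruhat order: the reflexive transitive closure of `u → u t`, where `t` is a transposition
such that `u t` is longer than `u`. -/
def BruhatLE {n : ℕ} : Equiv.Perm (Fin n) → Equiv.Perm (Fin n) → Prop :=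
  Relation.ReflTransGen fun u v => ∃ t : Equiv.Perm (Fin n),
    t.IsSwap ∧ v = u * t ∧ permLength u < permLength v

/-- `ρ` is a maximal element of `A` in the Bruhat order. -/
def IsBruhatMaximal {n : ℕ} (A : Set (Equiv.Perm (Fin n))) (ρ : Equiv.Perm (Fin n)) : Prop :=
  ρ ∈ A ∧ ∀ σ ∈ A, BruhatLE ρ σ → σ = ρ

/-! ### Columns of a tableau and key tableaux -/

/-- The set of entries in column `j` of a tableau. -/
def column {μ : YoungDiagram} (S : SemistandardYoungTableau μ) (j : ℕ) : Finset ℕ :=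
  (Finset.range (μ.colLen j)).image fun i => S i j

/-- The set of the first `k` letters of the one-line notation of `σ`. -/
def initialLetters {n : ℕ} (σ : Equiv.Perm (Fin n)) (k : ℕ) : Finset ℕ :=
  (Finset.univ.filter fun i : Fin n => (i : ℕ) < k).image fun i => (σ i : ℕ)

theorem card_initialLetters {n : ℕ} (σ : Equiv.Perm (Fin n)) {k : ℕ} (hk : k ≤ n) :
    (initialLetters σ k).card = k := by
  rw [initialLetters, Finset.card_image_of_injective _
    (fun a b h => σ.injective (Fin.ext h)), Fin.card_filter_val_lt, min_eq_right hk]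

theorem initialLetters_mono {n : ℕ} (σ : Equiv.Perm (Fin n)) {k l : ℕ} (h : k ≤ l) :
    initialLetters σ k ⊆ initialLetters σ l := by
  apply Finset.image_subset_image
  intro i hi
  simp only [Finset.mem_filter, Finset.mem_univ, true_and] at hi ⊢
  omega

theorem finite_mem (s : Finset ℕ) : {x | x ∈ s}.Finite := s.finite_toSet

theorem card_finite_mem (s : Finset ℕ) (hf : {x | x ∈ s}.Finite) : hf.toFinset.card = s.card := by
  congr 1
  ext x
  simp

/-- The key tableau of shape `μ` determined by `σ`: the entries of a column with `k` boxes are the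
first `k` letters `σ 0, …, σ (k - 1)`, arranged in increasing order.  (`Nat.nth (· ∈ s) i` is the
`i`-th smallest element of the finite set `s`, counting from `0`, and is `0` for `i ≥ s.card`.) -/
noncomputable def keyTableau {n : ℕ} (μ : YoungDiagram) (hμ : μ.colLen 0 ≤ n)
    (σ : Equiv.Perm (Fin n)) : SemistandardYoungTableau μ where
  entry i j := Nat.nth (· ∈ initialLetters σ (μ.colLen j)) i
  row_weak' := by
    classical
    intro i j1 j2 hj hc
    have hc2 : i < μ.colLen j2 := YoungDiagram.mem_iff_lt_colLen.mp hc
    have h12 : μ.colLen j2 ≤ μ.colLen j1 := μ.colLen_anti j1 j2 hj.le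
    have hn1 : μ.colLen j1 ≤ n := (μ.colLen_anti 0 j1 (Nat.zero_le _)).trans hμ
    have hsub := initialLetters_mono σ h12
    have hcard2 := card_initialLetters σ (h12.trans hn1)
    have hcard1 := card_initialLetters σ hn1
    generalize initialLetters σ (μ.colLen j2) = E at *
    generalize initialLetters σ (μ.colLen j1) = F at *
    have hiE : ∀ hf : {x | x ∈ E}.Finite, i < hf.toFinset.card := by
      intro hf
      rw [card_finite_mem, hcard2]
      exact hc2
    have hx : Nat.nth (· ∈ E) i ∈ E := Nat.nth_mem i hiE
    have hcount : Nat.count (· ∈ E) (Nat.nth (· ∈ E) i) = i := Nat.count_nth hiE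
    generalize Nat.nth (· ∈ E) i = x at *
    have hmono : i ≤ Nat.count (· ∈ F) x := by
      rw [← hcount]
      exact Nat.count_mono_left (fun _ _ h => hsub h)
    have hF : Nat.nth (· ∈ F) (Nat.count (· ∈ F) x) = x := Nat.nth_count (hsub hx)
    calc Nat.nth (· ∈ F) i ≤ Nat.nth (· ∈ F) (Nat.count (· ∈ F) x) :=
          Nat.nth_le_nth' hmono (fun hf => Nat.count_lt_card hf (hsub hx))
      _ = x := hF
  col_strict' := by
    intro i1 i2 j hi hc
    have hc2 : i2 < μ.colLen j := YoungDiagram.mem_iff_lt_colLen.mp hc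
    have hn : μ.colLen j ≤ n := (μ.colLen_anti 0 j (Nat.zero_le _)).trans hμ
    apply Nat.nth_lt_nth' hi
    intro hf
    rw [card_finite_mem, card_initialLetters σ hn]
    exact hc2
  zeros' := by
    intro i j hc
    have hc2 : μ.colLen j ≤ i := by
      by_contra h
      exact hc (YoungDiagram.mem_iff_lt_colLen.mpr (not_le.mp h))
    have hn : μ.colLen j ≤ n := (μ.colLen_anti 0 j (Nat.zero_le _)).trans hμ
    apply Nat.nth_of_card_le (finite_mem _)
    rw [card_finite_mem, card_initialLetters σ hn]
    exact hc2

/-! ### Skew tableaux, jeu de taquin, and the left key -/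

/-- A semistandard tableau of skew shape `outer / inner`; `entry (i, j)` is the entry in row `i` and
column `j`, and is set to `0` off the shape. -/
structure SkewTableau where
  outer : YoungDiagram
  inner : YoungDiagram
  inner_le : inner ≤ outer
  entry : ℕ × ℕ → ℕ
  row_weak : ∀ i j₁ j₂ : ℕ, j₁ < j₂ → (i, j₁) ∉ inner → (i, j₂) ∈ outer →
    entry (i, j₁) ≤ entry (i, j₂)
  col_strict : ∀ i₁ i₂ j : ℕ, i₁ < i₂ → (i₁, j) ∉ inner → (i₂, j) ∈ outer →
    entry (i₁, j) < entry (i₂, j)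
  zeros : ∀ c : ℕ × ℕ, c ∉ outer ∨ c ∈ inner → entry c = 0

/-- A semistandard Young tableau, as a skew tableau with empty inner shape. -/
def SkewTableau.ofStraight {μ : YoungDiagram} (S : SemistandardYoungTableau μ) : SkewTableau where
  outer := μ
  inner := ⊥
  inner_le := bot_le
  entry c := S c.1 c.2
  row_weak _ _ _ hj _ hc := S.row_weak hj hc
  col_strict _ _ _ hi _ hc := S.col_strict hi hc
  zeros c hc := S.zeros (hc.resolve_right (YoungDiagram.notMem_bot c))

/-- One move of a jeu de taquin slide inside the outer shape `D`.  A state is a filling together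
with the position of the hole.  Of the entries immediately to the right of and below the hole, the
smaller one moves into the hole, the one below if they are equal (or the only one, if just one of
the two boxes is in `D`), and its former box becomes the hole. -/
inductive HoleMove (D : YoungDiagram) : (ℕ × ℕ → ℕ) × (ℕ × ℕ) → (ℕ × ℕ → ℕ) × (ℕ × ℕ) → Prop
  | up (e : ℕ × ℕ → ℕ) (i j : ℕ) (hD : (i + 1, j) ∈ D)
      (hle : (i, j + 1) ∈ D → e (i + 1, j) ≤ e (i, j + 1)) :
      HoleMove D (e, (i, j))
        (Function.update (Function.update e (i, j) (e (i + 1, j))) (i + 1, j) 0, (i + 1, j))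
  | left (e : ℕ × ℕ → ℕ) (i j : ℕ) (hD : (i, j + 1) ∈ D)
      (hlt : (i + 1, j) ∈ D → e (i, j + 1) < e (i + 1, j)) :
      HoleMove D (e, (i, j))
        (Function.update (Function.update e (i, j) (e (i, j + 1))) (i, j + 1) 0, (i, j + 1))

/-- `T'` is obtained from `T` by one jeu de taquin slide: the hole starts at a corner `h` of the
inner shape and moves until there is no box to its right or below it, at a corner `h'` of the outer
shape; `h` is then removed from the inner shape and `h'` from the outer shape. -/
def Slide (T T' : SkewTableau) : Prop :=
  ∃ h h' : ℕ × ℕ,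
    h ∈ T.inner ∧ (h.1 + 1, h.2) ∉ T.inner ∧ (h.1, h.2 + 1) ∉ T.inner ∧
    Relation.ReflTransGen (HoleMove T.outer) (T.entry, h) (T'.entry, h') ∧
    (h'.1 + 1, h'.2) ∉ T.outer ∧ (h'.1, h'.2 + 1) ∉ T.outer ∧
    T'.inner.cells = T.inner.cells.erase h ∧ T'.outer.cells = T.outer.cells.erase h'

/-- The skew tableau `T` is obtained from the tableau `S` by the jeu de taquin process (reverse
slides starting from `S`); equivalently, slides starting from `T` lead to `S`. -/
def IsJeuDeTaquinOf {μ : YoungDiagram} (T : SkewTableau) (S : SemistandardYoungTableau μ) : Prop :=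
  Relation.ReflTransGen Slide T (SkewTableau.ofStraight S)

/-- The numbers of boxes in the successive columns of the skew shape `lam / nu`. -/
def columnLengths (lam nu : YoungDiagram) : List ℕ :=
  (List.range (lam.rowLen 0)).map fun j => lam.colLen j - nu.colLen j

/-- The set of entries in the first column of a skew tableau. -/
def SkewTableau.firstColumn (T : SkewTableau) : Finset ℕ :=
  ((T.outer.cells \ T.inner.cells).filter fun c => c.2 = 0).image T.entry

/-- `K` is the left key of `S`: for each column `j` and for every skew shape `lam / nu` whose
sequence of column lengths is a permutation of that of `S` beginning with the length of column `j`,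
a tableau of shape `lam / nu` can be obtained from `S` by jeu de taquin, and the first column of any
such tableau is the `j`-th column of `K`. -/
def IsLeftKey {μ : YoungDiagram} (S K : SemistandardYoungTableau μ) : Prop :=
  ∀ j < μ.rowLen 0, ∀ lam nu : YoungDiagram, nu ≤ lam →
    (columnLengths lam nu).Perm (columnLengths μ ⊥) →
    (columnLengths lam nu).head? = some (μ.colLen j) →
    (∃ T : SkewTableau, T.outer = lam ∧ T.inner = nu ∧ IsJeuDeTaquinOf T S) ∧
    ∀ T : SkewTableau, T.outer = lam → T.inner = nu → IsJeuDeTaquinOf T S →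
      T.firstColumn = column K j

/-! ### The crossing-out procedure

In this procedure a semistandard tableau is recorded by the list of the entry sets of its non-empty
columns, from left to right; deleting a box of a column and pushing up the remaining ones amounts to
removing the entry from the set. -/

/-- The list of the non-empty columns of `S`. -/
def columns {μ : YoungDiagram} (S : SemistandardYoungTableau μ) : List (Finset ℕ) :=
  (List.range (μ.rowLen 0)).map (column S)

/-- The crossing-out line `v_1, …, v_c`: `v_c` is the biggest entry in the last column, and `v_i`
for `i < c` is the biggest entry in column `i` that is at most `v_{i+1}`. -/
def crossingLine : List (Finset ℕ) → List ℕ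
  | [] => []
  | C :: L =>
    match crossingLine L with
    | [] => [C.sup id]
    | v :: vs => (C.filter (· ≤ v)).sup id :: v :: vs

/-- The number `w(S) = v_1`. -/
def lineHead (L : List (Finset ℕ)) : ℕ := (crossingLine L).headD 0

/-- The tableau `S'`: delete the boxes on the crossing-out line (and discard the columns that have
become empty). -/
def crossOut (L : List (Finset ℕ)) : List (Finset ℕ) :=
  (List.zipWith (fun C v => C.erase v) L (crossingLine L)).filter fun C => decide C.Nonempty

/-- The numbers `w(S_1), …, w(S_p)`, where `S_1 = S` and `S_{j+1} = S_j'`. -/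
def lineHeads : ℕ → List (Finset ℕ) → List ℕ
  | 0, _ => []
  | p + 1, L => lineHead L :: lineHeads p (crossOut L)

/-- The one-line notation `τ_1 … τ_n` produced by the procedure: first the `p` numbers
`w(S_1), …, w(S_p)`, where `p` is the number of parts of `μ`, and then the remaining elements of
`[n]` in decreasing order. -/
def leftKeyWord (n : ℕ) {μ : YoungDiagram} (S : SemistandardYoungTableau μ) : List ℕ :=
  let heads := lineHeads (μ.colLen 0) (columns S)
  heads ++ ((List.range n).filter fun x => decide (x ∉ heads)).reverse

end LeftKey

/-!
Write a filling of a skew shape as the zero-one matrix that records which letters occur in which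
columns. Such matrices carry two crystal structures. The raising operators of the first one
(`ColRaise`) move a letter to the column on its left, those of the second one (`RowRaise`) replace a
letter `i + 1` by `i` within a column; they are defined by bracketing rules, and they commute
(`ColRaise.commute`). The proof translates jeu de taquin into the first structure and uses the
second one to reduce to a trivial case.

*Translation.* A vertical move of the hole does not change the matrix, and a horizontal one is a
raising operator on the columns (`IsHoleTableau.left`), so slides form a path of raising operators
(`colPath_of_slides`). Straight tableaux have highest weight matrices, and a matrix fits a skew
shape when its column excesses are at most the offsets of the columns (`exists_skewTableau`).

*Reduction.* A matrix that is highest for both crystals is determined by the multiplicities of its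
letters (`eq_of_highest`). Raising the letters of `S` as far as possible leads to such a matrix, and
transports every matrix that can be raised to `S` to one with the same column lengths. If these lengths
are those of `S` in another order, then the columns of the transported matrix have to be initial
segments (`column_eq_of_sameLengths`). Going back along the path of letter operators gives the
uniqueness of the first column (`column_zero_unique`) and the existence of a tableau on each
rearranged skew shape that rectifies to `S` (`exists_rearrangement`, `exists_jeuDeTaquin`).

*The procedure.* By uniqueness, any matrix with rearranged column lengths may be used to compute the
left key. Exchanging the lengths of two adjacent columns by lowering operators keeps in the left
column exactly the letters that are matched with letters of the right one (`exists_exchange`). The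
set of matched letters is found by a greedy choice that treats the letters of the right column in
any order (`picks_spec`); in the order in which the procedure crosses them out, the greedy choices are
the numbers that it crosses out in the left column (`lineHeads_cons_cons`). Hence moving the `j`-th
column to the front produces the first numbers that the procedure crosses out
(`exists_front_rearrangement`), and these are the initial letters of `τ`.

*Bruhat order.* Each line that does not use up a column is followed by one that lies strictly below
it (`IsTableau.lineHead_crossOut_lt`). Hence `τ` decreases on the positions of equal parts of `μ`. A
coset has only one such element, every other element is below a longer one of the coset, and so `τ`
is the only maximal element (`IsBlockDecreasing.isBruhatMaximal_iff`).
-/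

namespace LeftKey

/-! ### Two commuting crystal structures on zero-one matrices -/

/-- The matrix `M` (columns `c`, letters `x`) has entries `0` and `1`, and is supported on the
columns `c < m` and the letters `x < n`. -/
structure IsZeroOne (m n : ℕ) (M : ℕ → ℕ → ℤ) : Prop where
  zero_or_one : ∀ c x, M c x = 0 ∨ M c x = 1
  col_bound : ∀ c x, m ≤ c → M c x = 0
  row_bound : ∀ c x, n ≤ x → M c x = 0

/-- The excess of column `j + 1` over column `j` among the letters `< y`. -/
def colHt (j : ℕ) (M : ℕ → ℕ → ℤ) (y : ℕ) : ℤ :=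
  ∑ x ∈ Finset.range y, (M (j + 1) x - M j x)

/-- The excess of the letter `i + 1` over the letter `i` among the columns `< y`. -/
def rowHt (i : ℕ) (M : ℕ → ℕ → ℤ) (y : ℕ) : ℤ :=
  ∑ c ∈ Finset.range y, (M c (i + 1) - M c i)

/-- The first maximum of `H` is attained at `x + 1`. -/
def IsFirstMax (H : ℕ → ℤ) (x : ℕ) : Prop :=
  (∀ y ≤ x, H y < H (x + 1)) ∧ ∀ y, x < y → H y ≤ H (x + 1)

/-- The last minimum of `P` is attained at `c`. -/
def IsLastMin (P : ℕ → ℤ) (c : ℕ) : Prop :=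
  (∀ y ≤ c, P c ≤ P y) ∧ ∀ y, c < y → P c < P y

/-- Move a letter `x` from column `j + 1` to column `j`. -/
def colMove (j x : ℕ) (M : ℕ → ℕ → ℤ) : ℕ → ℕ → ℤ := fun c z =>
  M c z + (if c = j ∧ z = x then 1 else 0) - (if c = j + 1 ∧ z = x then 1 else 0)

/-- Replace a letter `i + 1` of column `c` by `i`. -/
def rowMove (i c : ℕ) (M : ℕ → ℕ → ℤ) : ℕ → ℕ → ℤ := fun d z =>
  M d z + (if d = c ∧ z = i then 1 else 0) - (if d = c ∧ z = i + 1 then 1 else 0)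

/-- The raising operator of the crystal structure on the columns: bracket the letters of column `j`
(opening) with those of column `j + 1` (closing), and move the largest unmatched letter of column
`j + 1` to column `j`. -/
def ColRaise (j : ℕ) (M N : ℕ → ℕ → ℤ) : Prop :=
  ∃ x, IsFirstMax (colHt j M) x ∧ N = colMove j x M

/-- The raising operator of the crystal structure on the letters: bracket the letters `i + 1` and
`i` along the columns, and lower the rightmost unmatched `i + 1` to `i`. -/
def RowRaise (i : ℕ) (M N : ℕ → ℕ → ℤ) : Prop :=
  ∃ c, IsLastMin (rowHt i M) c ∧ N = rowMove i c M

variable {m n i j : ℕ} {M N M' N' : ℕ → ℕ → ℤ}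

theorem colHt_succ (j : ℕ) (M : ℕ → ℕ → ℤ) (y : ℕ) :
    colHt j M (y + 1) = colHt j M y + (M (j + 1) y - M j y) := Finset.sum_range_succ _ _

theorem rowHt_succ (i : ℕ) (M : ℕ → ℕ → ℤ) (y : ℕ) :
    rowHt i M (y + 1) = rowHt i M y + (M y (i + 1) - M y i) := Finset.sum_range_succ _ _

theorem colHt_colMove (j x : ℕ) (M : ℕ → ℕ → ℤ) (y : ℕ) :
    colHt j (colMove j x M) y = colHt j M y - if x < y then 2 else 0 := by
  induction y with
  | zero => simp [colHt]
  | succ y ih =>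
    simp only [colHt_succ, ih, colMove, true_and]
    split_ifs <;> omega

theorem rowHt_rowMove (i c : ℕ) (M : ℕ → ℕ → ℤ) (y : ℕ) :
    rowHt i (rowMove i c M) y = rowHt i M y - if c < y then 2 else 0 := by
  induction y with
  | zero => simp [rowHt]
  | succ y ih =>
    simp only [rowHt_succ, ih, rowMove, and_true]
    split_ifs <;> omega

theorem colHt_rowMove (j i c : ℕ) (M : ℕ → ℕ → ℤ) (y : ℕ) :
    colHt j (rowMove i c M) y = colHt j M y +
      if y = i + 1 then (if c = j + 1 then 1 else if c = j then -1 else 0) else 0 := by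
  induction y with
  | zero => simp [colHt]
  | succ y ih =>
    simp only [colHt_succ, ih, rowMove]
    rcases eq_or_ne c j with rfl | h1
    · split_ifs <;> omega
    · rcases eq_or_ne c (j + 1) with rfl | h2 <;> split_ifs <;> omega

theorem rowHt_colMove (i j x : ℕ) (M : ℕ → ℕ → ℤ) (y : ℕ) :
    rowHt i (colMove j x M) y = rowHt i M y +
      if y = j + 1 then (if x = i + 1 then 1 else if x = i then -1 else 0) else 0 := by
  induction y with
  | zero => simp [rowHt]
  | succ y ih =>
    simp only [rowHt_succ, ih, colMove]
    rcases eq_or_ne x i with rfl | h1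
    · split_ifs <;> omega
    · rcases eq_or_ne x (i + 1) with rfl | h2 <;> split_ifs <;> omega

theorem IsZeroOne.colRaise (hM : IsZeroOne m n M) (h : ColRaise j M N) : IsZeroOne m n N := by
  obtain ⟨x, hx, rfl⟩ := h
  have h1 := hx.1 x le_rfl
  rw [colHt_succ] at h1
  have ha := hM.zero_or_one (j + 1) x
  have hb := hM.zero_or_one j x
  have hjm : j + 1 < m := by
    by_contra hc
    have := hM.col_bound (j + 1) x (by omega)
    omega
  have hxn : x < n := by
    by_contra hc
    have := hM.row_bound (j + 1) x (by omega)
    omega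
  refine ⟨fun c z => ?_, fun c z hc => ?_, fun c z hz => ?_⟩
  · have hc := hM.zero_or_one c z
    unfold colMove
    split_ifs with h1 h2 h2
    · omega
    · obtain ⟨rfl, rfl⟩ := h1; omega
    · obtain ⟨rfl, rfl⟩ := h2; omega
    · omega
  · have := hM.col_bound c z hc
    unfold colMove
    split_ifs <;> omega
  · have := hM.row_bound c z hz
    unfold colMove
    split_ifs <;> omega

theorem IsZeroOne.rowRaise (hM : IsZeroOne m n M) (h : RowRaise i M N) : IsZeroOne m n N := by
  obtain ⟨x, hx, rfl⟩ := h
  have h1 := hx.2 (x + 1) (by omega)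
  rw [rowHt_succ] at h1
  have ha := hM.zero_or_one x (i + 1)
  have hb := hM.zero_or_one x i
  have hjm : x < m := by
    by_contra hc
    have := hM.col_bound x (i + 1) (by omega)
    omega
  have hxn : i + 1 < n := by
    by_contra hc
    have := hM.row_bound x (i + 1) (by omega)
    omega
  refine ⟨fun c z => ?_, fun c z hc => ?_, fun c z hz => ?_⟩
  · have hc := hM.zero_or_one c z
    unfold rowMove
    split_ifs with h1 h2 h2
    · omega
    · obtain ⟨rfl, rfl⟩ := h1; omega
    · obtain ⟨rfl, rfl⟩ := h2; omega
    · omega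
  · have := hM.col_bound c z hc
    unfold rowMove
    split_ifs <;> omega
  · have := hM.row_bound c z hz
    unfold rowMove
    split_ifs <;> omega

theorem IsFirstMax.unique {H : ℕ → ℤ} {x y : ℕ} (hx : IsFirstMax H x) (hy : IsFirstMax H y) :
    x = y := by
  rcases lt_trichotomy x y with h | h | h
  · have := hy.1 (x + 1) h; have := hx.2 (y + 1) (by omega); omega
  · exact h
  · have := hx.1 (y + 1) h; have := hy.2 (x + 1) (by omega); omega

theorem IsLastMin.unique {H : ℕ → ℤ} {x y : ℕ} (hx : IsLastMin H x) (hy : IsLastMin H y) :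
    x = y := by
  rcases lt_trichotomy x y with h | h | h
  · have := hy.1 x h.le; have := hx.2 y h; omega
  · exact h
  · have := hx.1 y h.le; have := hy.2 x h; omega

theorem RowRaise.unique (h : RowRaise i M N) (h' : RowRaise i M N') : N = N' := by
  obtain ⟨x, hx, rfl⟩ := h
  obtain ⟨x', hx', rfl⟩ := h'
  rw [hx.unique hx']

theorem colMove_injective (j x : ℕ) : Function.Injective (colMove j x) := by
  intro M N h
  funext c z
  have := congrFun (congrFun h c) z
  unfold colMove at this
  omega

theorem rowMove_injective (i c : ℕ) : Function.Injective (rowMove i c) := by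
  intro M N h
  funext d z
  have := congrFun (congrFun h d) z
  unfold rowMove at this
  omega

/-- After the move, the letter moved is read off from the last maximum of the column excess. -/
theorem ColRaise.injective (hM : IsZeroOne m n M) (hM' : IsZeroOne m n M')
    (h : ColRaise j M N) (h' : ColRaise j M' N) : M = M' := by
  have key : ∀ {L : ℕ → ℕ → ℤ} {x : ℕ}, IsZeroOne m n L → IsFirstMax (colHt j L) x →
      IsLastMin (fun y => -colHt j (colMove j x L) y) x := by
    intro L x hL hx
    have h1 := hx.1 x le_rfl
    have h2 := colHt_succ j L x
    have ha := hL.zero_or_one (j + 1) x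
    have hb := hL.zero_or_one j x
    constructor
    · intro y hy
      have := hx.1 y hy
      simp only [colHt_colMove]
      split_ifs <;> omega
    · intro y hy
      have := hx.2 y hy
      simp only [colHt_colMove]
      split_ifs <;> omega
  obtain ⟨x, hx, rfl⟩ := h
  obtain ⟨x', hx', he⟩ := h'
  have h1 := key hM hx
  rw [he] at h1
  have := h1.unique (key hM' hx')
  subst this
  exact colMove_injective _ _ he

/-- After the move, the column in which a letter was raised is read off from the first maximum of
the excess of `i` over `i + 1`. -/
theorem RowRaise.injective (hM : IsZeroOne m n M) (hM' : IsZeroOne m n M')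
    (h : RowRaise i M N) (h' : RowRaise i M' N) : M = M' := by
  have key : ∀ {L : ℕ → ℕ → ℤ} {x : ℕ}, IsZeroOne m n L → IsLastMin (rowHt i L) x →
      IsFirstMax (fun y => -rowHt i (rowMove i x L) y) x := by
    intro L x hL hx
    have h1 := hx.2 (x + 1) (by omega)
    have h2 := rowHt_succ i L x
    have ha := hL.zero_or_one x (i + 1)
    have hb := hL.zero_or_one x i
    constructor
    · intro y hy
      have := hx.1 y hy
      simp only [rowHt_rowMove]
      split_ifs <;> omega
    · intro y hy
      have := hx.2 y hy
      simp only [rowHt_rowMove]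
      split_ifs <;> omega
  obtain ⟨x, hx, rfl⟩ := h
  obtain ⟨x', hx', he⟩ := h'
  have h1 := key hM hx
  rw [he] at h1
  have := h1.unique (key hM' hx')
  subst this
  exact rowMove_injective _ _ he

/-- What the first maximum of the column excess says about the `2 × 2` block of columns `j, j + 1`
and letters `i, i + 1`, if the letter to be moved is one of these two. -/
theorem IsFirstMax.block (hM : IsZeroOne m n M) {x : ℕ} (hx : IsFirstMax (colHt j M) x) (i : ℕ) :
    (x = i → M j i = 0 ∧ M (j + 1) i = 1 ∧ M (j + 1) (i + 1) ≤ M j (i + 1)) ∧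
    (x = i + 1 → M j (i + 1) = 0 ∧ M (j + 1) (i + 1) = 1 ∧ M j i ≤ M (j + 1) i) := by
  have p := hM.zero_or_one j i
  have q := hM.zero_or_one (j + 1) i
  have r := hM.zero_or_one j (i + 1)
  have s := hM.zero_or_one (j + 1) (i + 1)
  have a1 := colHt_succ j M i
  have a2 := colHt_succ j M (i + 1)
  constructor
  · rintro rfl
    have x0 := hx.1 x le_rfl
    have x1 := hx.2 (x + 1 + 1) (by omega)
    omega
  · rintro rfl
    have x0 := hx.1 (i + 1) le_rfl
    have x1 := hx.1 i (by omega)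
    omega

/-- What the last minimum says about the `2 × 2` block of columns `j, j + 1` and letters `i, i + 1`,
if the column of the letter to be raised is one of these two. -/
theorem IsLastMin.block (hM : IsZeroOne m n M) {c : ℕ} (hc : IsLastMin (rowHt i M) c) (j : ℕ) :
    (c = j → M j i = 0 ∧ M j (i + 1) = 1 ∧ M (j + 1) i ≤ M (j + 1) (i + 1)) ∧
    (c = j + 1 → M (j + 1) i = 0 ∧ M (j + 1) (i + 1) = 1 ∧ M j (i + 1) ≤ M j i) := by
  have p := hM.zero_or_one j i
  have q := hM.zero_or_one (j + 1) i
  have r := hM.zero_or_one j (i + 1)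
  have s := hM.zero_or_one (j + 1) (i + 1)
  have a1 := rowHt_succ i M j
  have a2 := rowHt_succ i M (j + 1)
  constructor
  · rintro rfl
    have x0 := hc.2 (c + 1) (by omega)
    have x1 := hc.2 (c + 1 + 1) (by omega)
    omega
  · rintro rfl
    have x0 := hc.2 (j + 1 + 1) (by omega)
    have x1 := hc.1 j (by omega)
    omega

/-- Raising a letter does not change which letter is moved to the left, except in the two blocks
that `ColRaise.commute` treats separately. -/
theorem IsFirstMax.rowMove (hM : IsZeroOne m n M) {x c : ℕ} (hx : IsFirstMax (colHt j M) x)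
    (hc : IsLastMin (rowHt i M) c) (h1 : ¬(c = j ∧ x = i)) (h2 : ¬(c = j + 1 ∧ x = i + 1)) :
    IsFirstMax (colHt j (rowMove i c M)) x := by
  have p := hM.zero_or_one j i
  have q := hM.zero_or_one (j + 1) i
  have r := hM.zero_or_one j (i + 1)
  have s := hM.zero_or_one (j + 1) (i + 1)
  obtain ⟨x0, x1⟩ := hx.block hM i
  obtain ⟨c0, c1⟩ := hc.block hM j
  have a1 := colHt_succ j M i
  have a2 := colHt_succ j M (i + 1)
  by_cases hcj : c = j
  · specialize c0 hcj
    have e : x ≠ i := fun h => h1 ⟨hcj, h⟩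
    constructor
    · intro y hy
      have u := hx.1 y hy
      simp only [colHt_rowMove]
      split_ifs <;> omega
    · intro y hy
      have u := hx.2 y hy
      simp only [colHt_rowMove]
      split_ifs <;> omega
  by_cases hcj' : c = j + 1
  · specialize c1 hcj'
    have e : x ≠ i + 1 := fun h => h2 ⟨hcj', h⟩
    have e1 : x ≠ i := fun h => by have := x0 h; omega
    constructor
    · intro y hy
      simp only [colHt_rowMove]
      have u := hx.1 y hy
      have u1 := hx.1 i
      have u2 := hx.1 (i + 1 + 1)
      have u3 : y = i + 1 → colHt j M y = colHt j M (i + 1) := fun h => by rw [h]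
      split_ifs <;> omega
    · intro y hy
      simp only [colHt_rowMove]
      have u := hx.2 y hy
      have u1 := hx.2 i
      have u2 := hx.2 (i + 1 + 1)
      have u3 : y = i + 1 → colHt j M y = colHt j M (i + 1) := fun h => by rw [h]
      split_ifs <;> omega
  · have e : colHt j (LeftKey.rowMove i c M) = colHt j M := by
      funext y
      simp [colHt_rowMove, hcj, hcj']
    rw [e]
    exact hx

/-- Moving a letter to the left does not change in which column a letter is raised, except in the
two blocks that `ColRaise.commute` treats separately. -/
theorem IsLastMin.colMove (hM : IsZeroOne m n M) {x c : ℕ} (hx : IsFirstMax (colHt j M) x)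
    (hc : IsLastMin (rowHt i M) c) (h1 : ¬(c = j ∧ x = i)) (h2 : ¬(c = j + 1 ∧ x = i + 1)) :
    IsLastMin (rowHt i (colMove j x M)) c := by
  have p := hM.zero_or_one j i
  have q := hM.zero_or_one (j + 1) i
  have r := hM.zero_or_one j (i + 1)
  have s := hM.zero_or_one (j + 1) (i + 1)
  obtain ⟨x0, x1⟩ := hx.block hM i
  obtain ⟨c0, c1⟩ := hc.block hM j
  have a1 := rowHt_succ i M j
  have a2 := rowHt_succ i M (j + 1)
  by_cases hxi : x = i
  · specialize x0 hxi
    have e : c ≠ j := fun h => h1 ⟨h, hxi⟩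
    have e1 : c ≠ j + 1 := fun h => by have := c1 h; omega
    constructor
    · intro y hy
      simp only [rowHt_colMove]
      have u := hc.1 y hy
      have u1 := hc.1 j
      have u2 := hc.1 (j + 1 + 1)
      have u3 : y = j + 1 → rowHt i M y = rowHt i M (j + 1) := fun h => by rw [h]
      split_ifs <;> omega
    · intro y hy
      simp only [rowHt_colMove]
      have u := hc.2 y hy
      have u1 := hc.2 j
      have u2 := hc.2 (j + 1 + 1)
      have u3 : y = j + 1 → rowHt i M y = rowHt i M (j + 1) := fun h => by rw [h]
      split_ifs <;> omega
  by_cases hxi' : x = i + 1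
  · specialize x1 hxi'
    have e : c ≠ j + 1 := fun h => h2 ⟨h, hxi'⟩
    constructor
    · intro y hy
      have u := hc.1 y hy
      simp only [rowHt_colMove]
      split_ifs <;> omega
    · intro y hy
      have u := hc.2 y hy
      simp only [rowHt_colMove]
      split_ifs <;> omega
  · have e : rowHt i (LeftKey.colMove j x M) = rowHt i M := by
      funext y
      simp [rowHt_colMove, hxi, hxi']
    rw [e]
    exact hc

/-- The two raising operators commute.  Only the `2 × 2` block of columns `j, j + 1` and letters
`i, i + 1` matters, and the two moves influence each other in two configurations of it. -/
theorem ColRaise.commute (hM : IsZeroOne m n M) (h : ColRaise j M M') (h' : RowRaise i M N) :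
    ∃ N', ColRaise j N N' ∧ RowRaise i M' N' := by
  obtain ⟨x, hx, rfl⟩ := h
  obtain ⟨c, hc, rfl⟩ := h'
  have comm : ∀ x' c', (x = x' ∧ c = c' ∨ c = j ∧ x = i ∧ c' = j + 1 ∧ x' = i + 1 ∨
      c = j + 1 ∧ x = i + 1 ∧ c' = j ∧ x' = i) →
      colMove j x' (rowMove i c M) = rowMove i c' (colMove j x M) := by
    rintro x' c' (⟨rfl, rfl⟩ | ⟨rfl, rfl, rfl, rfl⟩ | ⟨rfl, rfl, rfl, rfl⟩) <;>
    · funext d z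
      simp only [rowMove, colMove]
      ring
  have a1 := colHt_succ j M i
  have a2 := colHt_succ j M (i + 1)
  have b1 := rowHt_succ i M j
  have b2 := rowHt_succ i M (j + 1)
  obtain ⟨x0, x1⟩ := hx.block hM i
  obtain ⟨c0, c1⟩ := hc.block hM j
  -- If `i` is moved to the left and `i + 1` is raised in column `j`, then in either order the first
  -- operation redirects the second one to `i + 1` and to column `j + 1`, with the same result.
  by_cases h1 : c = j ∧ x = i
  · refine ⟨_, ⟨i + 1, ⟨?_, ?_⟩, rfl⟩, j + 1, ⟨?_, ?_⟩, comm _ _ (by omega)⟩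
    all_goals obtain ⟨rfl, rfl⟩ := h1
    all_goals specialize x0 rfl
    all_goals specialize c0 rfl
    · intro y hy
      have u1 := hx.1 y
      have u3 : y = x + 1 → colHt c M y = colHt c M (x + 1) := fun h => by rw [h]
      simp only [colHt_rowMove]
      split_ifs <;> omega
    · intro y hy
      have u2 := hx.2 y
      simp only [colHt_rowMove]
      split_ifs <;> omega
    · intro y hy
      have u1 := hc.1 y
      have u3 : y = c + 1 → rowHt x M y = rowHt x M (c + 1) := fun h => by rw [h]
      simp only [rowHt_colMove]
      split_ifs <;> omega
    · intro y hy
      have u2 := hc.2 y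
      simp only [rowHt_colMove]
      split_ifs <;> omega
  -- The opposite configuration: the second operation is redirected to `i` and to column `j`.
  by_cases h2 : c = j + 1 ∧ x = i + 1
  · refine ⟨_, ⟨i, ⟨?_, ?_⟩, rfl⟩, j, ⟨?_, ?_⟩, comm _ _ (by omega)⟩
    all_goals obtain ⟨rfl, rfl⟩ := h2
    all_goals specialize x1 rfl
    all_goals specialize c1 rfl
    · intro y hy
      have u1 := hx.1 y
      simp only [colHt_rowMove]
      split_ifs <;> omega
    · intro y hy
      have u1 := hx.1 (i + 1) le_rfl
      have u2 := hx.2 y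
      have u3 : y = i + 1 → colHt j M y = colHt j M (i + 1) := fun h => by rw [h]
      simp only [colHt_rowMove]
      split_ifs <;> omega
    · intro y hy
      have u1 := hc.1 y
      simp only [rowHt_colMove]
      split_ifs <;> omega
    · intro y hy
      have u2 := hc.2 y
      have u3 : y = j + 1 → rowHt i M y = rowHt i M (j + 1) := fun h => by rw [h]
      simp only [rowHt_colMove]
      split_ifs <;> omega
  exact ⟨_, ⟨x, hx.rowMove hM hc h1 h2, rfl⟩, c, hc.colMove hM hx h1 h2, comm _ _ (by omega)⟩

/-- Raising a letter does not change the maximum of the column excess. -/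
theorem RowRaise.colHt_le_iff (hM : IsZeroOne m n M) (h : RowRaise i M N) (j : ℕ) (t : ℤ) :
    (∀ y, colHt j N y ≤ t) ↔ ∀ y, colHt j M y ≤ t := by
  obtain ⟨c, hc, rfl⟩ := h
  have p := hM.zero_or_one j i
  have q := hM.zero_or_one (j + 1) i
  have r := hM.zero_or_one j (i + 1)
  have s := hM.zero_or_one (j + 1) (i + 1)
  have a1 := colHt_succ j M i
  have a2 := colHt_succ j M (i + 1)
  obtain ⟨c0, c1⟩ := hc.block hM j
  simp only [colHt_rowMove]
  constructor <;> intro h y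
  · have h0 := h i
    have h1 := h (i + 1)
    have h2 := h (i + 1 + 1)
    have hy := h y
    have u3 : y = i + 1 → colHt j M y = colHt j M (i + 1) := fun h => by rw [h]
    split_ifs at h0 h1 h2 hy <;> omega
  · have h0 := h i
    have h2 := h (i + 1 + 1)
    have hy := h y
    have u3 : y = i + 1 → colHt j M y = colHt j M (i + 1) := fun h => by rw [h]
    split_ifs <;> omega

/-- Moving a letter to the left does not change the minimum of the excess of `i + 1` over `i`. -/
theorem ColRaise.le_rowHt_iff (hM : IsZeroOne m n M) (h : ColRaise j M N) (i : ℕ) (t : ℤ) :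
    (∀ y, t ≤ rowHt i N y) ↔ ∀ y, t ≤ rowHt i M y := by
  obtain ⟨x, hx, rfl⟩ := h
  have p := hM.zero_or_one j i
  have q := hM.zero_or_one (j + 1) i
  have r := hM.zero_or_one j (i + 1)
  have s := hM.zero_or_one (j + 1) (i + 1)
  have b1 := rowHt_succ i M j
  have b2 := rowHt_succ i M (j + 1)
  obtain ⟨x0, x1⟩ := hx.block hM i
  simp only [rowHt_colMove]
  constructor <;> intro h y
  · have h0 := h j
    have h1 := h (j + 1)
    have h2 := h (j + 1 + 1)
    have hy := h y
    have u3 : y = j + 1 → rowHt i M y = rowHt i M (j + 1) := fun h => by rw [h]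
    split_ifs at h0 h1 h2 hy <;> omega
  · have h0 := h j
    have h2 := h (j + 1 + 1)
    have hy := h y
    have u3 : y = j + 1 → rowHt i M y = rowHt i M (j + 1) := fun h => by rw [h]
    split_ifs <;> omega

end LeftKey

namespace LeftKey

variable {m n i j k : ℕ} {M N M' N' : ℕ → ℕ → ℤ}

/-! ### Paths of raising operators -/

theorem exists_isLastMin {P : ℕ → ℤ} {m : ℕ} (hP : ∀ y, m ≤ y → P y = P m)
    (h : ∃ y, P y < P m) : ∃ c, IsLastMin P c := by
  obtain ⟨y₀, hy₀⟩ := h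
  have hm : y₀ < m := by
    by_contra hc
    rw [hP y₀ (by omega)] at hy₀
    omega
  -- Maximizing this function minimizes `P` first and then maximizes the position.
  obtain ⟨c, hc, hmax⟩ := Finset.exists_max_image (Finset.range m)
    (fun y => -P y * (m + 1) + y) ⟨y₀, Finset.mem_range.mpr hm⟩
  rw [Finset.mem_range] at hc
  have hle : ∀ y < m, P c ≤ P y ∧ (c < y → P c < P y) := by
    intro y hy
    have h1 := hmax y (Finset.mem_range.mpr hy)
    have h2 : P c ≤ P y := by
      by_contra h3
      have h4 : P y + 1 ≤ P c := by omega
      have h5 : (P y + 1) * ((m : ℤ) + 1) ≤ P c * ((m : ℤ) + 1) :=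
        mul_le_mul_of_nonneg_right h4 (by positivity)
      have h6 : (c : ℤ) < m := by exact_mod_cast hc
      nlinarith
    refine ⟨h2, fun h3 => lt_of_le_of_ne h2 fun h4 => ?_⟩
    rw [h4] at h1
    omega
  refine ⟨c, fun y hy => (hle y (by omega)).1, fun y hy => ?_⟩
  by_cases hym : y < m
  · exact (hle y hym).2 hy
  · rw [hP y (by omega)]
    have := (hle y₀ hm).1
    omega

theorem exists_isFirstMax {H : ℕ → ℤ} {n : ℕ} (hH : ∀ y, n ≤ y → H y = H n)
    (h : ∃ y, H 0 < H y) : ∃ x, IsFirstMax H x := by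
  obtain ⟨y₀, hy₀⟩ := h
  obtain ⟨c, hc, hmax⟩ := Finset.exists_max_image (Finset.range (n + 1))
    (fun y => H y * (n + 1) - y) ⟨0, by simp⟩
  rw [Finset.mem_range] at hc
  have hle : ∀ y ≤ n, H y ≤ H c ∧ (y < c → H y < H c) := by
    intro y hy
    have h1 := hmax y (Finset.mem_range.mpr (by omega))
    have h2 : H y ≤ H c := by
      by_contra h3
      have h4 : H c + 1 ≤ H y := by omega
      have h5 : (H c + 1) * ((n : ℤ) + 1) ≤ H y * ((n : ℤ) + 1) :=
        mul_le_mul_of_nonneg_right h4 (by positivity)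
      have h6 : (y : ℤ) ≤ n := by exact_mod_cast hy
      nlinarith
    refine ⟨h2, fun h3 => lt_of_le_of_ne h2 fun h4 => ?_⟩
    rw [h4] at h1
    omega
  have hall : ∀ y, H y ≤ H c := by
    intro y
    by_cases hyn : y ≤ n
    · exact (hle y hyn).1
    · rw [hH y (by omega)]
      exact (hle n le_rfl).1
  have h0 : c ≠ 0 := by
    rintro rfl
    have := hall y₀
    omega
  obtain ⟨x, rfl⟩ := Nat.exists_eq_succ_of_ne_zero h0
  exact ⟨x, fun y hy => (hle y (by omega)).2 (by omega), fun y _ => hall y⟩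

theorem IsZeroOne.colHt_const (hM : IsZeroOne m n M) (j : ℕ) {y : ℕ} (hy : n ≤ y) :
    colHt j M y = colHt j M n := by
  induction y, hy using Nat.le_induction with
  | base => rfl
  | succ y hy ih => rw [colHt_succ, ih, hM.row_bound _ y hy, hM.row_bound _ y hy]; ring

theorem IsZeroOne.rowHt_const (hM : IsZeroOne m n M) (i : ℕ) {y : ℕ} (hy : m ≤ y) :
    rowHt i M y = rowHt i M m := by
  induction y, hy using Nat.le_induction with
  | base => rfl
  | succ y hy ih => rw [rowHt_succ, ih, hM.col_bound y _ hy, hM.col_bound y _ hy]; ring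

theorem IsZeroOne.exists_rowRaise (hM : IsZeroOne m n M)
    (h : ¬∀ y, rowHt i M m ≤ rowHt i M y) : ∃ N, RowRaise i M N := by
  push Not at h
  obtain ⟨c, hc⟩ := exists_isLastMin (fun y => hM.rowHt_const i) h
  exact ⟨_, c, hc, rfl⟩

theorem IsZeroOne.exists_colRaise (hM : IsZeroOne m n M)
    (h : ¬∀ y, colHt j M y ≤ 0) : ∃ N, ColRaise j M N := by
  push Not at h
  obtain ⟨c, hc⟩ := exists_isFirstMax (fun y => hM.colHt_const j) h
  exact ⟨_, c, hc, rfl⟩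

theorem ColRaise.exists_eq (hM : IsZeroOne m n M) (h : ColRaise j M N) :
    ∃ x < n, j + 1 < m ∧ N = colMove j x M := by
  obtain ⟨x, hx, rfl⟩ := h
  have h1 := hx.1 x le_rfl
  rw [colHt_succ] at h1
  have ha := hM.zero_or_one j x
  refine ⟨x, ?_, ?_, rfl⟩
  · by_contra hc
    have := hM.row_bound (j + 1) x (by omega)
    omega
  · by_contra hc
    have := hM.col_bound (j + 1) x (by omega)
    omega

theorem RowRaise.exists_eq (hM : IsZeroOne m n M) (h : RowRaise i M N) :
    ∃ c < m, i + 1 < n ∧ N = rowMove i c M := by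
  obtain ⟨x, hx, rfl⟩ := h
  have h1 := hx.2 (x + 1) (by omega)
  rw [rowHt_succ] at h1
  have ha := hM.zero_or_one x i
  refine ⟨x, ?_, ?_, rfl⟩
  · by_contra hc
    have := hM.col_bound x (i + 1) (by omega)
    omega
  · by_contra hc
    have := hM.row_bound x (i + 1) (by omega)
    omega

/-- The number of letters in column `c`. -/
def colSum (n : ℕ) (M : ℕ → ℕ → ℤ) (c : ℕ) : ℤ := ∑ x ∈ Finset.range n, M c x

/-- The number of letters `x`. -/
def rowSum (m : ℕ) (M : ℕ → ℕ → ℤ) (x : ℕ) : ℤ := ∑ c ∈ Finset.range m, M c x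

theorem ColRaise.rowSum_eq (hM : IsZeroOne m n M) (h : ColRaise j M N) :
    rowSum m N = rowSum m M := by
  obtain ⟨x, hx, hj, rfl⟩ := h.exists_eq hM
  funext z
  have h1 : j < m := by omega
  by_cases hz : z = x <;>
    simp [rowSum, colMove, hz, hj, h1, Finset.sum_add_distrib, Finset.sum_sub_distrib]

theorem RowRaise.colSum_eq (hM : IsZeroOne m n M) (h : RowRaise i M N) :
    colSum n N = colSum n M := by
  obtain ⟨x, hx, hj, rfl⟩ := h.exists_eq hM
  funext z
  have h1 : i < n := by omega
  by_cases hz : z = x <;>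
    simp [colSum, rowMove, hz, hj, h1, Finset.sum_add_distrib, Finset.sum_sub_distrib]

theorem colHt_eq_colSum (n j : ℕ) (M : ℕ → ℕ → ℤ) :
    colHt j M n = colSum n M (j + 1) - colSum n M j := Finset.sum_sub_distrib _ _

theorem rowHt_eq_rowSum (m i : ℕ) (M : ℕ → ℕ → ℤ) :
    rowHt i M m = rowSum m M (i + 1) - rowSum m M i := Finset.sum_sub_distrib _ _

/-- A sequence of raising operators on the columns with indices `≥ k`. -/
def ColPath (k : ℕ) : (ℕ → ℕ → ℤ) → (ℕ → ℕ → ℤ) → Prop :=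
  Relation.ReflTransGen fun M N => ∃ j, k ≤ j ∧ ColRaise j M N

/-- The sequence of raising operators on the letters with the listed indices. -/
def RowPath : List ℕ → (ℕ → ℕ → ℤ) → (ℕ → ℕ → ℤ) → Prop
  | [], M, N => M = N
  | i :: l, M, N => ∃ L, RowRaise i M L ∧ RowPath l L N

theorem IsZeroOne.colPath (hM : IsZeroOne m n M) (h : ColPath k M N) : IsZeroOne m n N := by
  induction h with
  | refl => exact hM
  | tail _ h ih => obtain ⟨j, -, hj⟩ := h; exact ih.colRaise hj

theorem ColPath.rowSum_eq (hM : IsZeroOne m n M) (h : ColPath k M N) :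
    rowSum m N = rowSum m M := by
  induction h with
  | refl => rfl
  | tail h' h ih => obtain ⟨j, -, hj⟩ := h; rw [← ih, hj.rowSum_eq (hM.colPath h')]

/-- Operators on later columns do not change the first `k` columns. -/
theorem ColPath.column_eq (h : ColPath k M N) {c : ℕ} (hc : c < k) : N c = M c := by
  induction h with
  | refl => rfl
  | tail _ h ih =>
    obtain ⟨j, hj, x, -, rfl⟩ := h
    rw [← ih]
    funext z
    have h1 : c ≠ j := by omega
    have h2 : c ≠ j + 1 := by omega
    simp [colMove, h1, h2]

/-- The words that are highest for the crystal on the letters are preserved. -/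
theorem ColPath.rowHighest_iff (hM : IsZeroOne m n M) (h : ColPath k M N) (i : ℕ) :
    (∀ y, rowHt i N m ≤ rowHt i N y) ↔ ∀ y, rowHt i M m ≤ rowHt i M y := by
  induction h with
  | refl => rfl
  | tail h' h ih =>
    obtain ⟨j, -, hj⟩ := h
    rw [← ih, ← hj.le_rowHt_iff (hM.colPath h'), rowHt_eq_rowSum, rowHt_eq_rowSum,
      hj.rowSum_eq (hM.colPath h')]

theorem IsZeroOne.rowPath {l : List ℕ} (hM : IsZeroOne m n M) (h : RowPath l M N) :
    IsZeroOne m n N := by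
  induction l generalizing M with
  | nil => exact h ▸ hM
  | cons i l ih => obtain ⟨L, h1, h2⟩ := h; exact ih (hM.rowRaise h1) h2

theorem RowPath.colSum_eq {l : List ℕ} (hM : IsZeroOne m n M) (h : RowPath l M N) :
    colSum n N = colSum n M := by
  induction l generalizing M with
  | nil => cases h; rfl
  | cons i l ih =>
    obtain ⟨L, h1, h2⟩ := h
    rw [ih (hM.rowRaise h1) h2, h1.colSum_eq hM]

theorem RowPath.colHt_le_iff {l : List ℕ} (hM : IsZeroOne m n M) (h : RowPath l M N) (j : ℕ)
    (t : ℤ) : (∀ y, colHt j N y ≤ t) ↔ ∀ y, colHt j M y ≤ t := by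
  induction l generalizing M with
  | nil => cases h; rfl
  | cons i l ih =>
    obtain ⟨L, h1, h2⟩ := h
    rw [ih (hM.rowRaise h1) h2, h1.colHt_le_iff hM]

theorem RowPath.injective {l : List ℕ} (hM : IsZeroOne m n M) (hM' : IsZeroOne m n M')
    (h : RowPath l M N) (h' : RowPath l M' N) : M = M' := by
  induction l generalizing M M' with
  | nil => exact Eq.trans h (Eq.symm h')
  | cons i l ih =>
    obtain ⟨L, h1, h2⟩ := h
    obtain ⟨L', h1', h2'⟩ := h'
    cases ih (hM.rowRaise h1) (hM'.rowRaise h1') h2 h2'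
    exact h1.injective hM hM' h1'

/-- Raising operators on the columns transport along a raising path on the letters. -/
theorem RowPath.colRaise {l : List ℕ} (hM : IsZeroOne m n M) (h : RowPath l M N)
    (hc : ColRaise j M M') : ∃ N', ColRaise j N N' ∧ RowPath l M' N' := by
  induction l generalizing M M' with
  | nil => cases h; exact ⟨M', hc, rfl⟩
  | cons i l ih =>
    obtain ⟨L, h1, h2⟩ := h
    obtain ⟨L', h3, h4⟩ := hc.commute hM h1
    obtain ⟨N', h5, h6⟩ := ih (hM.rowRaise h1) h2 h3
    exact ⟨N', h5, L', h4, h6⟩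

theorem RowPath.colPath {l : List ℕ} (hM : IsZeroOne m n M) (h : RowPath l M N)
    (hc : ColPath k M M') : ∃ N', ColPath k N N' ∧ RowPath l M' N' := by
  induction hc with
  | refl => exact ⟨N, .refl, h⟩
  | tail h' hj ih =>
    obtain ⟨j, hk, hj⟩ := hj
    obtain ⟨L, h1, h2⟩ := ih
    obtain ⟨N', h3, h4⟩ := h2.colRaise (hM.colPath h') hj
    exact ⟨N', h1.tail ⟨j, hk, h3⟩, h4⟩

theorem ColRaise.rowRaise (hM : IsZeroOne m n M) (hc : ColRaise j M M') (h : RowRaise i M' N') :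
    ∃ N, RowRaise i M N ∧ ColRaise j N N' := by
  -- By the invariance of the minimum, a letter can be raised in `M`, since one can in `M'`.
  have h1 : ¬∀ y, rowHt i M m ≤ rowHt i M y := by
    rw [← ColPath.rowHighest_iff (k := j) hM (.single ⟨j, le_rfl, hc⟩)]
    obtain ⟨c, hx, rfl⟩ := h
    intro hall
    have h2 := hall c
    have h3 := hx.2 (max m (c + 1)) (by omega)
    rw [(hM.colRaise hc).rowHt_const i (le_max_left _ _)] at h3
    omega
  obtain ⟨N, hN⟩ := hM.exists_rowRaise h1
  obtain ⟨L, h2, h3⟩ := hc.commute hM hN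
  rw [h.unique h3]
  exact ⟨N, hN, h2⟩

/-- Raising operators on the letters lift along a raising path on the columns. -/
theorem ColRaise.rowPath {l : List ℕ} (hM : IsZeroOne m n M) (hc : ColRaise j M M')
    (h : RowPath l M' N') : ∃ N, RowPath l M N ∧ ColRaise j N N' := by
  induction l generalizing M M' with
  | nil => cases h; exact ⟨M, rfl, hc⟩
  | cons i l ih =>
    obtain ⟨L, h1, h2⟩ := h
    obtain ⟨K, h3, h4⟩ := hc.rowRaise hM h1
    obtain ⟨N, h5, h6⟩ := ih (hM.rowRaise h3) h4 h2
    exact ⟨N, ⟨K, h3, h5⟩, h6⟩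

theorem ColPath.rowPath {l : List ℕ} (hM : IsZeroOne m n M) (hc : ColPath k M M')
    (h : RowPath l M' N') : ∃ N, RowPath l M N ∧ ColPath k N N' := by
  induction hc using Relation.ReflTransGen.head_induction_on with
  | refl => exact ⟨N', h, .refl⟩
  | head hj h' ih =>
    obtain ⟨j, hk, hj⟩ := hj
    obtain ⟨L, h1, h2⟩ := ih (hM.colRaise hj)
    obtain ⟨N, h3, h4⟩ := hj.rowPath hM h1
    exact ⟨N, h3, .head ⟨j, hk, h4⟩ h2⟩

/-- Move a letter `x` from column `j` to column `j + 1`. -/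
def colLower (j x : ℕ) (M : ℕ → ℕ → ℤ) : ℕ → ℕ → ℤ := fun c z =>
  M c z - (if c = j ∧ z = x then 1 else 0) + (if c = j + 1 ∧ z = x then 1 else 0)

theorem colMove_colLower (j x : ℕ) (M : ℕ → ℕ → ℤ) : colMove j x (colLower j x M) = M := by
  funext c z
  simp only [colMove, colLower]
  ring

theorem colHt_colLower (j x : ℕ) (M : ℕ → ℕ → ℤ) (y : ℕ) :
    colHt j (colLower j x M) y = colHt j M y + if x < y then 2 else 0 := by
  have := colHt_colMove j x (colLower j x M) y
  rw [colMove_colLower] at this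
  omega

/-- The inverse of the raising operator on the columns moves the letter at the last maximum of the
column excess. -/
theorem IsZeroOne.colRaise_colLower (hM : IsZeroOne m n M) (hj : j + 1 < m) {x : ℕ}
    (hx : IsLastMin (fun y => -colHt j M y) x) :
    ColRaise j (colLower j x M) M ∧ IsZeroOne m n (colLower j x M) ∧
      M j x = 1 ∧ M (j + 1) x = 0 ∧ x < n := by
  have h1 := hx.2 (x + 1) (by omega)
  simp only [colHt_succ] at h1
  have ha := hM.zero_or_one (j + 1) x
  have hb := hM.zero_or_one j x
  have hxn : x < n := by
    by_contra hc
    have := hM.row_bound j x (by omega)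
    omega
  refine ⟨⟨x, ⟨?_, ?_⟩, (colMove_colLower j x M).symm⟩,
    ⟨fun c z => ?_, fun c z hc => ?_, fun c z hz => ?_⟩, by omega, by omega, hxn⟩
  · intro y hy
    have := hx.1 y hy
    rw [colHt_colLower, colHt_colLower, colHt_succ]
    dsimp only at this
    split_ifs <;> omega
  · intro y hy
    have := hx.2 y hy
    rw [colHt_colLower, colHt_colLower, colHt_succ]
    dsimp only at this
    split_ifs <;> omega
  · have hc := hM.zero_or_one c z
    unfold colLower
    split_ifs with h1 h2 h2
    · omega
    · obtain ⟨rfl, rfl⟩ := h1; omega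
    · obtain ⟨rfl, rfl⟩ := h2; omega
    · omega
  · have := hM.col_bound c z hc
    unfold colLower
    split_ifs <;> omega
  · have := hM.row_bound c z hz
    unfold colLower
    split_ifs <;> omega

theorem RowRaise.exists_colRaise (hM : IsZeroOne m n M) (h : RowRaise i M N)
    (hN' : IsZeroOne m n N') (hc : ColRaise j N' N) :
    ∃ M', IsZeroOne m n M' ∧ ColRaise j M' M ∧ RowRaise i M' N' := by
  obtain ⟨-, -, hj, -⟩ := hc.exists_eq hN'
  -- By the invariance of the maximum, the lowering operator applies to `M`, since it does to `N`.
  have h1 : ¬∀ y, colHt j M y ≤ colHt j M n := by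
    rw [← h.colHt_le_iff hM]
    obtain ⟨x, hx, rfl⟩ := hc
    have h2 : colHt j M n = colHt j (colMove j x N') n := by
      rw [colHt_eq_colSum, colHt_eq_colSum, h.colSum_eq hM]
    have h3 := hx.1 x le_rfl
    have h4 := colHt_succ j N' x
    have h5 := hN'.zero_or_one (j + 1) x
    have h6 := hN'.zero_or_one j x
    have h7 := hx.2 (max n (x + 1)) (by omega)
    intro hall
    have h8 := hall x
    rw [h2, ← (hN'.colRaise ⟨x, hx, rfl⟩).colHt_const j (le_max_left n (x + 1)), colHt_colMove,
      colHt_colMove, if_neg (by omega), if_pos (by omega)] at h8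
    omega
  push Not at h1
  obtain ⟨x, hx⟩ := exists_isLastMin (P := fun y => -colHt j M y) (m := n)
    (fun y hy => by rw [hM.colHt_const j hy]) (by simpa using h1)
  obtain ⟨h2, h3, -⟩ := hM.colRaise_colLower hj hx
  obtain ⟨L, h4, h5⟩ := h2.rowRaise h3 h
  cases h5.injective (h3.rowRaise h4) hN' hc
  exact ⟨_, h3, h2, h4⟩

theorem RowPath.exists_colRaise {l : List ℕ} (hM : IsZeroOne m n M) (h : RowPath l M N)
    (hN' : IsZeroOne m n N') (hc : ColRaise j N' N) :
    ∃ M', IsZeroOne m n M' ∧ ColRaise j M' M ∧ RowPath l M' N' := by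
  induction l generalizing M with
  | nil => cases h; exact ⟨N', hN', hc, rfl⟩
  | cons i l ih =>
    obtain ⟨L, h1, h2⟩ := h
    obtain ⟨L', h3, h4, h5⟩ := ih (hM.rowRaise h1) h2
    obtain ⟨M', h6, h7, h8⟩ := h1.exists_colRaise hM h3 h4
    exact ⟨M', h6, h7, L', h8, h5⟩

/-- A raising path on the columns lifts backwards along a raising path on the letters. -/
theorem RowPath.exists_colPath {l : List ℕ} (hM : IsZeroOne m n M) (h : RowPath l M N)
    (hN' : IsZeroOne m n N') (hc : ColPath k N' N) :
    ∃ M', IsZeroOne m n M' ∧ ColPath k M' M ∧ RowPath l M' N' := by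
  induction hc using Relation.ReflTransGen.head_induction_on with
  | refl => exact ⟨M, hM, .refl, h⟩
  | head hj h' ih =>
    obtain ⟨j, hk, hj⟩ := hj
    obtain ⟨L, h1, h2, h3⟩ := ih (hN'.colRaise hj)
    obtain ⟨M', h4, h5, h6⟩ := h3.exists_colRaise h1 hN' hj
    exact ⟨M', h4, .head ⟨j, hk, h5⟩ h2, h6⟩

/-! ### Highest weight matrices -/

theorem sum_mul_ite {m n : ℕ} (w : ℕ → ℕ → ℤ) {a b : ℕ} (ha : a < m) (hb : b < n) :
    ∑ c ∈ Finset.range m, ∑ x ∈ Finset.range n, w c x * (if c = a ∧ x = b then 1 else 0) =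
      w a b := by
  simp [ite_and, ha, hb]

theorem sum_mul_nonneg (hM : IsZeroOne m n M) (w : ℕ → ℕ → ℤ) (hw : ∀ c x, 0 ≤ w c x) :
    0 ≤ ∑ c ∈ Finset.range m, ∑ x ∈ Finset.range n, w c x * M c x :=
  Finset.sum_nonneg fun c _ => Finset.sum_nonneg fun x _ => mul_nonneg (hw c x) (by
    have := hM.zero_or_one c x
    omega)

/-- Raising letters ends, because the sum of the letters decreases. -/
theorem exists_rowPath_highest (hM : IsZeroOne m n M) :
    ∃ l N, RowPath l M N ∧ ∀ i y, rowHt i N m ≤ rowHt i N y := by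
  obtain ⟨t, ht⟩ : ∃ t : ℕ,
      ∑ c ∈ Finset.range m, ∑ x ∈ Finset.range n, (fun _ x => (x : ℤ)) c x * M c x = t :=
    Int.eq_ofNat_of_zero_le (sum_mul_nonneg hM _ fun _ x => by positivity)
  induction t generalizing M with
  | zero =>
    refine ⟨[], M, rfl, fun i => ?_⟩
    by_contra hc
    obtain ⟨N, hN⟩ := hM.exists_rowRaise hc
    have h0 := sum_mul_nonneg (hM.rowRaise hN) (fun _ x => (x : ℤ)) fun _ x => by positivity
    obtain ⟨c, hc, hi, rfl⟩ := hN.exists_eq hM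
    simp only [rowMove, mul_add, mul_sub, Finset.sum_add_distrib, Finset.sum_sub_distrib] at h0 ht
    rw [ht, sum_mul_ite (fun _ x => (x : ℤ)) hc (by omega),
      sum_mul_ite (fun _ x => (x : ℤ)) hc hi] at h0
    push_cast at h0
    omega
  | succ t ih =>
    by_cases h : ∀ i y, rowHt i M m ≤ rowHt i M y
    · exact ⟨[], M, rfl, h⟩
    · obtain ⟨i, hi⟩ := not_forall.mp h
      obtain ⟨N, hN⟩ := hM.exists_rowRaise hi
      obtain ⟨l, L, h1, h2⟩ := ih (hM.rowRaise hN) (by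
        obtain ⟨c, hc, hi, rfl⟩ := hN.exists_eq hM
        simp only [rowMove, mul_add, mul_sub, Finset.sum_add_distrib,
          Finset.sum_sub_distrib] at ht ⊢
        rw [ht, sum_mul_ite (fun _ x => (x : ℤ)) hc (by omega),
          sum_mul_ite (fun _ x => (x : ℤ)) hc hi]
        push_cast
        omega)
      exact ⟨i :: l, L, ⟨N, hN, h1⟩, h2⟩

/-- Raising on the columns ends, because the sum of the column indices of the letters decreases. -/
theorem exists_colPath_highest (hM : IsZeroOne m n M) (k : ℕ) :
    ∃ N, ColPath k M N ∧ ∀ j, k ≤ j → ∀ y, colHt j N y ≤ 0 := by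
  obtain ⟨t, ht⟩ : ∃ t : ℕ,
      ∑ c ∈ Finset.range m, ∑ x ∈ Finset.range n, (fun c _ => (c : ℤ)) c x * M c x = t :=
    Int.eq_ofNat_of_zero_le (sum_mul_nonneg hM _ fun _ x => by positivity)
  induction t generalizing M with
  | zero =>
    refine ⟨M, .refl, fun j _ => ?_⟩
    by_contra hc
    obtain ⟨N, hN⟩ := hM.exists_colRaise hc
    have h0 := sum_mul_nonneg (hM.colRaise hN) (fun c _ => (c : ℤ)) fun _ x => by positivity
    obtain ⟨x, hx, hj, rfl⟩ := hN.exists_eq hM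
    simp only [colMove, mul_add, mul_sub, Finset.sum_add_distrib, Finset.sum_sub_distrib] at h0 ht
    rw [ht, sum_mul_ite (fun c _ => (c : ℤ)) (by omega) hx,
      sum_mul_ite (fun c _ => (c : ℤ)) hj hx] at h0
    push_cast at h0
    omega
  | succ t ih =>
    by_cases h : ∀ j, k ≤ j → ∀ y, colHt j M y ≤ 0
    · exact ⟨M, .refl, h⟩
    · push Not at h
      obtain ⟨j, hk, hj⟩ := h
      obtain ⟨N, hN⟩ := hM.exists_colRaise (j := j) (by push Not; exact hj)
      obtain ⟨L, h1, h2⟩ := ih (hM.colRaise hN) (by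
        obtain ⟨x, hx, hj, rfl⟩ := hN.exists_eq hM
        simp only [colMove, mul_add, mul_sub, Finset.sum_add_distrib,
          Finset.sum_sub_distrib] at ht ⊢
        rw [ht, sum_mul_ite (fun c _ => (c : ℤ)) (by omega) hx,
          sum_mul_ite (fun c _ => (c : ℤ)) hj hx]
        push_cast
        omega)
      exact ⟨L, .head ⟨j, hk, hN⟩ h1, h2⟩

/-- A matrix that is highest for both crystals has all its ones justified to the left and to the
top. -/
theorem justified_of_highest (hM : IsZeroOne m n M) (hcol : ∀ j y, colHt j M y ≤ 0)
    (hrow : ∀ i y, rowHt i M m ≤ rowHt i M y) (x : ℕ) :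
    (∀ c, M (c + 1) x ≤ M c x) ∧ ∀ c, M c (x + 1) ≤ M c x := by
  induction x using Nat.strong_induction_on with
  | _ x ih =>
    have left : ∀ c, M (c + 1) x ≤ M c x := by
      intro c
      rcases hM.zero_or_one (c + 1) x with h | h
      · have := hM.zero_or_one c x
        omega
      -- By induction column `c + 1` begins with `0, …, x` and column `c` with `0, …, x - 1`, so the
      -- excess would become positive if `x` were missing from column `c`.
      · have hz : ∀ z ≤ x, M (c + 1) z = 1 := by
          intro z hz
          induction hz using Nat.decreasingInduction with
          | self => exact h
          | of_succ z hz ih2 =>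
            have := (ih z hz).2 (c + 1)
            have := hM.zero_or_one (c + 1) z
            omega
        have h0 : ∀ y ≤ x, colHt c M y = 0 := by
          intro y
          induction y with
          | zero => intro _; rfl
          | succ y ih2 =>
            intro hy
            have h1 := hz y (by omega)
            have h2 := (ih y hy).1 c
            have h3 := hM.zero_or_one c y
            rw [colHt_succ, ih2 (by omega)]
            omega
        have h1 := hcol c (x + 1)
        rw [colHt_succ, h0 x le_rfl] at h1
        omega
    refine ⟨left, fun c => ?_⟩
    rcases hM.zero_or_one c (x + 1) with h | h
    · have := hM.zero_or_one c x
      omega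
    · by_contra hlt
      have h0 : M c x = 0 := by
        have := hM.zero_or_one c x
        omega
      have hc : c < m := by
        by_contra hc
        have := hM.col_bound c (x + 1) (by omega)
        omega
      -- No column from `c` on contains `x`, while column `c` contains `x + 1`, so the excess of
      -- `x + 1` over `x` is not minimal at the end.
      have hz : ∀ d, c ≤ d → M d x = 0 := by
        intro d hd
        induction d, hd using Nat.le_induction with
        | base => exact h0
        | succ d hd ih2 =>
          have := left d
          have := hM.zero_or_one (d + 1) x
          omega
      have h1 : ∀ d, c + 1 ≤ d → rowHt x M c + 1 ≤ rowHt x M d := by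
        intro d hd
        induction d, hd using Nat.le_induction with
        | base => rw [rowHt_succ]; omega
        | succ d hd ih2 =>
          have := hz d (by omega)
          have := hM.zero_or_one d (x + 1)
          rw [rowHt_succ]
          omega
      have := h1 m hc
      have := hrow x c
      omega

/-- A matrix that is highest for both crystals is determined by the multiplicities of its
letters. -/
theorem eq_of_highest (hM : IsZeroOne m n M) (hcol : ∀ j y, colHt j M y ≤ 0)
    (hrow : ∀ i y, rowHt i M m ≤ rowHt i M y) (hN : IsZeroOne m n N)
    (hcol' : ∀ j y, colHt j N y ≤ 0) (hrow' : ∀ i y, rowHt i N m ≤ rowHt i N y)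
    (hsum : rowSum m M = rowSum m N) : M = N := by
  have key : ∀ {f g : ℕ → ℤ}, (∀ c, f c = 0 ∨ f c = 1) → (∀ c, g c = 0 ∨ g c = 1) →
      (∀ c, m ≤ c → f c = 0) → (∀ c, f (c + 1) ≤ f c) → (∀ c, g (c + 1) ≤ g c) →
      ∑ c ∈ Finset.range m, f c = ∑ c ∈ Finset.range m, g c → ∀ c, f c = 1 → g c = 1 := by
    intro f g hf hg hfm hf' hg' hs c hc
    by_contra h
    have hg0 : g c = 0 := (hg c).resolve_right h
    have hfa : Antitone f := antitone_nat_of_succ_le hf'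
    have hga : Antitone g := antitone_nat_of_succ_le hg'
    refine absurd hs (ne_of_gt (Finset.sum_lt_sum (fun d _ => ?_) ⟨c, ?_, by omega⟩))
    · rcases le_total c d with h1 | h1
      · have := hga h1
        have := hg d
        have := hf d
        omega
      · have := hfa h1
        have := hg d
        have := hf d
        omega
    · rw [Finset.mem_range]
      by_contra h1
      have := hfm c (by omega)
      omega
  funext c x
  have h1 := (justified_of_highest hM hcol hrow x).1
  have h2 := (justified_of_highest hN hcol' hrow' x).1
  have hs : ∑ c ∈ Finset.range m, M c x = ∑ c ∈ Finset.range m, N c x := congrFun hsum x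
  have h3 := key (fun c => hM.zero_or_one c x) (fun c => hN.zero_or_one c x)
    (fun c hc => hM.col_bound c x hc) h1 h2 hs c
  have h4 := key (fun c => hN.zero_or_one c x) (fun c => hM.zero_or_one c x)
    (fun c hc => hN.col_bound c x hc) h2 h1 hs.symm c
  have h5 := hM.zero_or_one c x
  have h6 := hN.zero_or_one c x
  omega

/-- If two matrices with the same first column are highest for the crystal on the letters, and for
the crystal on the remaining columns, then they are determined by the multiplicities of their
letters. -/
theorem eq_of_highest_tail (hM : IsZeroOne m n M) (hcol : ∀ j, 1 ≤ j → ∀ y, colHt j M y ≤ 0)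
    (hrow : ∀ i y, rowHt i M m ≤ rowHt i M y) (hN : IsZeroOne m n N)
    (hcol' : ∀ j, 1 ≤ j → ∀ y, colHt j N y ≤ 0) (hrow' : ∀ i y, rowHt i N m ≤ rowHt i N y)
    (hsum : rowSum m M = rowSum m N) (h0 : M 0 = N 0) : M = N := by
  have zo : ∀ {L : ℕ → ℕ → ℤ}, IsZeroOne m n L → IsZeroOne m n fun c => L (c + 1) := fun hL =>
    ⟨fun c x => hL.zero_or_one _ x, fun c x hc => hL.col_bound _ x (by omega),
      fun c x hx => hL.row_bound _ x hx⟩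
  have rh : ∀ (L : ℕ → ℕ → ℤ) i y,
      rowHt i (fun c => L (c + 1)) y = rowHt i L (y + 1) - rowHt i L 1 := by
    intro L i y
    simp only [rowHt]
    rw [Finset.sum_range_succ' _ y]
    simp
  have rhm : ∀ {L : ℕ → ℕ → ℤ}, IsZeroOne m n L → (∀ i y, rowHt i L m ≤ rowHt i L y) →
      ∀ i y, rowHt i (fun c => L (c + 1)) m ≤ rowHt i (fun c => L (c + 1)) y := by
    intro L hL h i y
    rw [rh, rh, hL.rowHt_const i (Nat.le_succ m)]
    have := h i (y + 1)
    omega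
  have rs : ∀ {L : ℕ → ℕ → ℤ}, IsZeroOne m n L → ∀ x,
      rowSum m (fun c => L (c + 1)) x = rowSum m L x - L 0 x := by
    intro L hL x
    have h1 := Finset.sum_range_succ' (fun c => L c x) m
    rw [Finset.sum_range_succ, hL.col_bound m x le_rfl] at h1
    simp only [rowSum]
    omega
  have h1 := eq_of_highest (zo hM) (fun j y => hcol (j + 1) (by omega) y) (rhm hM hrow) (zo hN)
    (fun j y => hcol' (j + 1) (by omega) y) (rhm hN hrow')
    (by funext x; rw [rs hM, rs hN, hsum, h0])
  funext c
  cases c with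
  | zero => exact h0
  | succ c => exact congrFun h1 c

/-! ### Matrices whose column lengths are rearranged -/

/-- `M` and `N` have the same column lengths up to order, expressed by the sizes of all truncations
of the columns. -/
def SameLengths (m n : ℕ) (M N : ℕ → ℕ → ℤ) : Prop :=
  ∀ x : ℕ, ∑ c ∈ Finset.range m, min (x : ℤ) (colSum n M c) =
    ∑ c ∈ Finset.range m, min (x : ℤ) (colSum n N c)

theorem IsZeroOne.sum_range_le (hM : IsZeroOne m n M) (c x : ℕ) :
    ∑ z ∈ Finset.range x, M c z ≤ min (x : ℤ) (colSum n M c) := by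
  have nn : ∀ z, 0 ≤ M c z := fun z => by have := hM.zero_or_one c z; omega
  apply le_min
  · calc ∑ z ∈ Finset.range x, M c z ≤ ∑ z ∈ Finset.range x, (1 : ℤ) :=
          Finset.sum_le_sum fun z _ => by have := hM.zero_or_one c z; omega
      _ = x := by simp
  · rw [colSum]
    rcases le_total x n with h | h
    · exact Finset.sum_le_sum_of_subset_of_nonneg (Finset.range_mono h) fun z _ _ => nn z
    · refine (Finset.sum_subset (Finset.range_mono h) fun z _ hz => ?_).ge
      exact hM.row_bound c z (by simpa using hz)

theorem eq_ite_of_sum_range {f : ℕ → ℤ} {t : ℤ}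
    (h : ∀ x : ℕ, ∑ z ∈ Finset.range x, f z = min (x : ℤ) t) (x : ℕ) :
    f x = if (x : ℤ) < t then 1 else 0 := by
  have h1 := h x
  have h2 := h (x + 1)
  rw [Finset.sum_range_succ, h1] at h2
  push_cast at h2
  split_ifs <;> omega

/-- A column that is an initial segment attains the bound of `IsZeroOne.sum_range_le`. -/
theorem IsZeroOne.sum_range_eq (hM : IsZeroOne m n M) {c : ℕ} (h : ∀ x, M c (x + 1) ≤ M c x)
    (x : ℕ) : ∑ z ∈ Finset.range x, M c z = min (x : ℤ) (colSum n M c) := by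
  have hle := hM.sum_range_le c
  induction x with
  | zero =>
    have : 0 ≤ colSum n M c := Finset.sum_nonneg fun z _ => by
      have := hM.zero_or_one c z; omega
    simp [this]
  | succ x ih =>
    have h1 := hle (x + 1)
    rw [Finset.sum_range_succ] at h1 ⊢
    rcases hM.zero_or_one c x with h0 | h0
    · -- Beyond `x` there are no letters, so the sum is the length of the column.
      have hz : ∀ z, x ≤ z → M c z = 0 := by
        intro z hz
        induction z, hz using Nat.le_induction with
        | base => exact h0
        | succ z hz ih2 =>
          have := h z
          have := hM.zero_or_one c (z + 1)
          omega
      have h2 : colSum n M c ≤ ∑ z ∈ Finset.range x, M c z := by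
        rw [colSum]
        rcases le_total x n with h3 | h3
        · exact (Finset.sum_subset (Finset.range_mono h3) fun z _ hz' =>
            hz z (by simpa using hz')).ge
        · exact Finset.sum_le_sum_of_subset_of_nonneg (Finset.range_mono h3) fun z _ _ => by
            have := hM.zero_or_one c z; omega
      push_cast at *
      omega
    · push_cast at *
      omega

/-- A matrix whose column lengths and letter multiplicities are those of a highest weight matrix has
initial segments as its columns. -/
theorem column_eq_of_sameLengths (hM : IsZeroOne m n M) (hN : IsZeroOne m n N)
    (hinit : ∀ c x, N c (x + 1) ≤ N c x) (hlen : SameLengths m n M N)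
    (hsum : rowSum m M = rowSum m N) (c x : ℕ) :
    M c x = if (x : ℤ) < colSum n M c then 1 else 0 := by
  by_cases hc : c < m
  · refine eq_ite_of_sum_range (fun x => ?_) x
    -- The number of letters `< x` in the whole matrix is the largest that the column lengths
    -- allow, so this holds for each column.
    have h1 : ∑ c ∈ Finset.range m, ∑ z ∈ Finset.range x, M c z =
        ∑ c ∈ Finset.range m, min (x : ℤ) (colSum n M c) := by
      rw [hlen x, Finset.sum_comm, Finset.sum_congr rfl fun z _ =>
        show ∑ c ∈ Finset.range m, M c z = ∑ c ∈ Finset.range m, N c z from congrFun hsum z,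
        Finset.sum_comm]
      exact Finset.sum_congr rfl fun c _ => hN.sum_range_eq (hinit c) x
    exact (Finset.sum_eq_sum_iff_of_le fun c _ => hM.sum_range_le c x).mp h1 c
      (Finset.mem_range.mpr hc)
  · have h0 : colSum n M c = 0 :=
      Finset.sum_eq_zero fun z _ => hM.col_bound c z (by omega)
    rw [h0, hM.col_bound c x (by omega), if_neg (by omega)]

/-- The first column of a matrix with rearranged column lengths that can be raised to the highest
matrix `S` depends only on its length. -/
theorem column_zero_unique {S : ℕ → ℕ → ℤ} (hS : ∀ j y, colHt j S y ≤ 0)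
    (hM : IsZeroOne m n M) (hN : IsZeroOne m n N) (hMS : ColPath 0 M S) (hNS : ColPath 0 N S)
    (hMl : SameLengths m n M S) (hNl : SameLengths m n N S)
    (h0 : colSum n M 0 = colSum n N 0) : M 0 = N 0 := by
  have hSz := hM.colPath hMS
  -- The matrix `Q` is highest for both crystals.
  obtain ⟨l, Q, hl, hQ⟩ := exists_rowPath_highest hSz
  have hQz := hSz.rowPath hl
  have hQc : ∀ j y, colHt j Q y ≤ 0 := fun j => (hl.colHt_le_iff hSz j 0).mpr (hS j)
  have hQi : ∀ c x, Q c (x + 1) ≤ Q c x := fun c x => (justified_of_highest hQz hQc hQ x).2 c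
  -- Transporting `L` along the path `l` from `S` to `Q` makes its columns initial segments.  Making
  -- the columns after the first one highest keeps the first column, and leads to a matrix `U` that
  -- only depends on the length of this column; going back along `l` recovers the column.
  have main : ∀ {L : ℕ → ℕ → ℤ}, IsZeroOne m n L → ColPath 0 L S → SameLengths m n L S →
      ∃ L₁ U, IsZeroOne m n L₁ ∧ L₁ 0 = L 0 ∧ RowPath l L₁ U ∧ IsZeroOne m n U ∧
        (∀ j, 1 ≤ j → ∀ y, colHt j U y ≤ 0) ∧ (∀ i y, rowHt i U m ≤ rowHt i U y) ∧
        rowSum m U = rowSum m Q ∧ ∀ x : ℕ, U 0 x = if (x : ℤ) < colSum n L 0 then 1 else 0 := by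
    intro L hL hLS hLl
    obtain ⟨T, h1, h2⟩ := hLS.rowPath hL hl
    have hT := hL.rowPath h1
    obtain ⟨L₁, h3, h4⟩ := exists_colPath_highest hL 1
    have hL₁ := hL.colPath h3
    obtain ⟨U, h5, h6⟩ := h1.colPath hL h3
    refine ⟨L₁, U, hL₁, h3.column_eq one_pos, h6, hT.colPath h5,
      fun j hj => (h6.colHt_le_iff hL₁ j 0).mpr (h4 j hj),
      fun i => (h5.rowHighest_iff hT i).mpr ((h2.rowHighest_iff hT i).mp (hQ i)),
      (h5.rowSum_eq hT).trans (h2.rowSum_eq hT).symm, fun x => ?_⟩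
    rw [h5.column_eq one_pos, ← h1.colSum_eq hL]
    refine column_eq_of_sameLengths hT hQz hQi (fun x => ?_) (h2.rowSum_eq hT).symm 0 x
    rw [h1.colSum_eq hL, hl.colSum_eq hSz]
    exact hLl x
  obtain ⟨M₁, U, a1, a2, a3, a4, a5, a6, a7, a8⟩ := main hM hMS hMl
  obtain ⟨N₁, V, b1, b2, b3, b4, b5, b6, b7, b8⟩ := main hN hNS hNl
  have hUV : U = V := eq_of_highest_tail a4 a5 a6 b4 b5 b6 (a7.trans b7.symm)
    (by funext x; rw [a8, b8, h0])
  rw [← a2, ← b2, a3.injective a1 b1 (hUV ▸ b3)]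

/-- For each rearrangement `b` of the column lengths of the highest matrix `S` there is a matrix
with these column lengths that can be raised to `S`, and to no other highest matrix; its column
excesses are the smallest possible. -/
theorem exists_rearrangement {S : ℕ → ℕ → ℤ} (hSz : IsZeroOne m n S)
    (hS : ∀ j y, colHt j S y ≤ 0) (b : ℕ → ℕ) (hbn : ∀ c, b c ≤ n) (hbm : ∀ c, m ≤ c → b c = 0)
    (hb : ∀ x : ℕ, ∑ c ∈ Finset.range m, min (x : ℤ) (b c) =
      ∑ c ∈ Finset.range m, min (x : ℤ) (colSum n S c)) :
    ∃ T, IsZeroOne m n T ∧ ColPath 0 T S ∧ (∀ c, colSum n T c = b c) ∧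
      (∀ j y, colHt j T y ≤ max 0 ((b (j + 1) : ℤ) - b j)) ∧
      ∀ S', ColPath 0 T S' → (∀ j y, colHt j S' y ≤ 0) → S' = S := by
  obtain ⟨l, Q, hl, hQ⟩ := exists_rowPath_highest hSz
  have hQz := hSz.rowPath hl
  have hQc : ∀ j y, colHt j Q y ≤ 0 := fun j => (hl.colHt_le_iff hSz j 0).mpr (hS j)
  have hQi : ∀ c x, Q c (x + 1) ≤ Q c x := fun c x => (justified_of_highest hQz hQc hQ x).2 c
  -- The matrix `T₀` whose columns are initial segments of lengths `b` raises to the doubly highest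
  -- matrix `Q`, and `T` is obtained from it by going back along the path from `S` to `Q`.
  set T₀ : ℕ → ℕ → ℤ := fun c x => if x < b c then 1 else 0 with hT₀
  have sum₀ : ∀ c x, ∑ z ∈ Finset.range x, T₀ c z = min (x : ℤ) (b c) := by
    intro c x
    induction x with
    | zero => simp
    | succ x ih =>
      rw [Finset.sum_range_succ, ih]
      simp only [hT₀]
      push_cast
      split_ifs <;> omega
  have hT₀z : IsZeroOne m n T₀ := by
    refine ⟨fun c x => ?_, fun c x hc => ?_, fun c x hx => ?_⟩ <;> simp only [hT₀]
    · split_ifs <;> simp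
    · simp [hbm c hc]
    · have := hbn c
      rw [if_neg (by omega)]
  have hT₀c : ∀ j y, colHt j T₀ y ≤ max 0 ((b (j + 1) : ℤ) - b j) := by
    intro j y
    rw [colHt, Finset.sum_sub_distrib, sum₀, sum₀]
    omega
  have hT₀r : ∀ i y, rowHt i T₀ m ≤ rowHt i T₀ y := by
    intro i y
    have ha : Antitone (rowHt i T₀) := antitone_nat_of_succ_le fun y => by
      rw [rowHt_succ]
      simp only [hT₀]
      split_ifs <;> omega
    rcases le_total m y with h | h
    · exact (hT₀z.rowHt_const i h).ge
    · exact ha h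
  have hsum : rowSum m T₀ = rowSum m Q := by
    -- Both matrices have initial segments as columns, so the multiplicities of the letters are
    -- determined by the column lengths.
    have h1 : ∀ x, ∑ z ∈ Finset.range x, rowSum m T₀ z = ∑ z ∈ Finset.range x, rowSum m Q z := by
      intro x
      simp only [rowSum]
      rw [Finset.sum_comm, Finset.sum_comm (s := Finset.range x)]
      simp only [sum₀, hb, hQz.sum_range_eq (hQi _), hl.colSum_eq hSz]
    funext x
    have h2 := h1 (x + 1)
    rw [Finset.sum_range_succ, Finset.sum_range_succ, h1 x] at h2
    omega
  have uniq : ∀ {Q'}, ColPath 0 T₀ Q' → (∀ j y, colHt j Q' y ≤ 0) → Q' = Q := fun h hc =>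
    eq_of_highest (hT₀z.colPath h) hc (fun i => (h.rowHighest_iff hT₀z i).mpr (hT₀r i)) hQz hQc hQ
      ((h.rowSum_eq hT₀z).trans hsum)
  obtain ⟨Q', h1, h2⟩ := exists_colPath_highest hT₀z 0
  cases uniq h1 fun j => h2 j (Nat.zero_le j)
  obtain ⟨T, hT, h3, h4⟩ := hl.exists_colPath hSz hT₀z h1
  refine ⟨T, hT, h3, fun c => ?_, fun j => ?_, fun S' h5 h6 => ?_⟩
  · rw [← h4.colSum_eq hT, colSum, sum₀]
    have := hbn c
    omega
  · exact (h4.colHt_le_iff hT j _).mp (hT₀c j)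
  · obtain ⟨Q'', h7, h8⟩ := h4.colPath hT h5
    have hS' := hT.colPath h5
    cases uniq h7 fun j => (h8.colHt_le_iff hS' j 0).mpr (h6 j)
    exact h8.injective hS' hSz hl

/-! ### Exchanging the lengths of two adjacent columns -/

theorem colHt_sub_eq {z : ℕ} (h : ∀ x, z ≤ x → M j x = N j x ∧ M (j + 1) x = N (j + 1) x)
    {y : ℕ} (hy : z ≤ y) : colHt j M y - colHt j M z = colHt j N y - colHt j N z := by
  induction y, hy using Nat.le_induction with
  | base => ring
  | succ y hy ih =>
    have := h y hy
    rw [colHt_succ, colHt_succ, this.1, this.2]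
    omega

/-- If the letters of column `j + 1` are all matched, then the unmatched letters of column `j` can
be moved to column `j + 1`, by lowering operators.  A letter `x` is unmatched when the column excess
is smaller everywhere beyond `x` than at `x`. -/
theorem exists_exchange (hN : IsZeroOne m n N) (hj : j + 1 < m) (h : ∀ y, colHt j N y ≤ 0) :
    ∃ M, IsZeroOne m n M ∧ ColPath 0 M N ∧ (∀ c, c ≠ j → c ≠ j + 1 → M c = N c) ∧
      (∀ x, M j x ≤ N j x) ∧
      (∀ x, M j x < N j x → ∀ y, x < y → colHt j N y < colHt j N x) ∧
      colSum n M j = colSum n N (j + 1) ∧ colSum n M (j + 1) = colSum n N j := by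
  obtain ⟨r, hr⟩ : ∃ r : ℕ, -colHt j N n = r :=
    Int.eq_ofNat_of_zero_le (by have := h n; omega)
  -- After `t` lowering operators the maximum of the excess is `t`.  It is attained at `z`, and from
  -- `z` on nothing has changed.  The next letter to be moved is at least `z`, where the excess of
  -- `M` differs from that of `N` by a constant.
  have step : ∀ t : ℕ, t ≤ r → ∃ M z, IsZeroOne m n M ∧ ColPath 0 M N ∧
      (∀ c, c ≠ j → c ≠ j + 1 → M c = N c) ∧ (∀ x, M j x ≤ N j x) ∧
      (∀ x, M j x < N j x → ∀ y, x < y → colHt j N y < colHt j N x) ∧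
      colSum n M j = colSum n N j - t ∧ colSum n M (j + 1) = colSum n N (j + 1) + t ∧
      (∀ x, z ≤ x → M j x = N j x ∧ M (j + 1) x = N (j + 1) x) ∧
      colHt j M z = t ∧ ∀ y, colHt j M y ≤ t := by
    intro t
    induction t with
    | zero =>
      intro _
      exact ⟨N, 0, hN, .refl, fun _ _ _ => rfl, fun _ => le_rfl,
        fun x hx => absurd hx (lt_irrefl _), by simp, by simp, fun _ _ => ⟨rfl, rfl⟩,
        by simp [colHt], by simpa using h⟩
    | succ t ih =>
      intro ht
      obtain ⟨M, z, a1, a2, a3, a4, a5, a6, a7, a8, a9, a10⟩ := ih (by omega)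
      have hn : colHt j M n = 2 * t - r := by
        rw [colHt_eq_colSum] at hr ⊢
        omega
      obtain ⟨x, hx⟩ := exists_isLastMin (P := fun y => -colHt j M y) (m := n)
        (fun y hy => by rw [a1.colHt_const j hy]) ⟨z, by omega⟩
      have hx1 : ∀ y ≤ x, colHt j M y ≤ colHt j M x := fun y hy => neg_le_neg_iff.mp (hx.1 y hy)
      have hx2 : ∀ y, x < y → colHt j M y < colHt j M x := fun y hy =>
        neg_lt_neg_iff.mp (hx.2 y hy)
      have hxt : colHt j M x = t := by
        rcases le_total z x with h1 | h1
        · have := hx1 z h1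
          have := a10 x
          omega
        · rcases eq_or_lt_of_le h1 with rfl | h1
          · exact a9
          · have := hx2 z h1
            have := a10 x
            omega
      have hzx : z ≤ x := by
        by_contra h1
        have := hx2 z (by omega)
        omega
      obtain ⟨h1, h2, h3, h4, hxn⟩ := a1.colRaise_colLower hj hx
      have hxN := (a8 x hzx).1
      refine ⟨colLower j x M, x + 1, h2, .head ⟨j, Nat.zero_le j, h1⟩ a2, ?_, ?_, ?_, ?_, ?_, ?_,
        ?_, ?_⟩
      · intro c hc hc'
        rw [← a3 c hc hc']
        funext w
        simp [colLower, hc, hc']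
      · intro w
        have := a4 w
        simp only [colLower]
        split_ifs <;> omega
      · intro w hw y hy
        by_cases hwx : w = x
        · subst hwx
          have e1 := colHt_sub_eq a8 hzx
          have e2 := colHt_sub_eq a8 (hzx.trans hy.le)
          have e3 := hx2 y hy
          omega
        · refine a5 w ?_ y hy
          simpa [colLower, hwx] using hw
      · rw [Nat.cast_succ, ← sub_sub, ← a6]
        simp [colSum, colLower, Finset.sum_sub_distrib, hxn]
      · rw [Nat.cast_succ, ← add_assoc, ← a7]
        simp [colSum, colLower, Finset.sum_add_distrib, hxn]
      · intro w hw
        have hwx : w ≠ x := by omega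
        simpa [colLower, hwx] using a8 w (by omega)
      · rw [colHt_colLower, colHt_succ, if_pos (by omega), hxt, h3, h4]
        push_cast
        ring
      · intro y
        rw [colHt_colLower]
        have := a10 y
        have e3 := hx2 y
        push_cast
        split_ifs <;> omega
  obtain ⟨M, z, a1, a2, a3, a4, a5, a6, a7, -⟩ := step r le_rfl
  rw [colHt_eq_colSum] at hr
  exact ⟨M, a1, a2, a3, a4, a5, by omega, by omega⟩

end LeftKey

namespace LeftKey

/-! ### The crossing-out procedure -/

/-- The excess of `B` over `A` among the numbers `< y`. -/
def setHt (A B : Finset ℕ) (y : ℕ) : ℤ :=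
  ∑ x ∈ Finset.range y, ((if x ∈ B then 1 else 0) - if x ∈ A then 1 else 0)

/-- The columns `A` and `B`, placed next to each other with their first boxes in the same row, form
a semistandard tableau; equivalently, `B` has an injection into `A` that does not increase any
element. -/
def Dominates (A B : Finset ℕ) : Prop := ∀ y, setHt A B y ≤ 0

theorem setHt_succ (A B : Finset ℕ) (y : ℕ) : setHt A B (y + 1) =
    setHt A B y + ((if y ∈ B then 1 else 0) - if y ∈ A then 1 else 0) :=
  Finset.sum_range_succ _ _

/-- The largest element of `C` that is at most `v`. -/
def pick (C : Finset ℕ) (v : ℕ) : ℕ := (C.filter (· ≤ v)).sup id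

theorem pick_spec {C : Finset ℕ} {v : ℕ} (h : ∃ a ∈ C, a ≤ v) :
    pick C v ∈ C ∧ pick C v ≤ v ∧ ∀ a ∈ C, a ≤ v → a ≤ pick C v := by
  obtain ⟨a, ha, hav⟩ := h
  have hne : (C.filter (· ≤ v)).Nonempty := ⟨a, by simp [ha, hav]⟩
  obtain ⟨b, hb, hb'⟩ := Finset.exists_mem_eq_sup _ hne id
  rw [Finset.mem_filter] at hb
  refine ⟨?_, ?_, fun c hc hcv => ?_⟩
  · rw [pick, hb']; exact hb.1
  · rw [pick, hb']; exact hb.2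
  · exact Finset.le_sup (f := id) (by simp [hc, hcv])

theorem Dominates.exists_le {A B : Finset ℕ} (h : Dominates A B) {v : ℕ} (hv : v ∈ B) :
    ∃ a ∈ A, a ≤ v := by
  by_contra! hc
  have hx : ∀ x ∈ Finset.range (v + 1),
      ((if x ∈ B then 1 else 0) - if x ∈ A then 1 else 0 : ℤ) = if x ∈ B then 1 else 0 := by
    intro x hx
    rw [Finset.mem_range] at hx
    have hxA : x ∉ A := fun hxA => by have := hc x hxA; omega
    simp [hxA]
  have h1 := h (v + 1)
  rw [setHt, Finset.sum_congr rfl hx] at h1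
  have h2 := Finset.single_le_sum (f := fun x => if x ∈ B then (1 : ℤ) else 0)
    (fun x _ => by positivity) (Finset.self_mem_range_succ v)
  simp only [hv, if_true] at h2
  omega

theorem setHt_erase {A B : Finset ℕ} {a v : ℕ} (ha : a ∈ A) (hv : v ∈ B) (y : ℕ) :
    setHt (A.erase a) (B.erase v) y =
      setHt A B y + (if a < y then 1 else 0) - if v < y then 1 else 0 := by
  induction y with
  | zero => simp [setHt]
  | succ y ih =>
    rw [setHt_succ, setHt_succ, ih]
    simp only [Finset.mem_erase]
    by_cases h1 : y = a
    · subst h1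
      by_cases h2 : y = v
      · subst h2
        simp [ha, hv]
      · have : v < y + 1 ↔ v < y := by omega
        simp [ha, h2, this]; ring
    · have h3 : a < y + 1 ↔ a < y := by omega
      by_cases h2 : y = v
      · subst h2
        simp [hv, h1, h3]; ring
      · have : v < y + 1 ↔ v < y := by omega
        simp [h1, h2, h3, this]; ring

/-- There is nothing of `A` between `pick A v` and `v`. -/
theorem setHt_lt_of_pick {A B : Finset ℕ} {v : ℕ} (h : ∃ a ∈ A, a ≤ v) (hv : v ∈ B) {y : ℕ}
    (h1 : pick A v < y) (h2 : y ≤ v) : setHt A B y < setHt A B (v + 1) := by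
  have hA : ∀ z, y ≤ z → z ≤ v → z ∉ A := fun z hz hzv hzA => by
    have := (pick_spec h).2.2 z hzA hzv
    omega
  have h3 : ∀ z, y ≤ z → z ≤ v → setHt A B y ≤ setHt A B z := by
    intro z hz
    induction z, hz using Nat.le_induction with
    | base => exact fun _ => le_rfl
    | succ z hz ih =>
      intro hzv
      have := ih (by omega)
      rw [setHt_succ, if_neg (hA z hz (by omega))]
      split_ifs <;> omega
  have h4 := h3 v h2 le_rfl
  rw [setHt_succ, if_pos hv, if_neg (hA v h2 le_rfl)]
  omega

/-- Removing an element of `B` and its greedy partner keeps the domination. -/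
theorem Dominates.erase_pick {A B : Finset ℕ} (h : Dominates A B) {v : ℕ} (hv : v ∈ B) :
    Dominates (A.erase (pick A v)) (B.erase v) := by
  intro y
  have he := h.exists_le hv
  have hp := pick_spec he
  rw [setHt_erase hp.1 hv]
  have h1 := h y
  have h2 := h (v + 1)
  by_cases h3 : pick A v < y ∧ y ≤ v
  · have := setHt_lt_of_pick he hv h3.1 h3.2
    split_ifs <;> omega
  · split_ifs <;> omega

/-- For each element of the list in turn, remove the largest element of `C` that is at most as big;
the list of the removed elements. -/
def picks : Finset ℕ → List ℕ → List ℕ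
  | _, [] => []
  | C, v :: vs => pick C v :: picks (C.erase (pick C v)) vs

/-- The greedy choices exist and are distinct, and they avoid the elements of `A` that are unmatched
when `A` and `B` are bracketed, in whichever order `B` is listed. -/
theorem picks_spec {A : Finset ℕ} {vs : List ℕ} (hvs : vs.Nodup) (h : Dominates A vs.toFinset) :
    (picks A vs).Nodup ∧ (∀ x ∈ picks A vs, x ∈ A) ∧ (picks A vs).length = vs.length ∧
      ∀ x, (∀ y, x < y → setHt A vs.toFinset y < setHt A vs.toFinset x) → x ∉ picks A vs := by
  induction vs generalizing A with
  | nil => simp [picks]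
  | cons v vs ih =>
    obtain ⟨hv, hvs⟩ := List.nodup_cons.mp hvs
    have hvB : v ∈ (v :: vs).toFinset := by simp
    have hB : (v :: vs).toFinset.erase v = vs.toFinset := by
      rw [List.toFinset_cons, Finset.erase_insert (by simpa using hv)]
    have he := h.exists_le hvB
    have hp := pick_spec he
    have hd := h.erase_pick hvB
    have hht := setHt_erase hp.1 hvB
    rw [hB] at hd hht
    obtain ⟨i1, i2, i3, i4⟩ := ih hvs hd
    refine ⟨?_, ?_, by simp [picks, i3], ?_⟩
    · rw [picks, List.nodup_cons]
      exact ⟨fun hc => absurd (i2 _ hc) (by simp), i1⟩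
    · intro x hx
      rw [picks, List.mem_cons] at hx
      rcases hx with rfl | hx
      · exact hp.1
      · exact Finset.mem_of_mem_erase (i2 x hx)
    · intro x hx hmem
      rw [picks, List.mem_cons] at hmem
      rcases hmem with rfl | hmem
      · have h1 := hx (v + 1) (by omega)
        have h2 := setHt_succ A (v :: vs).toFinset (pick A v)
        rw [if_pos hp.1] at h2
        rcases eq_or_lt_of_le hp.2.1 with h3 | h3
        · rw [h3] at h2 h1
          rw [if_pos hvB] at h2
          omega
        · have h4 := setHt_lt_of_pick he hvB (Nat.lt_succ_self _) h3
          split_ifs at h2 <;> simp only [Nat.succ_eq_add_one] at h4 <;> omega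
      · refine i4 x (fun y hy => ?_) hmem
        rw [hht, hht]
        have h1 := hx y hy
        by_cases h3 : pick A v < y ∧ y ≤ v
        · have h4 := setHt_lt_of_pick he hvB h3.1 h3.2
          have h5 := hx (v + 1) (by omega)
          split_ifs <;> omega
        · split_ifs <;> omega

/-- The columns of a tableau: non-empty, each dominating the next one. -/
def IsTableau (L : List (Finset ℕ)) : Prop := L.IsChain Dominates ∧ ∀ C ∈ L, C.Nonempty

theorem IsTableau.tail {C : Finset ℕ} {L : List (Finset ℕ)} (h : IsTableau (C :: L)) :
    IsTableau L := ⟨h.1.tail, fun D hD => h.2 D (List.mem_cons_of_mem _ hD)⟩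

theorem lineHead_cons_cons (C D : Finset ℕ) (L : List (Finset ℕ)) :
    lineHead (C :: D :: L) = pick C (lineHead (D :: L)) := by
  have : ∃ v vs, crossingLine (D :: L) = v :: vs := by
    rw [crossingLine]
    split <;> simp
  obtain ⟨v, vs, hv⟩ := this
  simp only [lineHead]
  rw [crossingLine, hv]
  rfl

theorem crossingLine_cons (C : Finset ℕ) (L : List (Finset ℕ)) :
    crossingLine (C :: L) = lineHead (C :: L) :: crossingLine L := by
  rw [lineHead, crossingLine]
  split <;> simp_all

/-- Crossing out proceeds from right to left, so it commutes with adding a column on the left. -/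
theorem crossOut_cons (C : Finset ℕ) (L : List (Finset ℕ)) :
    crossOut (C :: L) = if (C.erase (lineHead (C :: L))).Nonempty then
      C.erase (lineHead (C :: L)) :: crossOut L else crossOut L := by
  rw [crossOut, crossingLine_cons, List.zipWith_cons_cons, List.filter_cons]
  simp only [decide_eq_true_eq]
  rfl

/-- Crossing out a line of a tableau leaves a tableau, and the line meets the first column. -/
theorem IsTableau.crossOut_spec {C : Finset ℕ} {L : List (Finset ℕ)} (h : IsTableau (C :: L)) :
    lineHead (C :: L) ∈ C ∧ IsTableau (crossOut (C :: L)) ∧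
      crossOut (C :: L) = if (C.erase (lineHead (C :: L))).Nonempty then
        C.erase (lineHead (C :: L)) :: crossOut L else [] := by
  induction L generalizing C with
  | nil =>
    have h0 := crossOut_cons C []
    have h1 : crossOut [] = [] := rfl
    rw [h1] at h0 ⊢
    refine ⟨?_, ?_, h0⟩
    · obtain ⟨b, hb, hb'⟩ := Finset.exists_mem_eq_sup C (h.2 C (by simp)) id
      have : lineHead [C] = C.sup id := rfl
      rw [this, hb']
      exact hb
    · rw [h0]
      split_ifs with h2
      · exact ⟨List.isChain_singleton _, by simpa using h2⟩
      · exact ⟨List.isChain_nil, by simp⟩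
  | cons D L ih =>
    obtain ⟨i1, i2, i3⟩ := ih h.tail
    have hCD : Dominates C D := (List.isChain_cons_cons.mp h.1).1
    have hp := pick_spec (hCD.exists_le i1)
    have hd := hCD.erase_pick i1
    rw [← lineHead_cons_cons] at hp hd
    have h0 := crossOut_cons C (D :: L)
    refine ⟨hp.1, ?_, ?_⟩
    · rw [h0]
      split_ifs with h2
      · rw [i3] at i2 ⊢
        split_ifs at i2 ⊢ with h3
        · refine ⟨List.isChain_cons_cons.mpr ⟨hd, i2.1⟩, ?_⟩
          intro E hE
          rcases List.mem_cons.mp hE with rfl | hE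
          · exact h2
          · exact i2.2 E hE
        · exact ⟨List.isChain_singleton _, by simpa using h2⟩
      · exact i2
    · rw [h0]
      split_ifs with h2
      · rfl
      · rw [i3, if_neg]
        intro h3
        obtain ⟨v, hv⟩ := h3
        obtain ⟨a, ha, -⟩ := hd.exists_le hv
        exact h2 ⟨a, ha⟩

theorem length_lineHeads (p : ℕ) (L : List (Finset ℕ)) : (lineHeads p L).length = p := by
  induction p generalizing L with
  | zero => rfl
  | succ p ih => simp [lineHeads, ih]

theorem take_lineHeads {k p : ℕ} (h : k ≤ p) (L : List (Finset ℕ)) :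
    (lineHeads p L).take k = lineHeads k L := by
  induction p generalizing k L with
  | zero => obtain rfl : k = 0 := by omega
            rfl
  | succ p ih =>
    cases k with
    | zero => rfl
    | succ k => rw [lineHeads, List.take_succ_cons, ih (by omega), lineHeads]

/-- As long as the second column is not used up, the procedure picks in the first column the
greedy choices for the numbers that it crosses out in the second column. -/
theorem lineHeads_cons_cons {k : ℕ} {C D : Finset ℕ} (L : List (Finset ℕ)) (hC : k ≤ C.card)
    (hD : k ≤ D.card) : lineHeads k (C :: D :: L) = picks C (lineHeads k (D :: L)) := by
  induction k generalizing C D L with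
  | zero => rfl
  | succ k ih =>
    rw [lineHeads, lineHeads, picks, ← lineHead_cons_cons]
    congr 1
    rcases Nat.eq_zero_or_pos k with rfl | hk
    · rfl
    · have c1 := Finset.pred_card_le_card_erase (s := C) (a := lineHead (C :: D :: L))
      have c2 := Finset.pred_card_le_card_erase (s := D) (a := lineHead (D :: L))
      rw [crossOut_cons, if_pos (Finset.card_pos.mp (by omega)), crossOut_cons D,
        if_pos (Finset.card_pos.mp (by omega))]
      exact ih _ (by omega) (by omega)

/-- The procedure uses up the first column. -/
theorem IsTableau.lineHeads_spec {C : Finset ℕ} {L : List (Finset ℕ)} (h : IsTableau (C :: L)) :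
    (lineHeads C.card (C :: L)).Nodup ∧ (lineHeads C.card (C :: L)).toFinset = C := by
  obtain ⟨c, hc⟩ : ∃ c, C.card = c := ⟨_, rfl⟩
  induction c generalizing C L with
  | zero => exact absurd (Finset.card_pos.mpr (h.2 C (by simp))) (by omega)
  | succ c ih =>
    obtain ⟨h1, h2, h3⟩ := h.crossOut_spec
    have hce := Finset.card_erase_of_mem h1
    rw [hc, lineHeads, List.nodup_cons, List.toFinset_cons]
    have key : (lineHeads c (crossOut (C :: L))).Nodup ∧
        (lineHeads c (crossOut (C :: L))).toFinset = C.erase (lineHead (C :: L)) := by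
      by_cases hne : (C.erase (lineHead (C :: L))).Nonempty
      · rw [if_pos hne] at h3
        rw [h3] at h2 ⊢
        have := ih h2 (by omega)
        rwa [hce, hc, Nat.add_sub_cancel] at this
      · have h4 := Finset.not_nonempty_iff_eq_empty.mp hne
        have : c = 0 := by
          rw [h4, hc] at hce
          simpa using hce.symm
        subst this
        rw [h4]
        simp [lineHeads]
    refine ⟨⟨fun hmem => ?_, key.1⟩, ?_⟩
    · rw [← List.mem_toFinset, key.2] at hmem
      simp at hmem
    · rw [key.2, Finset.insert_erase h1]

/-- A line takes exactly one box from each column. -/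
theorem IsTableau.exists_card_of_mem_crossOut {L : List (Finset ℕ)} (h : IsTableau L)
    {D : Finset ℕ} (hD : D ∈ crossOut L) : ∃ C ∈ L, C.card = D.card + 1 := by
  induction L with
  | nil => simp [crossOut, crossingLine] at hD
  | cons C L ih =>
    obtain ⟨h1, -, -⟩ := h.crossOut_spec
    rw [crossOut_cons] at hD
    have hc := Finset.card_erase_add_one h1
    split_ifs at hD
    · rcases List.mem_cons.mp hD with rfl | hD
      · exact ⟨C, by simp, hc.symm⟩
      · obtain ⟨E, hE, hE'⟩ := ih h.tail hD
        exact ⟨E, List.mem_cons_of_mem _ hE, hE'⟩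
    · obtain ⟨E, hE, hE'⟩ := ih h.tail hD
      exact ⟨E, List.mem_cons_of_mem _ hE, hE'⟩

/-- If no column is used up by the first line, then the second line lies strictly below it. -/
theorem IsTableau.lineHead_crossOut_lt {C : Finset ℕ} {L : List (Finset ℕ)}
    (h : IsTableau (C :: L)) (hL : ∀ D ∈ C :: L, D.card ≠ 1) :
    lineHead (crossOut (C :: L)) < lineHead (C :: L) := by
  have ne : ∀ {E : Finset ℕ} {L}, IsTableau (E :: L) → E.card ≠ 1 →
      (E.erase (lineHead (E :: L))).Nonempty := by
    intro E L h hE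
    have := Finset.card_erase_add_one h.crossOut_spec.1
    exact Finset.card_pos.mp (by omega)
  induction L generalizing C with
  | nil =>
    have hne := ne h (hL C (by simp))
    obtain ⟨h1, h2, h3⟩ := h.crossOut_spec
    rw [if_pos hne] at h3
    have h4 := (h3 ▸ h2).crossOut_spec.1
    rw [← h3] at h4
    rw [Finset.mem_erase] at h4
    exact lt_of_le_of_ne (Finset.le_sup (f := id) h4.2) h4.1
  | cons D L ih =>
    have hne := ne h (hL C (by simp))
    have hneD := ne h.tail (hL D (by simp))
    have hlt := ih h.tail fun E hE => hL E (List.mem_cons_of_mem _ hE)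
    obtain ⟨h1, h2, h3⟩ := h.crossOut_spec
    obtain ⟨-, -, i3⟩ := h.tail.crossOut_spec
    rw [if_pos hne] at h3
    rw [if_pos hneD] at i3
    rw [i3] at h3 hlt
    rw [h3] at h2 ⊢
    have hCD : Dominates C D := (List.isChain_cons_cons.mp h.1).1
    have hCD' := (List.isChain_cons_cons.mp h2.1).1
    have hp := pick_spec (hCD.exists_le h.tail.crossOut_spec.1)
    have hp' := pick_spec (hCD'.exists_le h2.tail.crossOut_spec.1)
    rw [← lineHead_cons_cons] at hp hp'
    rw [Finset.mem_erase] at hp'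
    exact lt_of_le_of_ne (hp.2.2 _ hp'.1.2 (hp'.2.1.trans hlt.le)) hp'.1.1

/-- If no column has length `t + 1`, then the number crossed out in step `t + 1` is smaller than the
one in step `t`, the steps being counted from `0`. -/
theorem IsTableau.lineHeads_decreasing {C : Finset ℕ} {L : List (Finset ℕ)}
    (h : IsTableau (C :: L)) {t p : ℕ} (hp : t + 1 < p) (hC : p ≤ C.card)
    (hL : ∀ D ∈ C :: L, D.card ≠ t + 1) :
    (lineHeads p (C :: L)).getD (t + 1) 0 < (lineHeads p (C :: L)).getD t 0 := by
  induction t generalizing C L p with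
  | zero =>
    obtain ⟨q, rfl⟩ : ∃ q, p = q + 2 := ⟨p - 2, by omega⟩
    simpa [lineHeads] using h.lineHead_crossOut_lt hL
  | succ t ih =>
    obtain ⟨q, rfl⟩ : ∃ q, p = q + 1 := ⟨p - 1, by omega⟩
    obtain ⟨h1, h2, h3⟩ := h.crossOut_spec
    have hc := Finset.card_erase_add_one h1
    rw [if_pos (Finset.card_pos.mp (by omega))] at h3
    have h4 := ih (h3 ▸ h2) (p := q) (by omega) (by omega) (by
      intro D hD
      rw [← h3] at hD
      obtain ⟨E, hE, hE'⟩ := h.exists_card_of_mem_crossOut hD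
      have := hL E hE
      omega)
    rw [← h3] at h4
    simpa [lineHeads] using h4

/-! ### The crossed-out numbers as the first column of a rearrangement -/

/-- The matrix with the given columns. -/
def indicator (C : ℕ → Finset ℕ) : ℕ → ℕ → ℤ := fun c x => if x ∈ C c then 1 else 0

theorem colHt_indicator (j : ℕ) (C : ℕ → Finset ℕ) (y : ℕ) :
    colHt j (indicator C) y = setHt (C j) (C (j + 1)) y := rfl

theorem sum_ite_mem_range {A : Finset ℕ} {n : ℕ} (h : ∀ x ∈ A, x < n) :
    ∑ x ∈ Finset.range n, (if x ∈ A then (1 : ℤ) else 0) = A.card := by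
  rw [Finset.sum_ite_mem, Finset.inter_eq_right.mpr fun x hx => Finset.mem_range.mpr (h x hx)]
  simp

/-- Moving the `j`-th column of a tableau to the front by successive exchanges of adjacent columns
produces the numbers crossed out first. -/
theorem exists_front_rearrangement {m n : ℕ} {L : List (Finset ℕ)} (hL : IsTableau L)
    (hm : L.length = m) (hn : ∀ C ∈ L, ∀ x ∈ C, x < n) {j : ℕ} (hj : j < m) :
    ∃ M, IsZeroOne m n M ∧ ColPath 0 M (indicator fun c => L.getD c ∅) ∧
      SameLengths m n M (indicator fun c => L.getD c ∅) ∧ colSum n M 0 = (L.getD j ∅).card ∧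
      ∀ x, M 0 x = if x ∈ lineHeads (L.getD j ∅).card L then 1 else 0 := by
  have getD_eq : ∀ c (hc : c < m), L.getD c ∅ = L[c] := fun c hc =>
    List.getD_eq_getElem _ _ (by omega)
  have getD_lt : ∀ c, ∀ x ∈ L.getD c ∅, x < n := by
    intro c x hx
    by_cases hc : c < m
    · rw [getD_eq c hc] at hx
      exact hn _ (List.getElem_mem _) x hx
    · rw [List.getD_eq_default _ _ (by omega)] at hx
      simp at hx
  set S := indicator fun c => L.getD c ∅ with hS
  have hSz : IsZeroOne m n S := by
    refine ⟨fun c x => ?_, fun c x hc => ?_, fun c x hx => ?_⟩ <;> simp only [hS, indicator]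
    · split_ifs <;> simp
    · rw [List.getD_eq_default _ _ (by omega)]
      simp
    · rw [if_neg fun h => absurd (getD_lt c x h) (by omega)]
  have drop_eq : ∀ c, c < m → L.drop c = L.getD c ∅ :: L.drop (c + 1) := by
    intro c hc
    rw [getD_eq c hc]
    exact List.drop_eq_getElem_cons (by omega)
  have drop_tab : ∀ c, IsTableau (L.drop c) := fun c =>
    ⟨hL.1.drop c, fun C hC => hL.2 C (List.mem_of_mem_drop hC)⟩
  have dom : ∀ c, c + 1 < m → Dominates (L.getD c ∅) (L.getD (c + 1) ∅) := by
    intro c hc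
    have := (drop_tab c).1
    rw [drop_eq c (by omega), drop_eq (c + 1) hc] at this
    exact (List.isChain_cons_cons.mp this).1
  have card_le : ∀ c, c + 1 < m → (L.getD (c + 1) ∅).card ≤ (L.getD c ∅).card := by
    intro c hc
    have := dom c hc n
    rw [setHt, Finset.sum_sub_distrib, sum_ite_mem_range (getD_lt _),
      sum_ite_mem_range (getD_lt _)] at this
    omega
  set k := (L.getD j ∅).card with hk
  have k_le : ∀ i, i ≤ j → k ≤ (L.getD i ∅).card := by
    intro i hi
    induction hi using Nat.decreasingInduction with
    | self => exact le_rfl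
    | of_succ i hi ih => exact ih.trans (card_le i (by omega))
  have heads : ∀ i, i ≤ j → (lineHeads k (L.drop i)).Nodup ∧
      ∀ x ∈ lineHeads k (L.drop i), x ∈ L.getD i ∅ := by
    intro i hi
    have h0 := drop_tab i
    have h1 := drop_eq i (by omega)
    rw [h1] at h0
    obtain ⟨h2, h3⟩ := h0.lineHeads_spec
    rw [h1, ← take_lineHeads (k_le i hi)]
    refine ⟨h2.sublist (List.take_sublist _ _), fun x hx => ?_⟩
    rw [← h3, List.mem_toFinset]
    exact List.mem_of_mem_take hx
  have step : ∀ i, i ≤ j → ∃ M, IsZeroOne m n M ∧ ColPath 0 M S ∧ SameLengths m n M S ∧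
      colSum n M i = k ∧ (∀ c < i, M c = S c) ∧
      ∀ x, M i x = if x ∈ lineHeads k (L.drop i) then 1 else 0 := by
    intro i hi
    induction hi using Nat.decreasingInduction with
    | self =>
      refine ⟨S, hSz, .refl, fun _ => rfl, sum_ite_mem_range (getD_lt j), fun _ _ => rfl,
        fun x => ?_⟩
      have h0 := drop_tab j
      rw [drop_eq j hj] at h0 ⊢
      have := h0.lineHeads_spec.2
      rw [← hk] at this
      simp only [← List.mem_toFinset, this]
      rfl
    -- Exchange columns `i` and `i + 1` of `N`: column `i + 1` holds the numbers that the
    -- procedure crosses out in this column of the tableau.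
    | of_succ i hi ih =>
      obtain ⟨N, a1, a2, a3, a4, a5, a6⟩ := ih
      obtain ⟨b1, b2⟩ := heads (i + 1) hi
      have hlen := length_lineHeads k (L.drop (i + 1))
      have hH : lineHeads k (L.drop i) = picks (L.getD i ∅) (lineHeads k (L.drop (i + 1))) := by
        rw [drop_eq i (by omega), drop_eq (i + 1) (by omega)]
        exact lineHeads_cons_cons _ (k_le i (by omega)) (k_le (i + 1) hi)
      have hNi : ∀ x, N i x = if x ∈ L.getD i ∅ then 1 else 0 := fun x => by
        rw [a5 i (by omega)]; rfl
      have hht : ∀ y, colHt i N y =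
          setHt (L.getD i ∅) (lineHeads k (L.drop (i + 1))).toFinset y := by
        intro y
        simp only [colHt, setHt, a6, hNi, List.mem_toFinset]
      have hdom : Dominates (L.getD i ∅) (lineHeads k (L.drop (i + 1))).toFinset := by
        intro y
        refine le_trans (Finset.sum_le_sum fun x _ => ?_) (dom i (by omega) y)
        have := b2 x
        simp only [List.mem_toFinset]
        split_ifs <;> simp_all
      obtain ⟨p1, p2, p3, p4⟩ := picks_spec b1 hdom
      rw [← hH] at p1 p2 p3 p4
      obtain ⟨M, c1, c2, c3, c4, c5, c6, c7⟩ :=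
        exists_exchange a1 (j := i) (by omega) fun y => (hht y).trans_le (hdom y)
      -- The greedy choices are matched letters, which the exchange leaves in place; since there are
      -- as many of them as there are letters left, they are all of column `i`.
      have hle : ∀ x, (if x ∈ lineHeads k (L.drop i) then (1 : ℤ) else 0) ≤ M i x := by
        intro x
        have h01 := c1.zero_or_one i x
        split_ifs with hx
        · by_contra hlt
          refine p4 x (fun y hy => ?_) hx
          rw [← hht, ← hht]
          refine c5 x ?_ y hy
          rw [hNi, if_pos (p2 x hx)]
          omega
        · omega
      refine ⟨M, c1, c2.trans a2, fun x => ?_, c6.trans a4, fun c hc => ?_, fun x => ?_⟩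
      · rw [← a3 x]
        refine Finset.sum_equiv (Equiv.swap i (i + 1)) (fun c => ?_) fun c _ => ?_
        · simp only [Finset.mem_range, Equiv.swap_apply_def]
          split_ifs <;> omega
        · rcases eq_or_ne c i with rfl | h1
          · rw [Equiv.swap_apply_left, c6]
          rcases eq_or_ne c (i + 1) with rfl | h2
          · rw [Equiv.swap_apply_right, c7]
          · rw [Equiv.swap_apply_of_ne_of_ne h1 h2, colSum, colSum, c3 c h1 h2]
      · rw [c3 c (by omega) (by omega), a5 c (by omega)]
      · by_cases hx : x < n
        · have hsum : ∑ x ∈ Finset.range n, (if x ∈ lineHeads k (L.drop i) then (1 : ℤ) else 0) =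
              ∑ x ∈ Finset.range n, M i x := by
            have h1 := sum_ite_mem_range (A := (lineHeads k (L.drop i)).toFinset) (n := n)
              fun x hx => getD_lt i x (p2 x (List.mem_toFinset.mp hx))
            rw [List.toFinset_card_of_nodup p1, p3, hlen] at h1
            simp only [List.mem_toFinset] at h1
            rw [h1]
            exact (c6.trans a4).symm
          exact ((Finset.sum_eq_sum_iff_of_le fun x _ => hle x).mp hsum x
            (Finset.mem_range.mpr hx)).symm
        · rw [c1.row_bound i x (by omega), if_neg fun hmem =>
            hx (getD_lt i x (p2 x hmem))]
  obtain ⟨M, a1, a2, a3, a4, -, a6⟩ := step 0 (Nat.zero_le j)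
  exact ⟨M, a1, a2, a3, a4, a6⟩

end LeftKey

namespace LeftKey

/-! ### Jeu de taquin slides as raising operators -/

/-- The set of the entries in column `c` of the filling `e` of the boxes in `X`. -/
def entrySets (X : Finset (ℕ × ℕ)) (e : ℕ × ℕ → ℕ) (c : ℕ) : Finset ℕ :=
  (X.filter fun p => p.2 = c).image e

theorem mem_entrySets {X : Finset (ℕ × ℕ)} {e : ℕ × ℕ → ℕ} {c x : ℕ} :
    x ∈ entrySets X e c ↔ ∃ r, (r, c) ∈ X ∧ e (r, c) = x := by
  simp only [entrySets, Finset.mem_image, Finset.mem_filter, Prod.exists]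
  constructor
  · rintro ⟨a, b, ⟨h, rfl⟩, rfl⟩
    exact ⟨a, h, rfl⟩
  · rintro ⟨r, h, rfl⟩
    exact ⟨r, c, ⟨h, rfl⟩, rfl⟩

/-- The zero-one matrix of a skew tableau. -/
def SkewTableau.matrix (T : SkewTableau) : ℕ → ℕ → ℤ :=
  indicator (entrySets (T.outer.cells \ T.inner.cells) T.entry)

/-- A filling of the skew shape `D / I` with a hole `q`, as it occurs in a jeu de taquin slide. -/
structure IsHoleTableau (D I : YoungDiagram) (e : ℕ × ℕ → ℕ) (q : ℕ × ℕ) : Prop where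
  mem : q ∈ D
  notMem : q ∉ I
  mono : ∀ p r, p ∉ I → p ≠ q → r ∈ D → r ≠ q → p.1 ≤ r.1 → p.2 ≤ r.2 → e p ≤ e r
  strict : ∀ p r, p ∉ I → p ≠ q → r ∈ D → r ≠ q → p.1 < r.1 → p.2 ≤ r.2 → e p < e r
  zeros : ∀ c, c ∉ D ∨ c ∈ I ∨ c = q → e c = 0

/-- The zero-one matrix of a filling with a hole. -/
def holeMatrix (D I : YoungDiagram) (e : ℕ × ℕ → ℕ) (q : ℕ × ℕ) : ℕ → ℕ → ℤ :=
  indicator (entrySets ((D.cells \ I.cells).erase q) e)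

theorem mem_holeSets {D I : YoungDiagram} {e : ℕ × ℕ → ℕ} {q : ℕ × ℕ} {c x : ℕ} :
    x ∈ entrySets ((D.cells \ I.cells).erase q) e c ↔
      ∃ r, (r, c) ≠ q ∧ (r, c) ∈ D ∧ (r, c) ∉ I ∧ e (r, c) = x := by
  rw [mem_entrySets]
  simp only [Finset.mem_erase, Finset.mem_sdiff, YoungDiagram.mem_cells, and_assoc]

/-- The increment of the excess between `y` and `z`. -/
theorem setHt_sub (A B : Finset ℕ) {y z : ℕ} (h : y ≤ z) : setHt A B z - setHt A B y =
    ((Finset.Ico y z ∩ B).card : ℤ) - (Finset.Ico y z ∩ A).card := by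
  rw [setHt, setHt, ← Finset.sum_Ico_eq_sub _ h, Finset.sum_sub_distrib, Finset.sum_ite_mem,
    Finset.sum_ite_mem]
  simp

section HoleMove

variable {D I : YoungDiagram} {e : ℕ × ℕ → ℕ} {i j : ℕ}

/-- A vertical move of the hole does not change the matrix. -/
theorem IsHoleTableau.up (h : IsHoleTableau D I e (i, j)) (hD : (i + 1, j) ∈ D)
    (hle : (i, j + 1) ∈ D → e (i + 1, j) ≤ e (i, j + 1)) :
    IsHoleTableau D I
      (Function.update (Function.update e (i, j) (e (i + 1, j))) (i + 1, j) 0) (i + 1, j) ∧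
    holeMatrix D I
      (Function.update (Function.update e (i, j) (e (i + 1, j))) (i + 1, j) 0) (i + 1, j) =
      holeMatrix D I e (i, j) := by
  have hI : (i + 1, j) ∉ I := fun hc => h.notMem (I.up_left_mem (Nat.le_succ i) le_rfl hc)
  have hne : (i + 1, j) ≠ (i, j) := by simp
  set e' := Function.update (Function.update e (i, j) (e (i + 1, j))) (i + 1, j) 0 with he'
  have v1 : e' (i, j) = e (i + 1, j) := by simp [he']
  have v2 : e' (i + 1, j) = 0 := by simp [he']
  have v3 : ∀ p, p ≠ (i, j) → p ≠ (i + 1, j) → e' p = e p := fun p h1 h2 => by simp [he', h1, h2]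
  have below : ∀ r : ℕ × ℕ, r ∈ D → r ≠ (i, j) → r ≠ (i + 1, j) → i ≤ r.1 → j ≤ r.2 →
      e (i + 1, j) ≤ e r ∧ (i < r.1 → e (i + 1, j) < e r) := by
    rintro ⟨a, b⟩ hr h1 h2 h3 h4
    simp only [ne_eq, Prod.mk.injEq, not_and] at h1 h2 h3 h4
    by_cases h5 : a ≤ i + 1
    · have hb : j + 1 ≤ b := by omega
      have hr1 : (i, j + 1) ∈ D := D.up_left_mem h3 hb hr
      have hr2 : (i, b) ∈ D := D.up_left_mem h3 le_rfl hr
      have hi1 : (i, j + 1) ∉ I := fun hc => h.notMem (I.up_left_mem le_rfl (Nat.le_succ j) hc)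
      have hi2 : (i, b) ∉ I := fun hc => h.notMem (I.up_left_mem le_rfl h4 hc)
      have hq : (i, b) ≠ (i, j) := by simp; omega
      have k1 := hle hr1
      have k2 := h.mono (i, j + 1) (i, b) hi1 (by simp) hr2 hq le_rfl hb
      have hrq : (a, b) ≠ (i, j) := by simp; omega
      have k3 := h.mono (i, b) (a, b) hi2 hq hr hrq h3 le_rfl
      refine ⟨by omega, fun h6 => ?_⟩
      have k4 := h.strict (i, b) (a, b) hi2 hq hr hrq h6 le_rfl
      omega
    · have hrq : (a, b) ≠ (i, j) := by simp; omega
      have := h.strict (i + 1, j) (a, b) hI hne hr hrq (by simp; omega) h4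
      exact ⟨this.le, fun _ => this⟩
  refine ⟨⟨hD, hI, ?_, ?_, ?_⟩, ?_⟩
  · intro p r hp hpq hr hrq h1 h2
    by_cases hpi : p = (i, j)
    · subst hpi
      rw [v1]
      by_cases hri : r = (i, j)
      · rw [hri, v1]
      · rw [v3 r hri hrq]
        exact (below r hr hri hrq h1 h2).1
    · rw [v3 p hpi hpq]
      by_cases hri : r = (i, j)
      · rw [hri, v1]
        rw [hri] at h1 h2
        exact h.mono p (i + 1, j) hp hpi hD hne (h1.trans (Nat.le_succ i)) h2
      · rw [v3 r hri hrq]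
        exact h.mono p r hp hpi hr hri h1 h2
  · intro p r hp hpq hr hrq h1 h2
    by_cases hpi : p = (i, j)
    · subst hpi
      rw [v1]
      by_cases hri : r = (i, j)
      · rw [hri] at h1; exact absurd h1 (lt_irrefl _)
      · rw [v3 r hri hrq]
        exact (below r hr hri hrq h1.le h2).2 h1
    · rw [v3 p hpi hpq]
      by_cases hri : r = (i, j)
      · rw [hri, v1]
        rw [hri] at h1 h2
        exact h.strict p (i + 1, j) hp hpi hD hne (h1.trans (Nat.lt_succ_self i)) h2
      · rw [v3 r hri hrq]
        exact h.strict p r hp hpi hr hri h1 h2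
  · intro c hc
    by_cases hc1 : c = (i + 1, j)
    · rw [hc1, v2]
    by_cases hc2 : c = (i, j)
    · subst hc2
      rcases hc with hc | hc | hc
      · exact absurd h.mem hc
      · exact absurd hc h.notMem
      · exact absurd hc.symm hne
    · rw [v3 c hc2 hc1]
      exact h.zeros c (by tauto)
  · unfold holeMatrix
    congr 1
    funext c
    ext x
    rw [mem_holeSets, mem_holeSets]
    constructor
    · rintro ⟨r, h1, h2, h3, h4⟩
      by_cases hr : (r, c) = (i, j)
      · obtain ⟨rfl, rfl⟩ := Prod.mk.inj hr
        exact ⟨r + 1, hne, hD, hI, v1 ▸ h4⟩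
      · exact ⟨r, hr, h2, h3, v3 _ hr h1 ▸ h4⟩
    · rintro ⟨r, h1, h2, h3, h4⟩
      by_cases hr : (r, c) = (i + 1, j)
      · obtain ⟨rfl, rfl⟩ := Prod.mk.inj hr
        exact ⟨i, hne.symm, h.mem, h.notMem, v1.trans h4⟩
      · exact ⟨r, hr, h2, h3, (v3 _ h1 hr).trans h4⟩

/-- A horizontal move of the hole raises the matrix: the boxes of the two columns above the hole,
and those below it, are compared row by row. -/
theorem IsHoleTableau.isFirstMax (h : IsHoleTableau D I e (i, j)) (hD : (i, j + 1) ∈ D)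
    (hlt : (i + 1, j) ∈ D → e (i, j + 1) < e (i + 1, j)) :
    IsFirstMax (colHt j (holeMatrix D I e (i, j))) (e (i, j + 1)) := by
  have hI : (i, j + 1) ∉ I := fun hc => h.notMem (I.up_left_mem le_rfl (Nat.le_succ j) hc)
  have hne : ∀ r, (r, j + 1) ≠ (i, j) := by simp
  set w := e (i, j + 1) with hw
  set A := entrySets ((D.cells \ I.cells).erase (i, j)) e j with hA
  set B := entrySets ((D.cells \ I.cells).erase (i, j)) e (j + 1) with hB
  have hAB : ∀ y, colHt j (holeMatrix D I e (i, j)) y = setHt A B y := fun _ => rfl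
  have below : ∀ r, i < r → (r, j) ∈ D → w < e (r, j) := by
    intro r hr hrD
    have h1 : (i + 1, j) ∈ D := D.up_left_mem hr le_rfl hrD
    have h2 : (i + 1, j) ∉ I := fun hc => h.notMem (I.up_left_mem (Nat.le_succ i) le_rfl hc)
    refine (hlt h1).trans_le (h.mono (i + 1, j) (r, j) h2 (by simp) hrD (by simp; omega) hr le_rfl)
  constructor
  · intro y hy
    rw [hAB, hAB]
    have hsub := setHt_sub A B (show y ≤ w + 1 by omega)
    have hwB : w ∈ Finset.Ico y (w + 1) ∩ B := by
      rw [Finset.mem_inter, Finset.mem_Ico, hB, mem_holeSets]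
      exact ⟨⟨hy, Nat.lt_succ_self w⟩, i, hne i, hD, hI, rfl⟩
    have hcard : (Finset.Ico y (w + 1) ∩ A).card ≤ ((Finset.Ico y (w + 1) ∩ B).erase w).card := by
      have hAsub : Finset.Ico y (w + 1) ∩ A ⊆ ((Finset.range i).filter fun r =>
          (r, j) ∉ I ∧ y ≤ e (r, j)).image fun r => e (r, j) := by
        intro x hx
        rw [Finset.mem_inter, Finset.mem_Ico, hA, mem_holeSets] at hx
        obtain ⟨⟨hx1, hx2⟩, r, h1, h2, h3, rfl⟩ := hx
        have hri : r < i := by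
          by_contra hri
          have : r ≠ i := by rintro rfl; exact h1 rfl
          have := below r (by omega) h2
          omega
        exact Finset.mem_image.mpr ⟨r, by simp [hri, h3, hx1], rfl⟩
      refine (Finset.card_le_card hAsub).trans (Finset.card_image_le.trans ?_)
      refine Finset.card_le_card_of_injOn (fun r => e (r, j + 1)) (fun r hr => ?_)
        (fun r hr s hs hrs => ?_)
      · simp only [Finset.coe_filter, Finset.mem_range, Set.mem_ofPred_eq] at hr
        obtain ⟨h1, h2, h3⟩ := hr
        have h4 : (r, j + 1) ∈ D := D.up_left_mem h1.le le_rfl hD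
        have h5 : (r, j + 1) ∉ I := fun hc => h2 (I.up_left_mem le_rfl (Nat.le_succ j) hc)
        have h6 := h.mono (r, j) (r, j + 1) h2 (by simp; omega) h4 (hne r) le_rfl (Nat.le_succ j)
        have h7 := h.strict (r, j + 1) (i, j + 1) h5 (hne r) hD (hne i) h1 le_rfl
        beta_reduce
        rw [Finset.mem_coe, Finset.mem_erase, Finset.mem_inter, Finset.mem_Ico, hB, mem_holeSets]
        exact ⟨by omega, ⟨by omega, by omega⟩, r, hne r, h4, h5, rfl⟩
      · simp only [Finset.coe_filter, Finset.mem_range, Set.mem_ofPred_eq] at hr hs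
        have hin : ∀ r, r < i → (r, j) ∉ I → (r, j + 1) ∈ D ∧ (r, j + 1) ∉ I := fun r h1 h2 =>
          ⟨D.up_left_mem h1.le le_rfl hD, fun hc => h2 (I.up_left_mem le_rfl (Nat.le_succ j) hc)⟩
        have hr' := hin r hr.1 hr.2.1
        have hs' := hin s hs.1 hs.2.1
        simp only at hrs
        rcases lt_trichotomy r s with hl | hl | hl
        · have := h.strict (r, j + 1) (s, j + 1) hr'.2 (hne r) hs'.1 (hne s) hl le_rfl
          omega
        · exact hl
        · have := h.strict (s, j + 1) (r, j + 1) hs'.2 (hne s) hr'.1 (hne r) hl le_rfl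
          omega
    have := Finset.card_erase_add_one hwB
    omega
  · intro y hy
    rw [hAB, hAB]
    have hsub := setHt_sub A B (show w + 1 ≤ y by omega)
    have hcard : (Finset.Ico (w + 1) y ∩ B).card ≤ (Finset.Ico (w + 1) y ∩ A).card := by
      have hBsub : Finset.Ico (w + 1) y ∩ B ⊆ ((Finset.range (D.colLen (j + 1))).filter fun r =>
          i < r ∧ e (r, j + 1) < y).image fun r => e (r, j + 1) := by
        intro x hx
        rw [Finset.mem_inter, Finset.mem_Ico, hB, mem_holeSets] at hx
        obtain ⟨⟨hx1, hx2⟩, r, h1, h2, h3, rfl⟩ := hx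
        have hri : i < r := by
          by_contra hri
          have := h.mono (r, j + 1) (i, j + 1) h3 (hne r) hD (hne i) (not_lt.mp hri) le_rfl
          omega
        exact Finset.mem_image.mpr
          ⟨r, by simp [hri, hx2, YoungDiagram.mem_iff_lt_colLen.mp h2], rfl⟩
      refine (Finset.card_le_card hBsub).trans (Finset.card_image_le.trans ?_)
      have hin : ∀ r, r < D.colLen (j + 1) → i < r → (r, j + 1) ∈ D ∧ (r, j) ∈ D ∧ (r, j) ∉ I ∧
          (r, j) ≠ (i, j) := fun r h1 h2 => by
        have h3 := YoungDiagram.mem_iff_lt_colLen.mpr h1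
        exact ⟨h3, D.up_left_mem le_rfl (Nat.le_succ j) h3,
          fun hc => h.notMem (I.up_left_mem h2.le le_rfl hc), by simp; omega⟩
      refine Finset.card_le_card_of_injOn (fun r => e (r, j)) (fun r hr => ?_)
        (fun r hr s hs hrs => ?_)
      · simp only [Finset.coe_filter, Finset.mem_range, Set.mem_ofPred_eq] at hr
        obtain ⟨h1, h2, h3⟩ := hr
        obtain ⟨h4, h5, h6, h7⟩ := hin r h1 h2
        have h8 := h.mono (r, j) (r, j + 1) h6 h7 h4 (hne r) le_rfl (Nat.le_succ j)
        have h9 := below r h2 h5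
        beta_reduce
        rw [Finset.mem_coe, Finset.mem_inter, Finset.mem_Ico, hA, mem_holeSets]
        exact ⟨⟨by omega, by omega⟩, r, h7, h5, h6, rfl⟩
      · simp only [Finset.coe_filter, Finset.mem_range, Set.mem_ofPred_eq] at hr hs
        obtain ⟨-, h5, h6, h7⟩ := hin r hr.1 hr.2.1
        obtain ⟨-, k5, k6, k7⟩ := hin s hs.1 hs.2.1
        simp only at hrs
        rcases lt_trichotomy r s with hl | hl | hl
        · have := h.strict (r, j) (s, j) h6 h7 k5 k7 hl le_rfl
          omega
        · exact hl
        · have := h.strict (s, j) (r, j) k6 k7 h5 h7 hl le_rfl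
          omega
    omega

/-- A horizontal move of the hole is a raising operator on the columns. -/
theorem IsHoleTableau.left (h : IsHoleTableau D I e (i, j)) (hD : (i, j + 1) ∈ D)
    (hlt : (i + 1, j) ∈ D → e (i, j + 1) < e (i + 1, j)) :
    IsHoleTableau D I
      (Function.update (Function.update e (i, j) (e (i, j + 1))) (i, j + 1) 0) (i, j + 1) ∧
    ColRaise j (holeMatrix D I e (i, j)) (holeMatrix D I
      (Function.update (Function.update e (i, j) (e (i, j + 1))) (i, j + 1) 0) (i, j + 1)) := by
  have hI : (i, j + 1) ∉ I := fun hc => h.notMem (I.up_left_mem le_rfl (Nat.le_succ j) hc)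
  have hne : (i, j + 1) ≠ (i, j) := by simp
  have hmax := h.isFirstMax hD hlt
  set e' := Function.update (Function.update e (i, j) (e (i, j + 1))) (i, j + 1) 0 with he'
  have v1 : e' (i, j) = e (i, j + 1) := by simp [he']
  have v2 : e' (i, j + 1) = 0 := by simp [he']
  have v3 : ∀ p, p ≠ (i, j) → p ≠ (i, j + 1) → e' p = e p := fun p h1 h2 => by simp [he', h1, h2]
  have below : ∀ r : ℕ × ℕ, r ∈ D → r ≠ (i, j) → r ≠ (i, j + 1) → i ≤ r.1 → j ≤ r.2 →
      e (i, j + 1) ≤ e r ∧ (i < r.1 → e (i, j + 1) < e r) := by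
    rintro ⟨a, b⟩ hr h1 h2 h3 h4
    by_cases h5 : j + 1 ≤ b
    · exact ⟨h.mono (i, j + 1) (a, b) hI hne hr h1 h3 h5,
        fun h6 => h.strict (i, j + 1) (a, b) hI hne hr h1 h6 h5⟩
    · simp only [ne_eq, Prod.mk.injEq, not_and] at h1 h2 h3 h4
      obtain rfl : b = j := by omega
      have h6 : i + 1 ≤ a := by omega
      have h7 : (i + 1, b) ∈ D := D.up_left_mem h6 le_rfl hr
      have h8 : (i + 1, b) ∉ I := fun hc => h.notMem (I.up_left_mem (Nat.le_succ i) le_rfl hc)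
      have h9 := h.mono (i + 1, b) (a, b) h8 (by simp) hr (by simp; omega) h6 le_rfl
      have h10 := hlt h7
      exact ⟨by omega, fun _ => by omega⟩
  refine ⟨⟨hD, hI, ?_, ?_, ?_⟩, e (i, j + 1), hmax, ?_⟩
  · intro p r hp hpq hr hrq h1 h2
    by_cases hpi : p = (i, j)
    · subst hpi
      rw [v1]
      by_cases hri : r = (i, j)
      · rw [hri, v1]
      · rw [v3 r hri hrq]
        exact (below r hr hri hrq h1 h2).1
    · rw [v3 p hpi hpq]
      by_cases hri : r = (i, j)
      · rw [hri, v1]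
        rw [hri] at h1 h2
        exact h.mono p (i, j + 1) hp hpi hD hne h1 (h2.trans (Nat.le_succ j))
      · rw [v3 r hri hrq]
        exact h.mono p r hp hpi hr hri h1 h2
  · intro p r hp hpq hr hrq h1 h2
    by_cases hpi : p = (i, j)
    · subst hpi
      rw [v1]
      by_cases hri : r = (i, j)
      · rw [hri] at h1; exact absurd h1 (lt_irrefl _)
      · rw [v3 r hri hrq]
        exact (below r hr hri hrq h1.le h2).2 h1
    · rw [v3 p hpi hpq]
      by_cases hri : r = (i, j)
      · rw [hri, v1]
        rw [hri] at h1 h2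
        exact h.strict p (i, j + 1) hp hpi hD hne h1 (h2.trans (Nat.le_succ j))
      · rw [v3 r hri hrq]
        exact h.strict p r hp hpi hr hri h1 h2
  · intro c hc
    by_cases hc1 : c = (i, j + 1)
    · rw [hc1, v2]
    by_cases hc2 : c = (i, j)
    · subst hc2
      rcases hc with hc | hc | hc
      · exact absurd h.mem hc
      · exact absurd hc h.notMem
      · exact absurd hc.symm hne
    · rw [v3 c hc2 hc1]
      exact h.zeros c (by tauto)
  · -- Only columns `j` and `j + 1` change, by the letter that moves.
    have hstep := hmax.1 _ le_rfl
    rw [colHt_succ] at hstep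
    have key : ∀ c x, x ∈ entrySets ((D.cells \ I.cells).erase (i, j + 1)) e' c ↔
        (x ∈ entrySets ((D.cells \ I.cells).erase (i, j)) e c ∧
          ¬(c = j + 1 ∧ x = e (i, j + 1))) ∨ (c = j ∧ x = e (i, j + 1)) := by
      intro c x
      rw [mem_holeSets, mem_holeSets]
      constructor
      · rintro ⟨r, h1, h2, h3, rfl⟩
        by_cases hr : (r, c) = (i, j)
        · obtain ⟨rfl, rfl⟩ := Prod.mk.inj hr
          exact .inr ⟨rfl, v1⟩
        · rw [v3 _ hr h1]
          refine .inl ⟨⟨r, hr, h2, h3, rfl⟩, ?_⟩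
          rintro ⟨rfl, h4⟩
          rcases lt_trichotomy r i with hl | hl | hl
          · have := h.strict (r, j + 1) (i, j + 1) h3 hr hD hne hl le_rfl
            omega
          · exact h1 (by rw [hl])
          · have := h.strict (i, j + 1) (r, j + 1) hI hne h2 hr hl le_rfl
            omega
      · rintro (⟨⟨r, h1, h2, h3, rfl⟩, h4⟩ | ⟨rfl, rfl⟩)
        · have hr : (r, c) ≠ (i, j + 1) := by
            intro hr
            obtain ⟨rfl, rfl⟩ := Prod.mk.inj hr
            exact h4 ⟨rfl, rfl⟩
          exact ⟨r, hr, h2, h3, v3 _ h1 hr⟩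
        · exact ⟨i, hne.symm, h.mem, h.notMem, v1⟩
    funext c x
    simp only [holeMatrix, indicator, colMove] at hstep ⊢
    by_cases hc1 : c = j ∧ x = e (i, j + 1)
    · obtain ⟨rfl, rfl⟩ := hc1
      rw [if_pos ((key _ _).mpr (.inr ⟨rfl, rfl⟩))]
      rw [if_neg (show ¬e (i, c + 1) ∈ entrySets ((D.cells \ I.cells).erase (i, c)) e c by
        intro hc
        rw [if_pos hc] at hstep
        split_ifs at hstep <;> omega)]
      simp
    · by_cases hc2 : c = j + 1 ∧ x = e (i, j + 1)
      · obtain ⟨rfl, rfl⟩ := hc2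
        rw [if_neg (fun hc => by simpa using (key _ _).mp hc), if_pos (mem_holeSets.mpr
          ⟨i, hne, hD, hI, rfl⟩)]
        simp
      · have := key c x
        simp only [hc1, hc2, not_false_eq_true, and_true, or_false] at this
        simp only [this, hc1, hc2, if_false]
        ring

theorem IsHoleTableau.holeMove {e' : ℕ × ℕ → ℕ} {q q' : ℕ × ℕ} (h : IsHoleTableau D I e q)
    (hm : HoleMove D (e, q) (e', q')) :
    IsHoleTableau D I e' q' ∧ ColPath 0 (holeMatrix D I e q) (holeMatrix D I e' q') := by
  cases hm with
  | up _ i j hD hle =>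
    obtain ⟨h1, h2⟩ := h.up hD hle
    exact ⟨h1, h2 ▸ .refl⟩
  | left _ i j hD hlt =>
    obtain ⟨h1, h2⟩ := h.left hD hlt
    exact ⟨h1, .single ⟨j, Nat.zero_le j, h2⟩⟩

theorem IsHoleTableau.holeMoves {s s' : (ℕ × ℕ → ℕ) × (ℕ × ℕ)} (h : IsHoleTableau D I s.1 s.2)
    (hm : Relation.ReflTransGen (HoleMove D) s s') :
    IsHoleTableau D I s'.1 s'.2 ∧
      ColPath 0 (holeMatrix D I s.1 s.2) (holeMatrix D I s'.1 s'.2) := by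
  induction hm with
  | refl => exact ⟨h, .refl⟩
  | tail _ hm ih =>
    obtain ⟨h1, h2⟩ := ih
    obtain ⟨h3, h4⟩ := h1.holeMove hm
    exact ⟨h3, h2.trans h4⟩

/-- The hole can be moved until it reaches a corner. -/
theorem IsHoleTableau.exists_corner {q : ℕ × ℕ} (h : IsHoleTableau D I e q) :
    ∃ e' q', Relation.ReflTransGen (HoleMove D) (e, q) (e', q') ∧
      (q'.1 + 1, q'.2) ∉ D ∧ (q'.1, q'.2 + 1) ∉ D := by
  obtain ⟨t, ht⟩ : ∃ t, D.colLen 0 + D.rowLen 0 - (q.1 + q.2) = t := ⟨_, rfl⟩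
  induction t generalizing e q with
  | zero =>
    have h1 := YoungDiagram.mem_iff_lt_colLen.mp (D.up_left_mem le_rfl (Nat.zero_le q.2) h.mem)
    have h2 := YoungDiagram.mem_iff_lt_rowLen.mp (D.up_left_mem (Nat.zero_le q.1) le_rfl h.mem)
    omega
  | succ t ih =>
    obtain ⟨i, j⟩ := q
    simp only at ht
    by_cases hd : (i + 1, j) ∈ D
    · by_cases hle : (i, j + 1) ∈ D → e (i + 1, j) ≤ e (i, j + 1)
      · obtain ⟨e', q', h1, h2⟩ := ih (h.up hd hle).1 (by simp only; omega)
        exact ⟨e', q', .head (.up e i j hd hle) h1, h2⟩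
      · push Not at hle
        obtain ⟨e', q', h1, h2⟩ := ih (h.left hle.1 fun _ => hle.2).1 (by simp only; omega)
        exact ⟨e', q', .head (.left e i j hle.1 fun _ => hle.2) h1, h2⟩
    · by_cases hr : (i, j + 1) ∈ D
      · obtain ⟨e', q', h1, h2⟩ := ih (h.left hr fun hc => absurd hc hd).1 (by simp only; omega)
        exact ⟨e', q', .head (.left e i j hr fun hc => absurd hc hd) h1, h2⟩
      · exact ⟨e, (i, j), .refl, hd, hr⟩

end HoleMove

theorem SkewTableau.isHoleTableau (T : SkewTableau) {I : YoungDiagram} {h : ℕ × ℕ}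
    (hh : h ∈ T.inner) (hI : I.cells = T.inner.cells.erase h) :
    IsHoleTableau T.outer I T.entry h ∧ holeMatrix T.outer I T.entry h = T.matrix := by
  have mI : ∀ p, p ∈ I ↔ p ≠ h ∧ p ∈ T.inner := fun p => by
    rw [← YoungDiagram.mem_cells, hI, Finset.mem_erase, YoungDiagram.mem_cells]
  have hho := T.inner_le hh
  refine ⟨⟨hho, fun hc => ((mI h).mp hc).1 rfl, ?_, ?_, ?_⟩, ?_⟩
  · rintro ⟨a, b⟩ ⟨c, d⟩ hp hpq hr hrq h1 h2
    simp only at h1 h2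
    have hp' : (a, b) ∉ T.inner := fun hc => hp ((mI _).mpr ⟨hpq, hc⟩)
    have k1 : (a, d) ∉ T.inner := fun hc => hp' (T.inner.up_left_mem le_rfl h2 hc)
    have k2 : (a, d) ∈ T.outer := T.outer.up_left_mem h1 le_rfl hr
    have k3 : T.entry (a, b) ≤ T.entry (a, d) := by
      rcases eq_or_lt_of_le h2 with rfl | h2
      · exact le_rfl
      · exact T.row_weak a b d h2 hp' k2
    have k4 : T.entry (a, d) ≤ T.entry (c, d) := by
      rcases eq_or_lt_of_le h1 with rfl | h1
      · exact le_rfl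
      · exact (T.col_strict a c d h1 k1 hr).le
    exact k3.trans k4
  · rintro ⟨a, b⟩ ⟨c, d⟩ hp hpq hr hrq h1 h2
    simp only at h1 h2
    have hp' : (a, b) ∉ T.inner := fun hc => hp ((mI _).mpr ⟨hpq, hc⟩)
    have k1 : (a, d) ∉ T.inner := fun hc => hp' (T.inner.up_left_mem le_rfl h2 hc)
    have k2 : (a, d) ∈ T.outer := T.outer.up_left_mem h1.le le_rfl hr
    have k3 : T.entry (a, b) ≤ T.entry (a, d) := by
      rcases eq_or_lt_of_le h2 with rfl | h2
      · exact le_rfl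
      · exact T.row_weak a b d h2 hp' k2
    exact k3.trans_lt (T.col_strict a c d h1 k1 hr)
  · rintro c (hc | hc | hc)
    · exact T.zeros c (.inl hc)
    · exact T.zeros c (.inr ((mI c).mp hc).2)
    · exact T.zeros c (.inr (hc ▸ hh))
  · unfold holeMatrix SkewTableau.matrix
    congr 2
    ext p
    simp only [Finset.mem_erase, Finset.mem_sdiff, YoungDiagram.mem_cells, mI]
    constructor
    · tauto
    · rintro ⟨h1, h2⟩
      exact ⟨fun hc => h2 (hc ▸ hh), h1, fun hc => h2 hc.2⟩

theorem holeMatrix_eq {T : SkewTableau} {D : YoungDiagram} {q : ℕ × ℕ}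
    (hT : T.outer.cells = D.cells.erase q) : holeMatrix D T.inner T.entry q = T.matrix := by
  unfold holeMatrix SkewTableau.matrix
  congr 2
  rw [hT]
  ext p
  simp only [Finset.mem_erase, Finset.mem_sdiff]
  tauto

theorem Slide.colPath {T T' : SkewTableau} (h : Slide T T') : ColPath 0 T.matrix T'.matrix := by
  obtain ⟨h, h', h1, -, -, h2, -, -, h3, h4⟩ := h
  obtain ⟨h5, h6⟩ := T.isHoleTableau h1 h3
  have h7 := (h5.holeMoves (s := (T.entry, h)) h2).2
  rwa [h6, holeMatrix_eq h4] at h7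

theorem colPath_of_slides {T T' : SkewTableau} (h : Relation.ReflTransGen Slide T T') :
    ColPath 0 T.matrix T'.matrix := by
  induction h with
  | refl => exact .refl
  | tail _ h ih => exact ih.trans h.colPath

/-- Removing a corner from a Young diagram. -/
def eraseCorner (D : YoungDiagram) (h : ℕ × ℕ) (h1 : (h.1 + 1, h.2) ∉ D)
    (h2 : (h.1, h.2 + 1) ∉ D) : YoungDiagram where
  cells := D.cells.erase h
  isLowerSet := by
    rintro ⟨a, b⟩ ⟨c, d⟩ ⟨hca, hdb⟩ hab
    simp only [Finset.coe_erase, Set.mem_sdiff, Finset.mem_coe, YoungDiagram.mem_cells,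
      Set.mem_singleton_iff] at hab hca hdb ⊢
    refine ⟨D.up_left_mem hca hdb hab.1, ?_⟩
    rintro rfl
    simp only at h1 h2
    by_cases hc : c + 1 ≤ a
    · exact h1 (D.up_left_mem hc hdb hab.1)
    · by_cases hd : d + 1 ≤ b
      · exact h2 (D.up_left_mem hca hd hab.1)
      · exact hab.2 (by rw [Prod.mk.injEq]; omega)

theorem SkewTableau.exists_slide (T : SkewTableau) (hT : T.inner ≠ ⊥) :
    ∃ T', Slide T T' ∧ T'.inner.card + 1 = T.inner.card := by
  have hne : T.inner.cells.Nonempty := by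
    rw [Finset.nonempty_iff_ne_empty]
    intro hc
    exact hT (YoungDiagram.ext (by rw [hc]; rfl))
  obtain ⟨h, hh, hmax⟩ := Finset.exists_max_image T.inner.cells (fun p => p.1 + p.2) hne
  have c1 : (h.1 + 1, h.2) ∉ T.inner := fun hc => by
    have := hmax _ hc
    simp only at this
    omega
  have c2 : (h.1, h.2 + 1) ∉ T.inner := fun hc => by
    have := hmax _ hc
    simp only at this
    omega
  obtain ⟨i1, -⟩ := T.isHoleTableau (I := eraseCorner T.inner h c1 c2) hh rfl
  obtain ⟨e', q', i2, d1, d2⟩ := i1.exists_corner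
  obtain ⟨i3, -⟩ := i1.holeMoves (s := (T.entry, h)) i2
  simp only at i3
  have mD : ∀ p, p ∈ eraseCorner T.outer q' d1 d2 ↔ p ≠ q' ∧ p ∈ T.outer := fun p =>
    Finset.mem_erase
  have np : ∀ a b c d, a ≤ c → b ≤ d → (c, d) ∈ T.outer → (c, d) ≠ q' → (a, b) ≠ q' := by
    rintro a b c d hac hbd hcd hne rfl
    exact ((mD _).mp ((eraseCorner T.outer (a, b) d1 d2).up_left_mem hac hbd
      ((mD _).mpr ⟨hne, hcd⟩))).1 rfl
  refine ⟨⟨eraseCorner T.outer q' d1 d2, eraseCorner T.inner h c1 c2, ?_, e', ?_, ?_, ?_⟩,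
    ⟨h, q', hh, c1, c2, i2, d1, d2, rfl, rfl⟩, ?_⟩
  · intro p hp
    refine (mD p).mpr ⟨?_, T.inner_le (Finset.mem_of_mem_erase hp)⟩
    rintro rfl
    exact i3.notMem hp
  · intro i j₁ j₂ hj hin hout
    obtain ⟨o1, o2⟩ := (mD _).mp hout
    exact i3.mono (i, j₁) (i, j₂) hin (np _ _ _ _ le_rfl hj.le o2 o1) o2 o1 le_rfl hj.le
  · intro i₁ i₂ j hi hin hout
    obtain ⟨o1, o2⟩ := (mD _).mp hout
    exact i3.strict (i₁, j) (i₂, j) hin (np _ _ _ _ hi.le le_rfl o2 o1) o2 o1 hi le_rfl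
  · intro c hc
    apply i3.zeros
    rw [mD] at hc
    tauto
  · exact Finset.card_erase_add_one hh

/-- Every skew tableau slides to a tableau of straight shape. -/
theorem SkewTableau.exists_rectification (T : SkewTableau) :
    ∃ (μ : YoungDiagram) (S : SemistandardYoungTableau μ), IsJeuDeTaquinOf T S := by
  obtain ⟨t, ht⟩ : ∃ t, T.inner.card = t := ⟨_, rfl⟩
  induction t generalizing T with
  | zero =>
    have hT : T.inner = ⊥ := YoungDiagram.ext (Finset.card_eq_zero.mp ht)
    obtain ⟨outer, inner, hle, entry, hr, hc, hz⟩ := T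
    simp only at hT
    subst hT
    refine ⟨outer, ⟨fun i j => entry (i, j), ?_, ?_, ?_⟩, .refl⟩
    · intro i j1 j2 hj hcell
      exact hr i j1 j2 hj (YoungDiagram.notMem_bot _) hcell
    · intro i1 i2 j hi hcell
      exact hc i1 i2 j hi (YoungDiagram.notMem_bot _) hcell
    · intro i j hcell
      exact hz _ (.inl hcell)
  | succ t ih =>
    obtain ⟨T', h1, h2⟩ := T.exists_slide fun h => by
      rw [h] at ht
      exact absurd ht (by simp [YoungDiagram.card])
    obtain ⟨μ, S, hS⟩ := ih T' (by omega)
    exact ⟨μ, S, .head h1 hS⟩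

end LeftKey

namespace LeftKey

/-! ### The left key -/

theorem SkewTableau.mem_entrySets {T : SkewTableau} {c x : ℕ} :
    x ∈ entrySets (T.outer.cells \ T.inner.cells) T.entry c ↔
      ∃ r, (r, c) ∈ T.outer ∧ (r, c) ∉ T.inner ∧ T.entry (r, c) = x := by
  rw [LeftKey.mem_entrySets]
  simp only [Finset.mem_sdiff, YoungDiagram.mem_cells, and_assoc]

theorem SkewTableau.entrySets_eq_image (T : SkewTableau) (c : ℕ) :
    entrySets (T.outer.cells \ T.inner.cells) T.entry c =
      (Finset.Ico (T.inner.colLen c) (T.outer.colLen c)).image fun r => T.entry (r, c) := by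
  ext x
  simp only [SkewTableau.mem_entrySets, Finset.mem_image, Finset.mem_Ico,
    YoungDiagram.mem_iff_lt_colLen, not_lt]
  constructor
  · rintro ⟨r, h1, h2, h3⟩; exact ⟨r, ⟨h2, h1⟩, h3⟩
  · rintro ⟨r, ⟨h2, h1⟩, h3⟩; exact ⟨r, h1, h2, h3⟩

theorem SkewTableau.card_entrySets (T : SkewTableau) (c : ℕ) :
    (entrySets (T.outer.cells \ T.inner.cells) T.entry c).card =
      T.outer.colLen c - T.inner.colLen c := by
  rw [T.entrySets_eq_image, Finset.card_image_of_injOn, Nat.card_Ico]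
  have key : ∀ r s, r ∈ Finset.Ico (T.inner.colLen c) (T.outer.colLen c) →
      s ∈ Finset.Ico (T.inner.colLen c) (T.outer.colLen c) → r < s →
      T.entry (r, c) < T.entry (s, c) := by
    intro r s hr hs hrs
    rw [Finset.mem_Ico] at hr hs
    exact T.col_strict r s c hrs (fun h => by
      have := YoungDiagram.mem_iff_lt_colLen.mp h
      omega) (YoungDiagram.mem_iff_lt_colLen.mpr hs.2)
  intro r hr s hs hrs
  simp only at hrs
  rcases lt_trichotomy r s with h | h | h
  · have := key r s hr hs h
    omega
  · exact h
  · have := key s r hs hr h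
    omega

theorem SkewTableau.isZeroOne (T : SkewTableau) {m n : ℕ} (hm : T.outer.rowLen 0 ≤ m)
    (hn : ∀ p ∈ T.outer, T.entry p < n) : IsZeroOne m n T.matrix := by
  refine ⟨fun c x => ?_, fun c x hc => ?_, fun c x hx => ?_⟩ <;>
    simp only [SkewTableau.matrix, indicator]
  · split_ifs <;> simp
  · rw [if_neg]
    rw [SkewTableau.mem_entrySets]
    rintro ⟨r, h1, -, -⟩
    have := YoungDiagram.mem_iff_lt_rowLen.mp (T.outer.up_left_mem (Nat.zero_le r) le_rfl h1)
    omega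
  · rw [if_neg]
    rw [SkewTableau.mem_entrySets]
    rintro ⟨r, h1, -, rfl⟩
    have := hn _ h1
    omega

theorem SkewTableau.colSum_matrix (T : SkewTableau) {n : ℕ} (hn : ∀ p ∈ T.outer, T.entry p < n)
    (c : ℕ) : colSum n T.matrix c = (T.outer.colLen c - T.inner.colLen c : ℕ) := by
  rw [← T.card_entrySets]
  refine sum_ite_mem_range fun x hx => ?_
  obtain ⟨r, h1, -, rfl⟩ := SkewTableau.mem_entrySets.mp hx
  exact hn _ h1

section Straight

variable {μ : YoungDiagram}

theorem colLen_bot (c : ℕ) : (⊥ : YoungDiagram).colLen c = 0 := by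
  by_contra h
  exact YoungDiagram.notMem_bot (0, c)
    (YoungDiagram.mem_iff_lt_colLen.mpr (Nat.pos_of_ne_zero h))

theorem colLen_eq_zero {c : ℕ} (hc : μ.rowLen 0 ≤ c) : μ.colLen c = 0 := by
  by_contra h
  have := YoungDiagram.mem_iff_lt_rowLen.mp
    (YoungDiagram.mem_iff_lt_colLen.mpr (Nat.pos_of_ne_zero h))
  omega

theorem colLen_pos {c : ℕ} (hc : c < μ.rowLen 0) : 0 < μ.colLen c :=
  YoungDiagram.mem_iff_lt_colLen.mp (YoungDiagram.mem_iff_lt_rowLen.mpr hc)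

theorem mem_column {S : SemistandardYoungTableau μ} {j x : ℕ} :
    x ∈ column S j ↔ ∃ i < μ.colLen j, S i j = x := by
  simp [column]

theorem entrySets_ofStraight (S : SemistandardYoungTableau μ) (c : ℕ) :
    entrySets ((SkewTableau.ofStraight S).outer.cells \ (SkewTableau.ofStraight S).inner.cells)
      (SkewTableau.ofStraight S).entry c = column S c := by
  rw [SkewTableau.entrySets_eq_image]
  simp only [SkewTableau.ofStraight, colLen_bot]
  rw [column, Finset.range_eq_Ico]

theorem matrix_ofStraight (S : SemistandardYoungTableau μ) :
    (SkewTableau.ofStraight S).matrix = indicator (column S) := by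
  unfold SkewTableau.matrix
  congr 1
  funext c
  exact entrySets_ofStraight S c

theorem card_column (S : SemistandardYoungTableau μ) (j : ℕ) :
    (column S j).card = μ.colLen j := by
  rw [← entrySets_ofStraight, SkewTableau.card_entrySets]
  simp [SkewTableau.ofStraight, colLen_bot]

theorem dominates_column (S : SemistandardYoungTableau μ) (j : ℕ) :
    Dominates (column S j) (column S (j + 1)) := by
  intro y
  have h1 := setHt_sub (column S j) (column S (j + 1)) (Nat.zero_le y)
  have h2 : (Finset.Ico 0 y ∩ column S (j + 1)).card ≤ (Finset.Ico 0 y ∩ column S j).card := by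
    have hsub : Finset.Ico 0 y ∩ column S (j + 1) ⊆
        ((Finset.range (μ.colLen (j + 1))).filter fun r => S r (j + 1) < y).image
          fun r => S r (j + 1) := by
      intro x hx
      rw [Finset.mem_inter, Finset.mem_Ico, mem_column] at hx
      obtain ⟨⟨-, hx⟩, r, hr, rfl⟩ := hx
      exact Finset.mem_image.mpr ⟨r, by simp [hr, hx], rfl⟩
    refine (Finset.card_le_card hsub).trans (Finset.card_image_le.trans ?_)
    have hlen := μ.colLen_anti j (j + 1) (Nat.le_succ j)
    refine Finset.card_le_card_of_injOn (fun r => S r j) (fun r hr => ?_) (fun r hr s hs hrs => ?_)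
    · simp only [Finset.coe_filter, Finset.mem_range, Set.mem_ofPred_eq] at hr
      have h3 := S.row_weak (Nat.lt_succ_self j) (YoungDiagram.mem_iff_lt_colLen.mpr hr.1)
      rw [Finset.mem_coe, Finset.mem_inter, Finset.mem_Ico, mem_column]
      exact ⟨⟨Nat.zero_le _, h3.trans_lt hr.2⟩, r, hr.1.trans_le hlen, rfl⟩
    · simp only [Finset.coe_filter, Finset.mem_range, Set.mem_ofPred_eq] at hr hs
      simp only at hrs
      rcases lt_trichotomy r s with hl | hl | hl
      · have := S.col_strict hl (YoungDiagram.mem_iff_lt_colLen.mpr (hs.1.trans_le hlen))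
        omega
      · exact hl
      · have := S.col_strict hl (YoungDiagram.mem_iff_lt_colLen.mpr (hr.1.trans_le hlen))
        omega
  have h0 : setHt (column S j) (column S (j + 1)) 0 = 0 := rfl
  omega

theorem getD_columns (S : SemistandardYoungTableau μ) (c : ℕ) :
    (columns S).getD c ∅ = column S c := by
  by_cases hc : c < μ.rowLen 0
  · rw [List.getD_eq_getElem _ _ (by simpa [columns] using hc)]
    simp [columns]
  · rw [List.getD_eq_default _ _ (by simpa [columns] using hc), eq_comm, ← Finset.card_eq_zero,
      card_column]
    exact colLen_eq_zero (by omega)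

theorem isTableau_columns (S : SemistandardYoungTableau μ) : IsTableau (columns S) := by
  constructor
  · rw [List.isChain_iff_getElem]
    intro i hi
    simp only [columns, List.getElem_map, List.getElem_range]
    exact dominates_column S i
  · intro C hC
    obtain ⟨c, hc, rfl⟩ := List.mem_map.mp hC
    rw [← Finset.card_pos, card_column]
    exact colLen_pos (List.mem_range.mp hc)

/-- The entries of a column are recovered from their set. -/
theorem nth_column (S : SemistandardYoungTableau μ) {i j : ℕ} (hi : i < μ.colLen j) :
    Nat.nth (· ∈ column S j) i = S i j := by
  have hcount : Nat.count (· ∈ column S j) (S i j) = i := by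
    rw [Nat.count_eq_card_filter_range]
    have : (Finset.range (S i j)).filter (· ∈ column S j) = (Finset.range i).image (S · j) := by
      ext x
      simp only [Finset.mem_filter, Finset.mem_range, mem_column, Finset.mem_image]
      constructor
      · rintro ⟨h1, r, hr, rfl⟩
        refine ⟨r, ?_, rfl⟩
        by_contra hc
        rcases eq_or_lt_of_le (not_lt.mp hc) with rfl | hl
        · omega
        · have := S.col_strict hl (YoungDiagram.mem_iff_lt_colLen.mpr hr)
          omega
      · rintro ⟨r, hr, rfl⟩
        exact ⟨S.col_strict hr (YoungDiagram.mem_iff_lt_colLen.mpr hi), r, hr.trans hi, rfl⟩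
    rw [this, Finset.card_image_of_injOn, Finset.card_range]
    intro r hr s hs hrs
    simp only [Finset.coe_range, Set.mem_Iio] at hr hs hrs
    rcases lt_trichotomy r s with hl | hl | hl
    · have := S.col_strict hl (YoungDiagram.mem_iff_lt_colLen.mpr (hs.trans hi))
      omega
    · exact hl
    · have := S.col_strict hl (YoungDiagram.mem_iff_lt_colLen.mpr (hr.trans hi))
      omega
  have := Nat.nth_count (p := (· ∈ column S j)) (mem_column.mpr ⟨i, hi, rfl⟩ : S i j ∈ column S j)
  rwa [hcount] at this

theorem eq_of_column_eq {S S' : SemistandardYoungTableau μ}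
    (h : ∀ j < μ.rowLen 0, column S j = column S' j) : S = S' := by
  ext i j
  by_cases hij : (i, j) ∈ μ
  · have hi := YoungDiagram.mem_iff_lt_colLen.mp hij
    have hj := YoungDiagram.mem_iff_lt_rowLen.mp (μ.up_left_mem (Nat.zero_le i) le_rfl hij)
    rw [← nth_column S hi, ← nth_column S' hi, h j hj]
  · rw [S.zeros hij, S'.zeros hij]

theorem indicator_injective : Function.Injective indicator := by
  intro C D h
  funext c
  ext x
  have := congrFun (congrFun h c) x
  simp only [indicator] at this
  split_ifs at this <;> simp_all

theorem isJeuDeTaquinOf_of_matrix_eq {μ' : YoungDiagram} {T : SkewTableau}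
    {S : SemistandardYoungTableau μ} {S' : SemistandardYoungTableau μ'}
    (h : (SkewTableau.ofStraight S').matrix = (SkewTableau.ofStraight S).matrix)
    (hT : IsJeuDeTaquinOf T S') : IsJeuDeTaquinOf T S := by
  rw [matrix_ofStraight, matrix_ofStraight] at h
  have h1 : ∀ c, column S' c = column S c := congrFun (indicator_injective h)
  have h2 : μ' = μ := by
    ext ⟨r, c⟩
    rw [YoungDiagram.mem_cells, YoungDiagram.mem_cells, YoungDiagram.mem_iff_lt_colLen,
      YoungDiagram.mem_iff_lt_colLen, ← card_column S', ← card_column S, h1]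
  subst h2
  rwa [eq_of_column_eq fun j _ => h1 j] at hT

theorem colHt_ofStraight_le (S : SemistandardYoungTableau μ) (j y : ℕ) :
    colHt j (SkewTableau.ofStraight S).matrix y ≤ 0 := by
  rw [matrix_ofStraight, colHt_indicator]
  exact dominates_column S j y

end Straight

theorem SkewTableau.exists_bound (T : SkewTableau) : ∃ n, ∀ p ∈ T.outer, T.entry p < n :=
  ⟨T.outer.cells.sup T.entry + 1, fun p hp =>
    Nat.lt_succ_of_le (Finset.le_sup (f := T.entry) ((YoungDiagram.mem_cells p).mpr hp))⟩

theorem sum_range_eq_list_sum (f : ℕ → ℤ) (m : ℕ) :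
    ∑ c ∈ Finset.range m, f c = ((List.range m).map f).sum := rfl

theorem sum_columnLengths (lam nu : YoungDiagram) (x : ℕ) :
    ∑ c ∈ Finset.range (lam.rowLen 0), min (x : ℤ) ((lam.colLen c - nu.colLen c : ℕ) : ℤ) =
      ((columnLengths lam nu).map fun b : ℕ => min (x : ℤ) b).sum := by
  rw [sum_range_eq_list_sum, columnLengths, List.map_map]
  rfl

theorem rowLen_eq_of_perm {μ lam nu : YoungDiagram}
    (h : (columnLengths lam nu).Perm (columnLengths μ ⊥)) : lam.rowLen 0 = μ.rowLen 0 := by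
  simpa [columnLengths] using h.length_eq

theorem colLen_zero_of_head {lam nu : YoungDiagram} {b : ℕ}
    (h : (columnLengths lam nu).head? = some b) : lam.colLen 0 - nu.colLen 0 = b := by
  rw [columnLengths, List.head?_map] at h
  rcases Nat.eq_zero_or_pos (lam.rowLen 0) with h0 | h0
  · simp [h0] at h
  · obtain ⟨k, hk⟩ := Nat.exists_eq_succ_of_ne_zero h0.ne'
    rw [hk, List.range_succ_eq_map] at h
    simpa using h

/-- The first column of any tableau of rearranged skew shape that is obtained from `S` by jeu de
taquin consists of the numbers crossed out first. -/
theorem firstColumn_eq {μ : YoungDiagram} (S : SemistandardYoungTableau μ) {j : ℕ}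
    (hj : j < μ.rowLen 0) {T : SkewTableau}
    (hperm : (columnLengths T.outer T.inner).Perm (columnLengths μ ⊥))
    (hhead : (columnLengths T.outer T.inner).head? = some (μ.colLen j))
    (hT : IsJeuDeTaquinOf T S) :
    T.firstColumn = (lineHeads (μ.colLen j) (columns S)).toFinset := by
  obtain ⟨n₁, hn₁⟩ := T.exists_bound
  obtain ⟨n₂, hn₂⟩ := (SkewTableau.ofStraight S).exists_bound
  set n := max n₁ n₂ with hn
  replace hn₁ : ∀ p ∈ T.outer, T.entry p < n := fun p hp => (hn₁ p hp).trans_le (le_max_left _ _)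
  replace hn₂ : ∀ p ∈ (SkewTableau.ofStraight S).outer, (SkewTableau.ofStraight S).entry p < n :=
    fun p hp => (hn₂ p hp).trans_le (le_max_right _ _)
  have hm := rowLen_eq_of_perm hperm
  have hTz := T.isZeroOne (m := μ.rowLen 0) hm.le hn₁
  have hcol : (fun c => (columns S).getD c ∅) = column S := funext (getD_columns S)
  -- By uniqueness, the first column of `T` is that of the matrix obtained by exchanging columns.
  obtain ⟨M, a1, a2, a3, a4, a5⟩ := exists_front_rearrangement (m := μ.rowLen 0) (n := n)
    (isTableau_columns S) (by simp [columns]) (by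
      intro C hC x hx
      obtain ⟨c, hc, rfl⟩ := List.mem_map.mp hC
      obtain ⟨i, hi, rfl⟩ := mem_column.mp hx
      exact hn₂ (i, c) (YoungDiagram.mem_iff_lt_colLen.mpr hi)) hj
  rw [hcol, ← matrix_ofStraight] at a2 a3
  rw [getD_columns, card_column] at a4 a5
  have hTl : SameLengths (μ.rowLen 0) n T.matrix (SkewTableau.ofStraight S).matrix := by
    intro x
    simp only [T.colSum_matrix hn₁, (SkewTableau.ofStraight S).colSum_matrix hn₂]
    have h1 := sum_columnLengths T.outer T.inner x
    have h2 := sum_columnLengths μ ⊥ x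
    rw [(hperm.map _).sum_eq, ← h2, hm] at h1
    exact h1
  have h0 := column_zero_unique (colHt_ofStraight_le S) hTz a1 (colPath_of_slides hT) a2 hTl a3
    (by rw [T.colSum_matrix hn₁, a4, colLen_zero_of_head hhead])
  ext x
  have hx := congrFun h0 x
  rw [a5] at hx
  have hF : T.firstColumn = entrySets (T.outer.cells \ T.inner.cells) T.entry 0 := rfl
  rw [hF, List.mem_toFinset]
  simp only [SkewTableau.matrix, indicator] at hx
  split_ifs at hx <;> simp_all

theorem count_eq_sum {m n : ℕ} {M : ℕ → ℕ → ℤ} (hM : IsZeroOne m n M) (c y : ℕ) :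
    (Nat.count (· ∈ (Finset.range n).filter fun x => M c x = 1) y : ℤ) =
      ∑ x ∈ Finset.range y, M c x := by
  induction y with
  | zero => simp
  | succ y ih =>
    rw [Nat.count_succ, Finset.sum_range_succ, ← ih]
    push_cast
    congr 1
    rcases hM.zero_or_one c y with h | h
    · simp [h]
    · have : y < n := by
        by_contra hc
        rw [hM.row_bound c y (by omega)] at h
        omega
      simp [h, this]

/-- A zero-one matrix with the column lengths of a skew shape is the matrix of a semistandard
tableau of this shape, if the column excesses allow for the vertical offsets of the columns. -/
theorem exists_skewTableau {lam nu : YoungDiagram} (hle : nu ≤ lam) {m n : ℕ} {M : ℕ → ℕ → ℤ}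
    (hM : IsZeroOne m n M)
    (hlen : ∀ c, colSum n M c = (lam.colLen c - nu.colLen c : ℕ))
    (hht : ∀ j y, colHt j M y ≤ (nu.colLen j : ℤ) - nu.colLen (j + 1)) :
    ∃ T : SkewTableau, T.outer = lam ∧ T.inner = nu ∧ T.matrix = M := by
  classical
  set E : ℕ → Finset ℕ := fun c => (Finset.range n).filter fun x => M c x = 1 with hE
  have hind : ∀ c x, M c x = if x ∈ E c then 1 else 0 := by
    intro c x
    rcases hM.zero_or_one c x with h | h
    · simp [hE, h]
    · have : x < n := by
        by_contra hc
        rw [hM.row_bound c x (by omega)] at h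
        omega
      simp [hE, h, this]
  have hcard : ∀ c, (E c).card = lam.colLen c - nu.colLen c := by
    intro c
    have h1 := hlen c
    rw [colSum, Finset.sum_congr rfl fun x _ => hind c x, sum_ite_mem_range fun x hx =>
      Finset.mem_range.mp (Finset.mem_of_mem_filter x hx)] at h1
    exact_mod_cast h1
  have hlt : ∀ r c, (r, c) ∈ lam → (r, c) ∉ nu → r - nu.colLen c < (E c).card := by
    intro r c h1 h2
    rw [YoungDiagram.mem_iff_lt_colLen] at h1 h2
    rw [hcard]
    omega
  have hlt' : ∀ r c, (r, c) ∈ lam → (r, c) ∉ nu → ∀ hf : {x | x ∈ E c}.Finite,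
      r - nu.colLen c < hf.toFinset.card := by
    intro r c h1 h2 hf
    rw [card_finite_mem]
    exact hlt r c h1 h2
  set entry : ℕ × ℕ → ℕ := fun p =>
    if p ∈ lam ∧ p ∉ nu then Nat.nth (· ∈ E p.2) (p.1 - nu.colLen p.2) else 0 with hentry
  have he : ∀ r c, (r, c) ∈ lam → (r, c) ∉ nu →
      entry (r, c) = Nat.nth (· ∈ E c) (r - nu.colLen c) := fun r c h1 h2 => if_pos ⟨h1, h2⟩
  have hadj : ∀ i j, (i, j) ∉ nu → (i, j + 1) ∈ lam → entry (i, j) ≤ entry (i, j + 1) := by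
    intro i j h1 h2
    have h3 : (i, j) ∈ lam := lam.up_left_mem le_rfl (Nat.le_succ j) h2
    have h4 : (i, j + 1) ∉ nu := fun hc => h1 (nu.up_left_mem le_rfl (Nat.le_succ j) hc)
    rw [he i j h3 h1, he i (j + 1) h2 h4]
    -- If `b` is the entry on the right, then column `j + 1` has `i - nu.colLen (j + 1) + 1`
    -- entries up to `b`; by the bound on the excess, those of column `j` reach down to row `i`.
    have hc1 := Nat.count_nth_succ (p := (· ∈ E (j + 1))) (hlt' i (j + 1) h2 h4)
    set b := Nat.nth (· ∈ E (j + 1)) (i - nu.colLen (j + 1))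
    have hb := hht j (b + 1)
    rw [colHt, Finset.sum_sub_distrib, ← count_eq_sum hM, ← count_eq_sum hM] at hb
    change ((Nat.count (· ∈ E (j + 1)) (b + 1) : ℕ) : ℤ) - (Nat.count (· ∈ E j) (b + 1) : ℕ) ≤ _
      at hb
    rw [hc1] at hb
    rw [YoungDiagram.mem_iff_lt_colLen] at h1 h4
    have hb' : i - nu.colLen j < Nat.count (· ∈ E j) (b + 1) := by omega
    exact Nat.lt_succ_iff.mp (Nat.nth_lt_of_lt_count hb')
  refine ⟨⟨lam, nu, hle, entry, ?_, ?_, ?_⟩, rfl, rfl, ?_⟩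
  · intro i j₁ j₂ hj h1 h2
    induction j₂, (show j₁ + 1 ≤ j₂ from hj) using Nat.le_induction with
    | base => exact hadj i j₁ h1 h2
    | succ j₂ hj' ih =>
      exact (ih hj' (lam.up_left_mem le_rfl (Nat.le_succ j₂) h2)).trans
        (hadj i j₂ (fun hc => h1 (nu.up_left_mem le_rfl (by omega) hc)) h2)
  · intro i₁ i₂ j hi h1 h2
    have h3 : (i₁, j) ∈ lam := lam.up_left_mem hi.le le_rfl h2
    have h4 : (i₂, j) ∉ nu := fun hc => h1 (nu.up_left_mem hi.le le_rfl hc)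
    rw [he _ _ h3 h1, he _ _ h2 h4]
    refine Nat.nth_lt_nth' ?_ (hlt' i₂ j h2 h4)
    rw [YoungDiagram.mem_iff_lt_colLen] at h1
    omega
  · intro c hc
    exact if_neg (by tauto)
  · funext c x
    rw [hind]
    simp only [SkewTableau.matrix, indicator]
    congr 1
    rw [eq_iff_iff, LeftKey.mem_entrySets]
    simp only [Finset.mem_sdiff, YoungDiagram.mem_cells]
    constructor
    · rintro ⟨r, ⟨h1, h2⟩, rfl⟩
      rw [he r c h1 h2]
      exact Nat.nth_mem _ (hlt' r c h1 h2)
    · intro hx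
      have h1 := Nat.count_lt_card (p := (· ∈ E c)) (finite_mem (E c)) hx
      rw [card_finite_mem, hcard] at h1
      have h2 := Nat.nth_count (p := (· ∈ E c)) hx
      have h3 : (Nat.count (· ∈ E c) x + nu.colLen c, c) ∈ lam := by
        rw [YoungDiagram.mem_iff_lt_colLen]
        omega
      have h4 : (Nat.count (· ∈ E c) x + nu.colLen c, c) ∉ nu := by
        rw [YoungDiagram.mem_iff_lt_colLen]
        omega
      refine ⟨_, ⟨h3, h4⟩, ?_⟩
      rw [he _ _ h3 h4, Nat.add_sub_cancel, h2]

/-- On every rearranged skew shape there is a tableau that is obtained from `S` by jeu de taquin. -/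
theorem exists_jeuDeTaquin {μ : YoungDiagram} (S : SemistandardYoungTableau μ)
    {lam nu : YoungDiagram} (hle : nu ≤ lam)
    (hperm : (columnLengths lam nu).Perm (columnLengths μ ⊥)) :
    ∃ T : SkewTableau, T.outer = lam ∧ T.inner = nu ∧ IsJeuDeTaquinOf T S := by
  obtain ⟨n₂, hn₂⟩ := (SkewTableau.ofStraight S).exists_bound
  set n := max (lam.colLen 0) n₂ with hn
  replace hn₂ : ∀ p ∈ (SkewTableau.ofStraight S).outer, (SkewTableau.ofStraight S).entry p < n :=
    fun p hp => (hn₂ p hp).trans_le (le_max_right _ _)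
  have hm := rowLen_eq_of_perm hperm
  have hSz := (SkewTableau.ofStraight S).isZeroOne (m := μ.rowLen 0) le_rfl hn₂
  obtain ⟨M, a1, a2, a3, a4, a5⟩ := exists_rearrangement hSz (colHt_ofStraight_le S)
    (fun c => lam.colLen c - nu.colLen c)
    (fun c => (Nat.sub_le _ _).trans ((lam.colLen_anti 0 c (Nat.zero_le c)).trans
      (le_max_left _ _)))
    (fun c hc => by rw [colLen_eq_zero (hm ▸ hc), Nat.zero_sub]) (by
      intro x
      simp only [(SkewTableau.ofStraight S).colSum_matrix hn₂]
      have h1 := sum_columnLengths lam nu x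
      have h2 := sum_columnLengths μ ⊥ x
      rw [(hperm.map _).sum_eq, ← h2, hm] at h1
      exact h1)
  have hcl : ∀ c, nu.colLen c ≤ lam.colLen c := by
    intro c
    by_contra hc
    have := hle (YoungDiagram.mem_iff_lt_colLen.mpr (not_le.mp hc))
    rw [YoungDiagram.mem_iff_lt_colLen] at this
    omega
  obtain ⟨T, rfl, rfl, hTM⟩ := exists_skewTableau hle a1 a3 (fun j y => by
    have h1 := a4 j y
    have h2 := lam.colLen_anti j (j + 1) (Nat.le_succ j)
    have h3 := nu.colLen_anti j (j + 1) (Nat.le_succ j)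
    have h4 := hcl j
    have h5 := hcl (j + 1)
    omega)
  -- Rectifying `T` leads to a highest matrix, and `S` is the only one above `T`.
  obtain ⟨μ', S', hS'⟩ := T.exists_rectification
  refine ⟨T, rfl, rfl, isJeuDeTaquinOf_of_matrix_eq ?_ hS'⟩
  exact a5 _ (hTM ▸ colPath_of_slides hS') (colHt_ofStraight_le S')

/-- The Young diagram with `m` columns of the given lengths. -/
def ofColLens (m : ℕ) (f : ℕ → ℕ) (hf : ∀ c, c + 1 < m → f (c + 1) ≤ f c) : YoungDiagram where
  cells := (Finset.range (f 0) ×ˢ Finset.range m).filter fun p => p.1 < f p.2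
  isLowerSet := by
    have anti : ∀ c d, c ≤ d → d < m → f d ≤ f c := by
      intro c d h
      induction d, h using Nat.le_induction with
      | base => exact fun _ => le_rfl
      | succ d h ih => exact fun hd => (hf d hd).trans (ih (by omega))
    rintro ⟨a, b⟩ ⟨c, d⟩ ⟨hca, hdb⟩ hab
    simp only [Finset.coe_filter, Finset.mem_product, Finset.mem_range, Set.mem_ofPred_eq]
      at hab hca hdb ⊢
    have := anti d b hdb hab.1.2
    omega

theorem mem_ofColLens {m : ℕ} {f : ℕ → ℕ} {hf : ∀ c, c + 1 < m → f (c + 1) ≤ f c} {r c : ℕ} :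
    (r, c) ∈ ofColLens m f hf ↔ c < m ∧ r < f c := by
  have anti : ∀ c < m, f c ≤ f 0 := by
    intro c
    induction c with
    | zero => exact fun _ => le_rfl
    | succ c ih => exact fun hc => (hf c hc).trans (ih (by omega))
  rw [← YoungDiagram.mem_cells]
  simp only [ofColLens, Finset.mem_filter, Finset.mem_product, Finset.mem_range]
  constructor
  · tauto
  · rintro ⟨h1, h2⟩
    exact ⟨⟨h2.trans_le (anti c h1), h1⟩, h2⟩

theorem colLen_ofColLens {m : ℕ} {f : ℕ → ℕ} {hf : ∀ c, c + 1 < m → f (c + 1) ≤ f c} {c : ℕ}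
    (hc : c < m) : (ofColLens m f hf).colLen c = f c := by
  apply eq_of_forall_lt_iff
  intro r
  rw [← YoungDiagram.mem_iff_lt_colLen, mem_ofColLens]
  simp [hc]

theorem rowLen_ofColLens {m : ℕ} {f : ℕ → ℕ} {hf : ∀ c, c + 1 < m → f (c + 1) ≤ f c}
    (hpos : ∀ c < m, 0 < f c) : (ofColLens m f hf).rowLen 0 = m := by
  apply eq_of_forall_lt_iff
  intro c
  rw [← YoungDiagram.mem_iff_lt_rowLen, mem_ofColLens]
  exact ⟨fun h => h.1, fun h => ⟨h, hpos c h⟩⟩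

/-- For each column of `μ` there is a skew shape of the kind considered in the definition of the
left key: the columns are placed far below each other, after a transposition that moves the given
one to the front. -/
theorem exists_skewShape {μ : YoungDiagram} {j : ℕ} (hj : j < μ.rowLen 0) :
    ∃ lam nu : YoungDiagram, nu ≤ lam ∧ (columnLengths lam nu).Perm (columnLengths μ ⊥) ∧
      (columnLengths lam nu).head? = some (μ.colLen j) := by
  set m := μ.rowLen 0 with hm
  set N := μ.colLen 0 with hN
  have hbN : ∀ c, μ.colLen c ≤ N := fun c => μ.colLen_anti 0 c (Nat.zero_le c)
  have hsw : ∀ c < m, Equiv.swap 0 j c < m := by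
    intro c hc
    rw [Equiv.swap_apply_def]
    split_ifs <;> omega
  have off : ∀ c, c + 1 < m → (m - 1 - c) * N = (m - 1 - (c + 1)) * N + N := by
    intro c hc
    obtain ⟨d, hd⟩ : ∃ d, m = c + d + 2 := ⟨m - c - 2, by omega⟩
    rw [show m - 1 - c = d + 1 by omega, show m - 1 - (c + 1) = d by omega]
    ring
  have hf : ∀ c, c + 1 < m →
      (m - 1 - (c + 1)) * N + μ.colLen (Equiv.swap 0 j (c + 1)) ≤
        (m - 1 - c) * N + μ.colLen (Equiv.swap 0 j c) := fun c hc => by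
    rw [off c hc]
    have := hbN (Equiv.swap 0 j (c + 1))
    omega
  have hg : ∀ c, c + 1 < m → (m - 1 - (c + 1)) * N ≤ (m - 1 - c) * N := fun c hc => by
    rw [off c hc]
    omega
  have hrow := rowLen_ofColLens
    (f := fun c => (m - 1 - c) * N + μ.colLen (Equiv.swap 0 j c)) (hf := hf) fun c hc =>
    Nat.add_pos_right _ (colLen_pos (hsw c hc))
  have hcl : columnLengths
      (ofColLens m (fun c => (m - 1 - c) * N + μ.colLen (Equiv.swap 0 j c)) hf)
      (ofColLens m (fun c => (m - 1 - c) * N) hg) =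
      ((List.range m).map (Equiv.swap 0 j)).map μ.colLen := by
    rw [columnLengths, hrow, List.map_map]
    refine List.map_congr_left fun c hc => ?_
    rw [List.mem_range] at hc
    rw [colLen_ofColLens hc, colLen_ofColLens hc, Nat.add_sub_cancel_left]
    rfl
  refine ⟨ofColLens m (fun c => (m - 1 - c) * N + μ.colLen (Equiv.swap 0 j c)) hf,
    ofColLens m (fun c => (m - 1 - c) * N) hg, ?_, ?_, ?_⟩
  · rintro ⟨r, c⟩ h
    have h1 := (mem_ofColLens (hf := hg)).mp h
    exact mem_ofColLens.mpr ⟨h1.1, by omega⟩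
  · rw [hcl]
    have h1 : columnLengths μ ⊥ = (List.range m).map μ.colLen := by
      rw [columnLengths]
      refine List.map_congr_left fun c _ => ?_
      rw [colLen_bot, Nat.sub_zero]
    rw [h1]
    refine List.Perm.map _ ((List.perm_ext_iff_of_nodup
      (List.nodup_range.map (Equiv.injective _)) List.nodup_range).mpr fun x => ?_)
    rw [List.mem_map, List.mem_range]
    constructor
    · rintro ⟨c, hc, rfl⟩
      exact hsw c (List.mem_range.mp hc)
    · intro hx
      exact ⟨Equiv.swap 0 j x, List.mem_range.mpr (hsw x hx), Equiv.swap_apply_self _ _ _⟩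
  · rw [hcl]
    obtain ⟨k, hk⟩ := Nat.exists_eq_succ_of_ne_zero (show m ≠ 0 by omega)
    rw [hk, List.range_succ_eq_map]
    simp

/-- The left key is the tableau whose columns consist of the numbers crossed out first. -/
theorem isLeftKey_iff {μ : YoungDiagram} (S K : SemistandardYoungTableau μ) :
    IsLeftKey S K ↔
      ∀ j < μ.rowLen 0, column K j = (lineHeads (μ.colLen j) (columns S)).toFinset := by
  constructor
  · intro h j hj
    obtain ⟨lam, nu, h1, h2, h3⟩ := exists_skewShape hj
    obtain ⟨⟨T, rfl, rfl, hT⟩, h4⟩ := h j hj lam nu h1 h2 h3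
    rw [← h4 T rfl rfl hT]
    exact firstColumn_eq S hj h2 h3 hT
  · intro h j hj lam nu h1 h2 h3
    refine ⟨exists_jeuDeTaquin S h1 h2, ?_⟩
    rintro T rfl rfl hT
    rw [h j hj]
    exact firstColumn_eq S hj h2 h3 hT

end LeftKey

namespace LeftKey

/-! ### Key tableaux and cosets -/

section Coset

variable {n : ℕ} {μ : YoungDiagram}

theorem column_keyTableau (hμ : μ.colLen 0 ≤ n) (σ : Equiv.Perm (Fin n)) (j : ℕ) :
    column (keyTableau μ hμ σ) j = initialLetters σ (μ.colLen j) := by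
  classical
  have hn : μ.colLen j ≤ n := (μ.colLen_anti 0 j (Nat.zero_le _)).trans hμ
  have hcard := card_initialLetters σ hn
  ext x
  rw [mem_column]
  change (∃ i < μ.colLen j, Nat.nth (· ∈ initialLetters σ (μ.colLen j)) i = x) ↔ _
  constructor
  · rintro ⟨i, hi, rfl⟩
    refine Nat.nth_mem (p := (· ∈ initialLetters σ (μ.colLen j))) i fun hf => ?_
    rw [card_finite_mem, hcard]
    exact hi
  · intro hx
    have h1 := Nat.count_lt_card (p := (· ∈ initialLetters σ (μ.colLen j))) (finite_mem _) hx
    rw [card_finite_mem, hcard] at h1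
    exact ⟨_, h1, Nat.nth_count (p := (· ∈ initialLetters σ (μ.colLen j))) hx⟩

theorem mem_initialLetters {σ : Equiv.Perm (Fin n)} {k : ℕ} (y : Fin n) :
    (y : ℕ) ∈ initialLetters σ k ↔ ((σ⁻¹ y : Fin n) : ℕ) < k := by
  simp only [initialLetters, Finset.mem_image, Finset.mem_filter, Finset.mem_univ, true_and]
  constructor
  · rintro ⟨i, hi, hiy⟩
    rw [← Fin.ext hiy]
    simpa using hi
  · intro h
    exact ⟨σ⁻¹ y, h, by simp⟩

theorem lt_of_mem_initialLetters {σ : Equiv.Perm (Fin n)} {k x : ℕ}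
    (h : x ∈ initialLetters σ k) : x < n := by
  obtain ⟨i, -, rfl⟩ := Finset.mem_image.mp h
  exact (σ i).isLt

theorem lt_colLen_iff {i j : ℕ} : i < μ.colLen j ↔ j < μ.rowLen i := by
  rw [← YoungDiagram.mem_iff_lt_colLen, YoungDiagram.mem_iff_lt_rowLen]

theorem mem_leftCoset {σ τ : Equiv.Perm (Fin n)} :
    σ ∈ leftCoset τ μ ↔ ∀ i, μ.rowLen (σ⁻¹ (τ i) : Fin n) = μ.rowLen i := by
  rw [leftCoset, mem_leftCoset_iff]
  change (∀ i : Fin n, μ.rowLen ((τ⁻¹ * σ)⁻¹ i : Fin n) = μ.rowLen i) ↔ _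
  simp [mul_inv_rev]

theorem keyTableau_eq_iff (hμ : μ.colLen 0 ≤ n) {σ τ : Equiv.Perm (Fin n)} :
    keyTableau μ hμ σ = keyTableau μ hμ τ ↔ σ ∈ leftCoset τ μ := by
  have h1 : keyTableau μ hμ σ = keyTableau μ hμ τ ↔
      ∀ j, initialLetters σ (μ.colLen j) = initialLetters τ (μ.colLen j) := by
    constructor
    · intro h j
      rw [← column_keyTableau hμ, ← column_keyTableau hμ, h]
    · intro h
      refine eq_of_column_eq fun j _ => ?_
      rw [column_keyTableau, column_keyTableau, h]
  rw [h1, mem_leftCoset]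
  constructor
  · intro h i
    refine eq_of_forall_lt_iff fun j => ?_
    have h2 : ((τ i : Fin n) : ℕ) ∈ initialLetters σ (μ.colLen j) ↔
        ((τ i : Fin n) : ℕ) ∈ initialLetters τ (μ.colLen j) := by rw [h j]
    rw [mem_initialLetters, mem_initialLetters, lt_colLen_iff, lt_colLen_iff] at h2
    simpa using h2
  · intro h j
    have h2 : ∀ y : Fin n, (y : ℕ) ∈ initialLetters σ (μ.colLen j) ↔
        (y : ℕ) ∈ initialLetters τ (μ.colLen j) := by
      intro y
      have := h (τ⁻¹ y)
      rw [mem_initialLetters, mem_initialLetters, lt_colLen_iff, lt_colLen_iff, ← this]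
      simp
    ext x
    constructor
    · intro hx
      exact (h2 ⟨x, lt_of_mem_initialLetters hx⟩).mp hx
    · intro hx
      exact (h2 ⟨x, lt_of_mem_initialLetters hx⟩).mpr hx

/-! ### Maximal elements of cosets in the Bruhat order -/

/-- The one-line notation of `σ` decreases on the positions of equal parts of `μ`. -/
def IsBlockDecreasing (μ : YoungDiagram) (σ : Equiv.Perm (Fin n)) : Prop :=
  ∀ i i' : Fin n, (i' : ℕ) = i + 1 → μ.rowLen i = μ.rowLen i' → σ i' < σ i

theorem IsBlockDecreasing.lt {σ : Equiv.Perm (Fin n)} (h : IsBlockDecreasing μ σ) {i i' : Fin n}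
    (hi : i < i') (hr : μ.rowLen i = μ.rowLen i') : σ i' < σ i := by
  obtain ⟨i', hi'⟩ := i'
  have hle : (i : ℕ) + 1 ≤ i' := hi
  clear hi
  induction i', hle using Nat.le_induction with
  | base => exact h i _ rfl hr
  | succ k hk ih =>
    have hkn : k < n := by omega
    have h1 : μ.rowLen (k + 1) ≤ μ.rowLen k := μ.rowLen_anti k (k + 1) (Nat.le_succ k)
    have h2 : μ.rowLen k ≤ μ.rowLen i := μ.rowLen_anti i k (by omega)
    simp only at hr
    have h3 : μ.rowLen i = μ.rowLen k := by omega
    exact (h ⟨k, hkn⟩ ⟨k + 1, hi'⟩ rfl (by simp only; omega)).trans (ih hkn h3)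

theorem IsBlockDecreasing.unique {σ τ : Equiv.Perm (Fin n)} (hσ : IsBlockDecreasing μ σ)
    (hτ : IsBlockDecreasing μ τ) (h : σ ∈ leftCoset τ μ) : σ = τ := by
  rw [mem_leftCoset] at h
  -- The permutation `σ⁻¹ τ` preserves the blocks, and it is increasing on each of them.
  have hmono : StrictMono fun i => σ⁻¹ (τ i) := by
    intro i i' hi
    have h1 : μ.rowLen i' ≤ μ.rowLen i := μ.rowLen_anti i i' hi.le
    have h2 := h i
    have h3 := h i'
    by_contra hc
    simp only [not_lt] at hc
    rcases eq_or_lt_of_le h1 with h4 | h4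
    · have h5 := hτ.lt hi h4.symm
      rcases eq_or_lt_of_le hc with h6 | h6
      · exact hi.ne (τ.injective (σ⁻¹.injective h6)).symm
      · have := hσ.lt h6 (by omega)
        simp only [Equiv.Perm.inv_def, Equiv.apply_symm_apply] at this
        exact lt_asymm this h5
    · have := μ.rowLen_anti _ _ (Fin.le_def.mp hc)
      omega
  have hid : (fun i => σ⁻¹ (τ i)) = id :=
    (StrictMono.range_inj hmono strictMono_id).mp (by
      rw [Set.range_id]
      exact (σ⁻¹.surjective.comp τ.surjective).range_eq)
  ext i
  have := congrFun hid i
  simp only [id] at this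
  rw [Equiv.Perm.inv_eq_iff_eq] at this
  rw [this]

/-- Exchanging two adjacent letters that are in increasing order creates an inversion. -/
theorem permLength_lt_mul_swap {σ : Equiv.Perm (Fin n)} {i i' : Fin n} (hi : (i' : ℕ) = i + 1)
    (hσ : σ i < σ i') : permLength σ < permLength (σ * Equiv.swap i i') := by
  have hii : i < i' := Fin.lt_def.mpr (by omega)
  have hmem : (i, i') ∈ Finset.univ.filter fun ij : Fin n × Fin n => ij.1 < ij.2 ∧
      (σ * Equiv.swap i i') ij.2 < (σ * Equiv.swap i i') ij.1 := by
    exact Finset.mem_filter.mpr ⟨Finset.mem_univ _, hii, by simpa using hσ⟩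
  rw [permLength, permLength, ← Finset.card_erase_add_one hmem, Nat.lt_succ_iff]
  refine Finset.card_le_card_of_injOn (fun p => (Equiv.swap i i' p.1, Equiv.swap i i' p.2)) ?_
    fun p _ q _ hpq => ?_
  · rintro ⟨a, b⟩ hab
    obtain ⟨-, hab, hinv⟩ := Finset.mem_filter.mp (Finset.mem_coe.mp hab)
    have hne : ¬(a = i ∧ b = i') := by
      rintro ⟨rfl, rfl⟩
      exact lt_asymm hσ hinv
    -- An adjacent transposition preserves the order of all other pairs of positions.
    have hlt : Equiv.swap i i' a < Equiv.swap i i' b := by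
      simp only [Equiv.swap_apply_def, Fin.lt_def, Fin.ext_iff] at hab hne ⊢
      split_ifs <;> omega
    refine Finset.mem_coe.mpr (Finset.mem_erase.mpr
      ⟨fun h => ?_, Finset.mem_filter.mpr ⟨Finset.mem_univ _, hlt, by simpa using hinv⟩⟩)
    obtain ⟨h1, h2⟩ := Prod.mk.inj h
    rw [Equiv.swap_apply_eq_iff, Equiv.swap_apply_left] at h1
    rw [Equiv.swap_apply_eq_iff, Equiv.swap_apply_right] at h2
    subst h1 h2
    exact lt_asymm hab hii
  · simp only [Prod.mk.injEq, EmbeddingLike.apply_eq_iff_eq] at hpq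
    exact Prod.ext hpq.1 hpq.2

theorem BruhatLE.eq_or_lt {u v : Equiv.Perm (Fin n)} (h : BruhatLE u v) :
    u = v ∨ permLength u < permLength v := by
  induction h with
  | refl => exact .inl rfl
  | tail _ h ih =>
    obtain ⟨t, -, -, hlt⟩ := h
    rcases ih with rfl | ih
    · exact .inr hlt
    · exact .inr (ih.trans hlt)

theorem exists_bruhatLE_of_not_isBlockDecreasing {σ τ : Equiv.Perm (Fin n)}
    (hσ : σ ∈ leftCoset τ μ) (h : ¬IsBlockDecreasing μ σ) :
    ∃ ρ ∈ leftCoset τ μ, BruhatLE σ ρ ∧ permLength σ < permLength ρ := by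
  unfold IsBlockDecreasing at h
  push Not at h
  obtain ⟨i, i', hi, hr, hle⟩ := h
  have hne : i ≠ i' := by rintro rfl; omega
  have hlt := permLength_lt_mul_swap hi (lt_of_le_of_ne hle (σ.injective.ne hne))
  refine ⟨_, ?_, .single ⟨Equiv.swap i i', ⟨i, i', hne, rfl⟩, rfl, hlt⟩, hlt⟩
  rw [mem_leftCoset] at hσ ⊢
  intro k
  rw [mul_inv_rev, Equiv.swap_inv, Equiv.Perm.mul_apply, ← hσ k, Equiv.swap_apply_def]
  split_ifs with h1 h2
  · rw [h1, hr]
  · rw [h2, hr]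
  · rfl

/-- The permutation that decreases on blocks is the only Bruhat-maximal element of its coset,
because it is the one of maximal length. -/
theorem IsBlockDecreasing.isBruhatMaximal_iff {τ ρ : Equiv.Perm (Fin n)}
    (hτ : IsBlockDecreasing μ τ) : IsBruhatMaximal (leftCoset τ μ) ρ ↔ ρ = τ := by
  classical
  have hmem : τ ∈ leftCoset τ μ := mem_leftCoset.mpr fun i => by simp
  constructor
  · rintro ⟨h1, h2⟩
    by_cases hρ : IsBlockDecreasing μ ρ
    · exact hρ.unique hτ h1
    · obtain ⟨σ, h3, h4, h5⟩ := exists_bruhatLE_of_not_isBlockDecreasing h1 hρ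
      rw [h2 σ h3 h4] at h5
      exact absurd h5 (lt_irrefl _)
  · rintro rfl
    refine ⟨hmem, fun σ hσ hle => ?_⟩
    rcases hle.eq_or_lt with h | h
    · exact h.symm
    · obtain ⟨ν, h1, h2⟩ := Finset.exists_max_image
        (Finset.univ.filter fun σ => σ ∈ leftCoset ρ μ) permLength ⟨ρ, by simpa using hmem⟩
      have h1' := (Finset.mem_filter.mp h1).2
      by_cases hν : IsBlockDecreasing μ ν
      · rw [hν.unique hτ h1'] at h2
        exact absurd (h2 σ (by simpa using hσ)) (not_le.mpr h)
      · obtain ⟨κ, h3, -, h5⟩ := exists_bruhatLE_of_not_isBlockDecreasing h1' hν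
        exact absurd (h2 κ (by simpa using h3)) (not_le.mpr h5)

end Coset

/-! ### The permutation produced by the procedure -/

theorem exists_perm_of_perm_range {n : ℕ} {w : List ℕ} (hw : w.Perm (List.range n)) :
    ∃ τ : Equiv.Perm (Fin n), List.ofFn (fun i => (τ i : ℕ)) = w := by
  have hlen : w.length = n := by simpa using hw.length_eq
  have hnd : w.Nodup := hw.nodup_iff.mpr List.nodup_range
  have hlt : ∀ x ∈ w, x < n := fun x hx => List.mem_range.mp (hw.mem_iff.mp hx)
  let f : Fin n → Fin n := fun i => ⟨w[i], hlt _ (List.getElem_mem _)⟩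
  have hf : Function.Injective f := by
    intro i j hij
    have h1 : w[(i : ℕ)] = w[(j : ℕ)] := by simpa [f] using hij
    exact Fin.ext ((List.Nodup.getElem_inj_iff hnd).mp h1)
  refine ⟨Equiv.ofBijective f (Finite.injective_iff_bijective.mp hf), ?_⟩
  refine List.ext_getElem (by simp [hlen]) fun i h1 h2 => ?_
  simp [f]

section Word

variable {n : ℕ} {μ : YoungDiagram} (S : SemistandardYoungTableau μ)

theorem columns_eq_cons (h : 0 < μ.rowLen 0) : ∃ L, columns S = column S 0 :: L := by
  obtain ⟨k, hk⟩ := Nat.exists_eq_succ_of_ne_zero h.ne'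
  rw [columns, hk, List.range_succ_eq_map]
  exact ⟨_, rfl⟩

theorem lineHeads_columns (hS : ∀ i j : ℕ, (i, j) ∈ μ → S i j < n) :
    (lineHeads (μ.colLen 0) (columns S)).Nodup ∧
      ∀ x ∈ lineHeads (μ.colLen 0) (columns S), x < n := by
  rcases Nat.eq_zero_or_pos (μ.rowLen 0) with h | h
  · rw [colLen_eq_zero h.le]
    simp [lineHeads]
  · obtain ⟨L, hL⟩ := columns_eq_cons S h
    have h1 := isTableau_columns S
    rw [hL] at h1 ⊢
    have h2 := h1.lineHeads_spec
    rw [card_column] at h2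
    refine ⟨h2.1, fun x hx => ?_⟩
    rw [← List.mem_toFinset, h2.2, mem_column] at hx
    obtain ⟨i, hi, rfl⟩ := hx
    exact hS i 0 (YoungDiagram.mem_iff_lt_colLen.mpr hi)

theorem leftKeyWord_perm (hS : ∀ i j : ℕ, (i, j) ∈ μ → S i j < n) :
    (leftKeyWord n S).Perm (List.range n) := by
  obtain ⟨h1, h2⟩ := lineHeads_columns S hS
  refine (List.perm_ext_iff_of_nodup ?_ List.nodup_range).mpr fun x => ?_
  · rw [leftKeyWord, List.nodup_append]
    refine ⟨h1, List.nodup_reverse.mpr (List.nodup_range.filter _), ?_⟩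
    rintro x hx y hy rfl
    simp [hx] at hy
  · simp only [leftKeyWord, List.mem_append, List.mem_reverse, List.mem_filter, List.mem_range,
      decide_eq_true_eq]
    have := h2 x
    tauto

variable {S} {τ : Equiv.Perm (Fin n)}

theorem getElem_leftKeyWord (hτ : List.ofFn (fun i => (τ i : ℕ)) = leftKeyWord n S) (i : Fin n) :
    (leftKeyWord n S)[(i : ℕ)]? = some (τ i : ℕ) := by
  rw [← hτ]
  simp

theorem initialLetters_of_leftKeyWord (hμ : μ.colLen 0 ≤ n)
    (hτ : List.ofFn (fun i => (τ i : ℕ)) = leftKeyWord n S) {k : ℕ} (hk : k ≤ μ.colLen 0) :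
    initialLetters τ k = (lineHeads k (columns S)).toFinset := by
  have hlen := length_lineHeads (μ.colLen 0) (columns S)
  have htake : lineHeads k (columns S) = (leftKeyWord n S).take k := by
    rw [← take_lineHeads hk, leftKeyWord, List.take_append_of_le_length (by omega)]
  rw [htake, ← hτ]
  ext x
  rw [List.mem_toFinset, List.mem_take_iff_getElem]
  simp only [initialLetters, Finset.mem_image, Finset.mem_filter, Finset.mem_univ, true_and,
    List.length_ofFn, List.getElem_ofFn]
  constructor
  · rintro ⟨i, hi, rfl⟩
    exact ⟨i, by omega, rfl⟩
  · rintro ⟨i, hi, rfl⟩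
    exact ⟨⟨i, by omega⟩, by simp only; omega, rfl⟩

theorem isBlockDecreasing_of_leftKeyWord
    (hτ : List.ofFn (fun i => (τ i : ℕ)) = leftKeyWord n S) : IsBlockDecreasing μ τ := by
  intro i i' hi hr
  have hlen := length_lineHeads (μ.colLen 0) (columns S)
  have e1 := getElem_leftKeyWord hτ i
  have e2 := getElem_leftKeyWord hτ i'
  rw [leftKeyWord] at e1 e2
  rw [Fin.lt_def]
  -- The first `μ.colLen 0` letters are crossed out by the procedure, the others are in decreasing
  -- order.  The two positions are never on different sides, as they belong to parts of equal size.
  by_cases h1 : (i' : ℕ) < μ.colLen 0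
  · have hpos : 0 < μ.rowLen 0 := (Nat.zero_le _).trans_lt
      ((lt_colLen_iff.mp h1).trans_le (μ.rowLen_anti 0 i' (Nat.zero_le _)))
    rw [List.getElem?_append_left (by omega)] at e1 e2
    obtain ⟨L, hL⟩ := columns_eq_cons S hpos
    have htab := isTableau_columns S
    have hcard : ∀ D ∈ columns S, D.card ≠ (i : ℕ) + 1 := by
      intro D hD hc
      obtain ⟨c, -, rfl⟩ := List.mem_map.mp hD
      rw [card_column] at hc
      have h2 : (i : ℕ) < μ.colLen c := by omega
      have h3 : ¬(i' : ℕ) < μ.colLen c := by omega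
      rw [lt_colLen_iff] at h2 h3
      omega
    rw [hL] at htab hcard e1 e2
    have := htab.lineHeads_decreasing (t := i) (p := μ.colLen 0) (by omega)
      (card_column S 0).ge hcard
    rw [List.getD_eq_getElem?_getD, List.getD_eq_getElem?_getD, ← hi, e1, e2] at this
    simpa using this
  · have h2 : μ.colLen 0 ≤ i := by
      by_contra h2
      rw [lt_colLen_iff] at h1
      rw [not_le, lt_colLen_iff] at h2
      omega
    rw [List.getElem?_append_right (by omega)] at e1 e2
    have hp : ((List.range n).filter fun x =>
        decide (x ∉ lineHeads (μ.colLen 0) (columns S))).reverse.Pairwise (· > ·) := by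
      rw [List.pairwise_reverse]
      exact List.pairwise_lt_range.filter _
    obtain ⟨l1, g1⟩ := List.getElem?_eq_some_iff.mp e1
    obtain ⟨l2, g2⟩ := List.getElem?_eq_some_iff.mp e2
    have := List.pairwise_iff_getElem.mp hp _ _ l1 l2 (by omega)
    omega

end Word

end LeftKey

theorem theorem2p1 (n : ℕ) (μ : YoungDiagram) (hμ : μ.colLen 0 ≤ n)
    (S : SemistandardYoungTableau μ) (hS : ∀ i j : ℕ, (i, j) ∈ μ → S i j < n) :
    ∃ τ : Equiv.Perm (Fin n),
      List.ofFn (fun i => (τ i : ℕ)) = LeftKey.leftKeyWord n S ∧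
      (∀ K : SemistandardYoungTableau μ,
        LeftKey.IsLeftKey S K ↔ K = LeftKey.keyTableau μ hμ τ) ∧
      (∀ σ : Equiv.Perm (Fin n),
        LeftKey.keyTableau μ hμ σ = LeftKey.keyTableau μ hμ τ ↔ σ ∈ LeftKey.leftCoset τ μ) ∧
      (∀ ρ : Equiv.Perm (Fin n),
        LeftKey.IsBruhatMaximal (LeftKey.leftCoset τ μ) ρ ↔ ρ = τ) := by
  obtain ⟨τ, hτ⟩ := LeftKey.exists_perm_of_perm_range (LeftKey.leftKeyWord_perm S hS)
  have hcol : ∀ j, LeftKey.column (LeftKey.keyTableau μ hμ τ) j =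
      (LeftKey.lineHeads (μ.colLen j) (LeftKey.columns S)).toFinset := fun j => by
    rw [LeftKey.column_keyTableau,
      LeftKey.initialLetters_of_leftKeyWord hμ hτ (μ.colLen_anti 0 j (Nat.zero_le j))]
  refine ⟨τ, hτ, fun K => ?_, fun σ => LeftKey.keyTableau_eq_iff hμ,
    fun ρ => (LeftKey.isBlockDecreasing_of_leftKeyWord hτ).isBruhatMaximal_iff⟩
  rw [LeftKey.isLeftKey_iff]
  constructor
  · intro h
    exact LeftKey.eq_of_column_eq fun j hj => (h j hj).trans (hcol j).symm
  · rintro rfl j -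
    exact hcol j
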